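/- Let $M>0$, $\Delta=r(r-2M)$, and consider the Schwarzschild exterior $r>2M$ with signature $(+,-,-,-)$, $ds^2=\frac{\Delta}{r^2}dt^2-\frac{r^2}{\Delta}dr^2-r^2(d\theta^2+\sin^2\theta\,d\phi^2)$, with the Carter coframe $l_a=\frac{1}{\sqrt2 r}(\sqrt\Delta\,dt-\frac{r^2}{\sqrt\Delta}dr)$, $n_a=\frac{1}{\sqrt2 r}(\sqrt\Delta\,dt+\frac{r^2}{\sqrt\Delta}dr)$, $m_a=-\frac{r}{\sqrt2}(d\theta+i\sin\theta\,d\phi)$, the Newman–Penrose derivatives $D=l^a\nabla_a$, $D'=n^a\nabla_a$, $\delta=m^a\nabla_a$, $\delta'=\bar m^a\nabla_a$, $D_t=D+D'$, $D_r=D-D'$, the (real) spin coefficients $\rho=-\rho'=-\frac{\sqrt\Delta}{\sqrt2r^2}$, $\beta=\beta'=\frac{\cot\theta}{2\sqrt2 r}$, $\epsilon=-\epsilon'=\frac{M}{2\sqrt{2\Delta}\,r}$, $\Psi_2=-M/r^3$, and, on scalars of weight $(p,q)$, the GHP derivatives $þ=D-(p+q)\epsilon$, $þ'=D'+(p+q)\epsilon'$,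 $ð=\delta-(p-q)\beta$, $ð'=\delta'+(p-q)\beta$. Let $\hat\psi_4$ be smooth on the exterior (including the axis, as a field of spin weight $-2$), axisymmetric, and such that $\psi=r^4\hat\psi_4$, of weight $(-4,0)$, solves the Teukolsky equation $[(þ'-\rho')(þ+3\rho)-ð'ð-3\Psi_2]\psi=0$. Put $\eta=(þ+3\rho)\psi$ (weight $(-3,1)$), $\Psi_{DHR}=(þ+\rho)\eta$ (weight $(-2,2)$), and let $\gamma_{ab}=-l_al_bU+l_{(a}m_{b)}V-m_am_bW$ with $U=ð^2\psi$, $V=þð\psi+ð\eta$, $W=(þ-\rho)\eta$ be the complex metric perturbation generated by $\psi$. On the slices of constant $t$ (metric $h_{ab}$, derivative $D_a$, lapse $N=\sqrt\Delta/r$) let $q_{ab}$ be the pull-back of $\gamma_{ab}$, and let $p_{ab}$ be determined, with $p=h^{ab}p_{ab}$, by $£_tq_{ab}=2N(p_{ab}-\frac12p\,h_{ab})+2D_{(a}(h_{b)}{}^ct^d\gamma_{cd})$. The axial parts are the parts odd under $\phi\mapsto-\phi$. Let $r_a=(n_a-l_a)/\sqrt2$; on the spheres of constant $t,r$ let $s_{ab}$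 be the (negative definite) metric, $\mathscr D_a$ its derivative, $\mathscr D^2=s^{ab}\mathscr D_a\mathscr D_b$, and $\varepsilon_{ab}=2im_{[a}\bar m_{b]}$. There are smooth axisymmetric (complex) functions $q_1,q_2,p_1,p_2$ and real functions $f,g$, all without $\ell=0,1$ spherical harmonic modes, such that $$q^{axial}_{ab}=2r_{(a}\varepsilon_{b)}{}^c\mathscr D_cq_1-2\varepsilon_{(a}{}^c\mathscr D_{b)}\mathscr D_cq_2,\qquad p^{axial}_{ab}=2r_{(a}\varepsilon_{b)}{}^c\mathscr D_cp_1-2\varepsilon_{(a}{}^c\mathscr D_{b)}\mathscr D_cp_2,\qquad(1)$$ $$-\tfrac1{4r}\left(m_am_b\Psi_{DHR}+\bar m_a\bar m_b\bar\Psi_{DHR}\right)=\mathscr D_a\mathscr D_bf-\tfrac12s_{ab}\mathscr D^2f-\varepsilon_{(a}{}^c\mathscr D_{b)}\mathscr D_cg.\qquad(2)$$ For all smooth axisymmetric functions with (1) and (2), with or without $\ell=0,1$ modes, Moncrief's variables $Q_{RW}=\sqrt\Delta\left(\frac{q_1}{r^2}+\frac{\sqrt\Delta}{r}\partial_r\frac{q_2}{r^2}\right)$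 and $P_{RW}=\frac{2r}{\Delta}\mathscr D^2p_1$ satisfy, away from the axis: 1. $(\delta-2\beta)\delta Q_{RW}=\frac{i\sqrt\Delta}{4\sqrt2r^2}[D_rW+ð'V]=\frac{i\sqrt\Delta}{4\sqrt2r^2}D_t\Psi_{DHR}$ and $P_{RW}=-\frac{ir}{2\Delta}ð(þ+\rho)V=-\frac{ir}{\Delta}ð^2\Psi_{DHR}$. 2. $\Psi_{DHR}=-4r(\delta-2\beta)\delta(f+ig)$, and $Q_{RW}=-i£_t(f+ig)$ up to $\ell=0,1$ modes, i.e. up to a term $a(t,r)+b(t,r)\cos\theta$; this term vanishes if $q_1,q_2,f,g$ have no $\ell=0,1$ modes. 3. Let $\phi^a=\partial_\phi$, $\Phi=-\phi_a\phi^a=r^2\sin^2\theta$, and let the slices carry the volume form $\varepsilon_{abc}=o\cdot3r_{[a}\varepsilon_{bc]}$, where $o=\pm1$ is the choice of orientation. The perturbed twist potential $\omega$, defined by $p^{axial}_{ab}\phi^b=\frac12\Phi^{-1}\varepsilon_a{}^{bc}\phi_cD_b\omega$, is $$\omega=-o\,\tfrac i2\,r^2\sin^2\theta\;\Psi_{DHR}:$$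 the right side is smooth and solves this equation, every smooth axisymmetric solution differs from it by a function of $t$ alone, and it is the only one that vanishes on the axis. Thus $\omega=\frac i2r^2\sin^2\theta\,\Psi_{DHR}$ for the orientation $\varepsilon_{ab}=r^c\varepsilon_{cab}$ ($o=-1$), and $\omega$ has the opposite sign for $o=1$, where the equation reads $p^{axial}_{ab}\phi^b=-\frac1{r\sin\theta}[\frac1{\sqrt2}\delta\omega\,r_a+\frac14D_r\omega\,(m_a+\bar m_a)]$. -/

import Mathlib

noncomputable section

namespace Schwarzschild

/-- An axisymmetric complex field in Schwarzschild coordinates, as a function of `(t, r, θ)`.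
Components of axisymmetric tensors in the coordinate basis are also of this type: they do not
depend on `φ`. -/
abbrev Field := ℝ → ℝ → ℝ → ℂ

/-- Coordinate components of a covector; the indices `0, 1, 2, 3` stand for `t, r, θ, φ`. -/
abbrev Covector := Fin 4 → Field

/-- Coordinate components of a tensor with two lower indices. -/
abbrev Tensor2 := Fin 4 → Fin 4 → Field

/-- The coordinate derivative `∂_i`. On axisymmetric components `∂_φ` is zero. -/
def pd (i : Fin 4) (ξ : Field) : Field :=
  match i with
  | 0 => fun t r θ => deriv (fun s => ξ s r θ) t
  | 1 => fun t r θ => deriv (fun s => ξ t s θ) r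
  | 2 => fun t r θ => deriv (fun s => ξ t r s) θ
  | 3 => fun _ _ _ => 0

/-- The index set of the slices `Σ` of constant `t`. -/
def slice : Finset (Fin 4) := {1, 2, 3}

/-- The index set of the spheres of constant `t` and `r`. -/
def sphere : Finset (Fin 4) := {2, 3}

/-- The exterior region away from the axis. -/
def Exterior (M r θ : ℝ) : Prop := 2 * M < r ∧ 0 < θ ∧ θ < Real.pi

/-! ### Background metric, Carter frame and spin coefficients -/

/-- `Δ = r (r - 2M)`. -/
def Del (M r : ℝ) : ℝ := r * (r - 2 * M)

/-- The coordinate function `r`. -/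
def rad : Field := fun _ r _ => (r : ℂ)

/-- `√Δ`. -/
def sqrtDel (M : ℝ) : Field := fun _ r _ => (Real.sqrt (Del M r) : ℂ)

/-- `sin θ`. -/
def sinF : Field := fun _ _ θ => (Real.sin θ : ℂ)

/-- `√2`, as a constant. -/
def rt2 : ℂ := (Real.sqrt 2 : ℂ)

/-- The diagonal components of the Schwarzschild metric of signature `(+,-,-,-)`. -/
def metricDiag (M : ℝ) : Covector := fun a =>
  match a with
  | 0 => fun _ r _ => ((Del M r / r ^ 2 : ℝ) : ℂ)
  | 1 => fun _ r _ => ((-(r ^ 2 / Del M r) : ℝ) : ℂ)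
  | 2 => fun _ r _ => ((-r ^ 2 : ℝ) : ℂ)
  | 3 => fun _ r θ => ((-(r ^ 2 * Real.sin θ ^ 2) : ℝ) : ℂ)

/-- The metric `g_{ab}`. Its restrictions to the index sets `slice` and `sphere` are the (negative
definite) induced metrics `h_{ab}` and `s_{ab}`. -/
def metric (M : ℝ) : Tensor2 := fun a b => if a = b then metricDiag M a else 0

/-- The inverse metric `g^{ab}`; it restricts to the inverses `h^{ab}` and `s^{ab}`, the metric
being diagonal. -/
def invMetric (M : ℝ) : Tensor2 := fun a b => if a = b then (metricDiag M a)⁻¹ else 0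

/-- The NP derivative `D = l^a ∂_a`. -/
def npD (M : ℝ) (ξ : Field) : Field := fun t r θ =>
  1 / (rt2 * r) * ((r : ℂ) ^ 2 / sqrtDel M t r θ * pd 0 ξ t r θ + sqrtDel M t r θ * pd 1 ξ t r θ)

/-- The NP derivative `D' = n^a ∂_a`. -/
def npD' (M : ℝ) (ξ : Field) : Field := fun t r θ =>
  1 / (rt2 * r) * ((r : ℂ) ^ 2 / sqrtDel M t r θ * pd 0 ξ t r θ - sqrtDel M t r θ * pd 1 ξ t r θ)

/-- The NP derivative `δ = m^a ∂_a`. -/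
def npDelta (ξ : Field) : Field := fun t r θ =>
  1 / (rt2 * r) * (pd 2 ξ t r θ + Complex.I / Real.sin θ * pd 3 ξ t r θ)

/-- The NP derivative `δ' = m̄^a ∂_a`. -/
def npDelta' (ξ : Field) : Field := fun t r θ =>
  1 / (rt2 * r) * (pd 2 ξ t r θ - Complex.I / Real.sin θ * pd 3 ξ t r θ)

/-- `D_t = D + D'`. -/
def Dt (M : ℝ) (ξ : Field) : Field := npD M ξ + npD' M ξ

/-- `D_r = D - D'`. -/
def Dr (M : ℝ) (ξ : Field) : Field := npD M ξ - npD' M ξ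

/-- The covector `l_a` of the Carter coframe. -/
def coL (M : ℝ) : Covector := fun a =>
  match a with
  | 0 => fun t r θ => 1 / (rt2 * r) * sqrtDel M t r θ
  | 1 => fun t r θ => -(1 / (rt2 * r) * ((r : ℂ) ^ 2 / sqrtDel M t r θ))
  | 2 => 0
  | 3 => 0

/-- The covector `n_a` of the Carter coframe. -/
def coN (M : ℝ) : Covector := fun a =>
  match a with
  | 0 => fun t r θ => 1 / (rt2 * r) * sqrtDel M t r θ
  | 1 => fun t r θ => 1 / (rt2 * r) * ((r : ℂ) ^ 2 / sqrtDel M t r θ)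
  | 2 => 0
  | 3 => 0

/-- The covector `m_a` of the Carter coframe. -/
def coM : Covector := fun a =>
  match a with
  | 0 => 0
  | 1 => 0
  | 2 => fun _ r _ => -(r / rt2)
  | 3 => fun _ r θ => -(r / rt2) * (Complex.I * Real.sin θ)

/-- The complex conjugate of a field. -/
def conjF (ξ : Field) : Field := fun t r θ => (starRingEnd ℂ) (ξ t r θ)

/-- The covector `m̄_a`. -/
def coMbar : Covector := fun a => conjF (coM a)

/-- The unit radial normal `r_a = (n_a - l_a) / √2` on the slices. -/
def coR (M : ℝ) : Covector := fun a => (1 / rt2) • (coN M a - coL M a)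

/-- The spin coefficient `ρ` of the Carter frame; `ρ' = -ρ`. All spin coefficients are real. -/
def spinRho (M : ℝ) : Field := fun _ r _ =>
  ((-(Real.sqrt (Del M r) / (Real.sqrt 2 * r ^ 2)) : ℝ) : ℂ)

/-- The spin coefficient `ρ'`. -/
def spinRho' (M : ℝ) : Field := -spinRho M

/-- The spin coefficient `β = β'`. -/
def spinBeta : Field := fun _ r θ =>
  ((Real.cos θ / Real.sin θ / (2 * Real.sqrt 2 * r) : ℝ) : ℂ)

/-- The spin coefficient `ε`. -/
def spinEps (M : ℝ) : Field := fun _ r _ =>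
  ((M / (2 * Real.sqrt (2 * Del M r) * r) : ℝ) : ℂ)

/-- The spin coefficient `ε' = -ε`. -/
def spinEps' (M : ℝ) : Field := -spinEps M

/-- The curvature component `Ψ₂ = -M / r³`. -/
def weyl2 (M : ℝ) : Field := fun _ r _ => ((-(M / r ^ 3) : ℝ) : ℂ)

/-! ### GHP derivatives of a scalar of weight `(p, q)` in the Carter frame -/

/-- `þ ξ = (D - p ε - q ε̄) ξ`. -/
def thorn (M : ℝ) (p q : ℤ) (ξ : Field) : Field :=
  npD M ξ - (p : ℂ) • (spinEps M * ξ) - (q : ℂ) • (spinEps M * ξ)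

/-- `þ' ξ = (D' + p ε' + q ε̄') ξ`. -/
def thorn' (M : ℝ) (p q : ℤ) (ξ : Field) : Field :=
  npD' M ξ + (p : ℂ) • (spinEps' M * ξ) + (q : ℂ) • (spinEps' M * ξ)

/-- `ð ξ = (δ - p β + q β̄') ξ`. -/
def eth (p q : ℤ) (ξ : Field) : Field :=
  npDelta ξ - (p : ℂ) • (spinBeta * ξ) + (q : ℂ) • (spinBeta * ξ)

/-- `ð' ξ = (δ' + p β' - q β̄) ξ`. -/
def eth' (p q : ℤ) (ξ : Field) : Field :=
  npDelta' ξ + (p : ℂ) • (spinBeta * ξ) - (q : ℂ) • (spinBeta * ξ)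

/-! ### Hertz potential and the complex metric perturbation it generates -/

/-- `η = (þ + 3ρ) ψ`, of weight `(-3, 1)`, for `ψ` of weight `(-4, 0)`. -/
def hertzEta (M : ℝ) (ψ : Field) : Field := thorn M (-4) 0 ψ + (3 : ℂ) • (spinRho M * ψ)

/-- The spin-`(-2)` Teukolsky operator
`[(þ' - ρ̄')(þ + 3ρ) - ð' ð - 3 Ψ₂] ψ` on `ψ` of weight `(-4, 0)`. -/
def teukolsky (M : ℝ) (ψ : Field) : Field :=
  (thorn' M (-3) 1 (hertzEta M ψ) - spinRho' M * hertzEta M ψ)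
    - eth' (-3) (-1) (eth (-4) 0 ψ) - (3 : ℂ) • (weyl2 M * ψ)

/-- `ψ` is a Hertz potential: it solves the spin-`(-2)` Teukolsky equation on the exterior. -/
def IsHertzPotential (M : ℝ) (ψ : Field) : Prop :=
  ∀ t r θ, Exterior M r θ → teukolsky M ψ t r θ = 0

/-- `U = ð² ψ`, of weight `(-2, -2)`. -/
def hertzU (ψ : Field) : Field := eth (-3) (-1) (eth (-4) 0 ψ)

/-- `V = [þ ð + ð (þ + 3ρ)] ψ`, of weight `(-2, 0)`. -/
def hertzV (M : ℝ) (ψ : Field) : Field :=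
  thorn M (-3) (-1) (eth (-4) 0 ψ) + eth (-3) 1 (hertzEta M ψ)

/-- `W = (þ - ρ)(þ + 3ρ) ψ`, of weight `(-2, 2)`. -/
def hertzW (M : ℝ) (ψ : Field) : Field :=
  thorn M (-3) 1 (hertzEta M ψ) - spinRho M * hertzEta M ψ

/-- The complex metric perturbation generated by `ψ`,
`γ_{ab} = - l_a l_b U + l_{(a} m_{b)} V - m_a m_b W`. -/
def hertzMetric (M : ℝ) (ψ : Field) : Tensor2 := fun a b =>
  -(coL M a * coL M b * hertzU ψ)
    + (1 / 2 : ℂ) • ((coL M a * coM b + coM a * coL M b) * hertzV M ψ)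
    - coM a * coM b * hertzW M ψ

/-- The DHR scalar `Ψ_DHR = (þ + ρ)(þ + 3ρ) ψ`, of weight `(-2, 2)`. -/
def dhrScalar (M : ℝ) (ψ : Field) : Field :=
  thorn M (-3) 1 (hertzEta M ψ) + spinRho M * hertzEta M ψ

/-- The DHR tensor `Ψ_{ab} = -(r/4) (m_a m_b Ψ_DHR + m̄_a m̄_b Ψ̄_DHR)`. -/
def dhrTensor (M : ℝ) (ψ : Field) : Tensor2 := fun a b =>
  -((1 / 4 : ℂ) • (rad * (coM a * coM b * dhrScalar M ψ
    + coMbar a * coMbar b * conjF (dhrScalar M ψ))))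

/-! ### Covariant derivatives on the slices and the spheres -/

/-- The Christoffel symbols `Γ^c_{ab}` of the metric induced on the surfaces with index set `S`. -/
def christoffel (M : ℝ) (S : Finset (Fin 4)) (c a b : Fin 4) : Field :=
  (1 / 2 : ℂ) • ∑ d ∈ S, invMetric M c d *
    (pd a (metric M d b) + pd b (metric M d a) - pd d (metric M a b))

/-- The covariant derivative `∇_a v_b` of a covector tangential to the surfaces with index set
`S`; it is a tangential tensor, so its other components are zero. -/
def covD (M : ℝ) (S : Finset (Fin 4)) (v : Covector) : Tensor2 := fun a b =>
  if a ∈ S ∧ b ∈ S then pd a (v b) - ∑ c ∈ S, christoffel M S c a b * v c else 0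

/-- The second covariant derivative `𝒟_a 𝒟_b f` on the spheres. -/
def hessS (M : ℝ) (f : Field) : Tensor2 := covD M sphere (fun b => pd b f)

/-- The Laplacian `𝒟² f = s^{ab} 𝒟_a 𝒟_b f` on the spheres (`s_{ab}` is negative definite). -/
def lapS (M : ℝ) (f : Field) : Field :=
  ∑ a ∈ sphere, ∑ b ∈ sphere, invMetric M a b * hessS M f a b

/-- The volume form `ε_{ab} = 2 i m_{[a} m̄_{b]}` of the spheres. -/
def volS : Tensor2 := fun a b => Complex.I • (coM a * coMbar b - coMbar a * coM b)

/-- `ε_a{}^c`. -/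
def volSMixed (M : ℝ) : Tensor2 := fun a c => ∑ d ∈ sphere, volS a d * invMetric M d c

/-! ### Initial data on the slices -/

/-- The lapse `N = √Δ / r`. -/
def lapse (M : ℝ) : Field := sqrtDel M * rad⁻¹

/-- `2 D_{(a} (h_{b)}{}^c t^d γ_{cd})`, the contribution of the perturbed shift. -/
def shiftTerm (M : ℝ) (γ : Tensor2) : Tensor2 := fun a b =>
  covD M slice (fun c => γ c 0) a b + covD M slice (fun c => γ c 0) b a

/-- `(£_t q_{ab} - 2 D_{(a} (h_{b)}{}^c t^d γ_{cd})) / (2N)`, where `q_{ab}` is the restriction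
of `γ_{ab}` to the index set `slice`. -/
def velocity (M : ℝ) (γ : Tensor2) : Tensor2 := fun a b =>
  (1 / 2 : ℂ) • ((lapse M)⁻¹ * (pd 0 (γ a b) - shiftTerm M γ a b))

/-- The trace `h^{ab} T_{ab}` on the slices. -/
def traceH (M : ℝ) (T : Tensor2) : Field :=
  ∑ a ∈ slice, ∑ b ∈ slice, invMetric M a b * T a b

/-- The linearized ADM momentum `p_{ab}` of `γ_{ab}` (components with indices in `slice`), i.e.
the solution of the linearized evolution equation proved in `admMomentum_evolution`. -/
def admMomentum (M : ℝ) (γ : Tensor2) : Tensor2 := fun a b =>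
  velocity M γ a b - traceH M (velocity M γ) * metric M a b

/-- The effect of the reflection `φ ↦ -φ` on a coordinate component. -/
def reflSign (a : Fin 4) : ℂ := if a = 3 then -1 else 1

/-- The axial part of a tensor, i.e. the part odd under the reflection `φ ↦ -φ`. -/
def axial (T : Tensor2) : Tensor2 := fun a b =>
  (1 / 2 : ℂ) • (T a b - (reflSign a * reflSign b) • T a b)

/-- The form `2 r_{(a} ε_{b)}{}^c 𝒟_c u₁ - 2 ε_{(a}{}^c 𝒟_{b)} 𝒟_c u₂` of an axial tensor. -/
def moncriefForm (M : ℝ) (u₁ u₂ : Field) : Tensor2 := fun a b =>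
  (∑ c ∈ sphere, (coR M a * volSMixed M b c + coR M b * volSMixed M a c) * pd c u₁)
    - ∑ c ∈ sphere, (volSMixed M a c * hessS M u₂ b c + volSMixed M b c * hessS M u₂ a c)

/-- `u₁, u₂` are Moncrief potentials of the axial tensor `T` on the slices. -/
def IsMoncrief (M : ℝ) (T : Tensor2) (u₁ u₂ : Field) : Prop :=
  ∀ t r θ, Exterior M r θ → ∀ a ∈ slice, ∀ b ∈ slice,
    T a b t r θ = moncriefForm M u₁ u₂ a b t r θ

/-- The Regge-Wheeler variable `Q_RW = √Δ (q₁ / r² + (√Δ / r) ∂_r (q₂ / r²))`. -/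
def rwQ (M : ℝ) (q₁ q₂ : Field) : Field :=
  sqrtDel M * (q₁ * (rad ^ 2)⁻¹ + sqrtDel M * rad⁻¹ * pd 1 (q₂ * (rad ^ 2)⁻¹))

/-- Its conjugate momentum `P_RW = (2 r / Δ) 𝒟² p₁`. -/
def rwP (M : ℝ) (p₁ : Field) : Field := fun t r θ => 2 * r / (Del M r : ℂ) * lapS M p₁ t r θ

/-- `(δ - 2β) δ ξ`. -/
def deltaDelta (ξ : Field) : Field :=
  npDelta (npDelta ξ) - (2 : ℂ) • (spinBeta * npDelta ξ)

/-- A real field, regarded as a complex one. -/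
def ofRealF (f : ℝ → ℝ → ℝ → ℝ) : Field := fun t r θ => (f t r θ : ℂ)

/-- `f, g` are potentials of the DHR tensor of `ψ`:
`Ψ_{ab} / r² = 𝒟_a 𝒟_b f - (1/2) s_{ab} 𝒟² f - ε_{(a}{}^c 𝒟_{b)} 𝒟_c g`. -/
def IsDHRPotentials (M : ℝ) (ψ : Field) (f g : ℝ → ℝ → ℝ → ℝ) : Prop :=
  ∀ t r θ, Exterior M r θ → ∀ a ∈ sphere, ∀ b ∈ sphere,
    dhrTensor M ψ a b t r θ / (r : ℂ) ^ 2 =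
      hessS M (ofRealF f) a b t r θ
        - 1 / 2 * (metric M a b t r θ * lapS M (ofRealF f) t r θ)
        - 1 / 2 * ∑ c ∈ sphere,
            (volSMixed M a c t r θ * hessS M (ofRealF g) b c t r θ
              + volSMixed M b c t r θ * hessS M (ofRealF g) a c t r θ)

/-- The volume form `ε_{abc} = o · 3 r_{[a} ε_{bc]}` of the slices; `o = 1` and `o = -1` are the two
orientations. -/
def volH (M : ℝ) (o : ℝ) (a b c : Fin 4) : Field :=
  (o : ℂ) • (coR M a * volS b c + coR M b * volS c a + coR M c * volS a b)

/-- `ω` is a twist potential of the axial momentum `p_{ab}`: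
`p_{ab} φ^b = (1/2) Φ⁻¹ ε_a{}^{bc} φ_c D_b ω` with `φ^a = ∂_φ` and `Φ = - φ_a φ^a`. -/
def IsTwistPotential (M : ℝ) (o : ℝ) (p : Tensor2) (ω : Field) : Prop :=
  ∀ t r θ, Exterior M r θ → ∀ a ∈ slice,
    p a 3 t r θ = 1 / 2 * (-(metric M 3 3 t r θ))⁻¹ *
      ∑ b ∈ slice, ∑ c ∈ slice, (∑ d ∈ slice, ∑ e ∈ slice,
        volH M o a d e t r θ * invMetric M d b t r θ * invMetric M e c t r θ)
          * metric M c 3 t r θ * pd b ω t r θ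

/-! ### Regularity and spherical modes -/

/-- `ξ` is the component in the frame `m` of a smooth axisymmetric field of spin weight `k` or `-k`
on the exterior including the axis: `ξ = sin^k θ · F (t, r, cos θ)` with `F` smooth.
For `k = 0` these are the smooth axisymmetric functions. -/
def SmoothSpin (M : ℝ) (k : ℕ) (ξ : Field) : Prop :=
  ∃ F : ℝ × ℝ × ℝ → ℂ, ContDiffOn ℝ ((⊤ : ℕ∞) : WithTop ℕ∞) F {x | 2 * M < x.2.1} ∧
    ∀ t r θ : ℝ, 2 * M < r → 0 ≤ θ → θ ≤ Real.pi →
      ξ t r θ = (Real.sin θ : ℂ) ^ k * F (t, r, Real.cos θ)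

/-- The axisymmetric function `ξ` has no part of spherical-harmonic order `ℓ = 0` or `ℓ = 1` on any
sphere. -/
def NoLowModes (M : ℝ) (ξ : Field) : Prop :=
  ∀ t r : ℝ, 2 * M < r →
    ∫ θ in (0 : ℝ)..Real.pi, ξ t r θ * Real.sin θ = 0 ∧
    ∫ θ in (0 : ℝ)..Real.pi, ξ t r θ * Real.cos θ * Real.sin θ = 0

/-- The momentum `p_{ab}` solves the linearized ADM evolution equation
`£_t q_{ab} = 2N (p_{ab} - (1/2) p h_{ab}) + 2 D_{(a} (h_{b)}{}^c t^d γ_{cd})`. -/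
theorem admMomentum_evolution (M : ℝ) (hM : 0 < M) (γ : Tensor2) (t r θ : ℝ)
    (h : Exterior M r θ) (a b : Fin 4) :
    pd 0 (γ a b) t r θ =
      2 * lapse M t r θ * (admMomentum M γ a b t r θ
        - 1 / 2 * traceH M (admMomentum M γ) t r θ * metric M a b t r θ)
      + shiftTerm M γ a b t r θ := by
  obtain ⟨hr, h0, hπ⟩ := h
  have hr0 : 0 < r := by linarith
  have hD : 0 < Del M r := mul_pos hr0 (by linarith)
  have hs : 0 < Real.sin θ := Real.sin_pos_of_pos_of_lt_pi h0 hπ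
  have hN : lapse M t r θ ≠ 0 := by
    have h1 : (Real.sqrt (Del M r) : ℂ) ≠ 0 := by
      exact_mod_cast (Real.sqrt_pos.2 hD).ne'
    have h2 : (r : ℂ) ≠ 0 := by exact_mod_cast hr0.ne'
    simp [lapse, sqrtDel, rad, h1, h2]
  have key : ∀ c ∈ slice, invMetric M c c t r θ * metric M c c t r θ = 1 := by
    have hDc : (Del M r : ℂ) ≠ 0 := by exact_mod_cast hD.ne'
    have hrc : (r : ℂ) ≠ 0 := by exact_mod_cast hr0.ne'
    have hsc : Complex.sin (θ : ℂ) ≠ 0 := by exact_mod_cast hs.ne'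
    intro c hc
    simp only [slice, Finset.mem_insert, Finset.mem_singleton] at hc
    rcases hc with rfl | rfl | rfl <;>
      simp [invMetric, metric, metricDiag] <;> field_simp
  have tr : traceH M (admMomentum M γ) t r θ = -2 * traceH M (velocity M γ) t r θ := by
    have e1 := key 1 (by simp [slice])
    have e2 := key 2 (by simp [slice])
    have e3 := key 3 (by simp [slice])
    have off : ∀ c d : Fin 4, c ≠ d → invMetric M c d = 0 := fun c d hcd => by
      simp [invMetric, hcd]
    have expand : ∀ T : Tensor2, traceH M T t r θ = invMetric M 1 1 t r θ * T 1 1 t r θ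
        + invMetric M 2 2 t r θ * T 2 2 t r θ + invMetric M 3 3 t r θ * T 3 3 t r θ := by
      intro T
      simp [traceH, slice, off]
      ring
    rw [expand (admMomentum M γ)]
    simp only [admMomentum, Pi.sub_apply, Pi.mul_apply]
    have ev := expand (velocity M γ)
    linear_combination (-1 : ℂ) * ev - traceH M (velocity M γ) t r θ * (e1 + e2 + e3)
  rw [tr]
  simp only [admMomentum, velocity, Pi.sub_apply, Pi.mul_apply, Pi.smul_apply, Pi.inv_apply,
    smul_eq_mul]
  field_simp
  ring

end Schwarzschild

end

noncomputable section

namespace Schwarzschild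

/-! By axisymmetry, a field of weight (p, q) with q - p = 2k is sin^k θ · G(t, r, x), with x = cos θ
and G smooth. With a factor √2 on each frame derivative, the GHP operators act on G through the
commuting derivations ∂_t, ∂_r, ∂_x and the functions r, 1/r, √Δ, 1/√Δ, x; the mass disappears
through 2Mr = r² - Δ. The theorem thus becomes a computation in the differential algebra
`smoothAlg`, and `Rep` is the dictionary.

Two groups of identities carry it. The first needs no field equation: þρ = ρ² and [þ, ð] = ρ ð give
V = 2 ð(þ + 2ρ)ψ (`vE_eq`) and Ψ_DHR = (þ + 2ρ)²ψ (`dhrE_eq`), hence (þ + ρ)V = 2 ð Ψ_DHR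
(`thorn_vE`). The second uses the Teukolsky equation: commuting ð' ð past þ gives ð'V = 2 þ ð'ðψ,
the equation replaces ð'ðψ, and the commutator [þ, þ'] together with þΨ₂ = 3ρΨ₂ yields D_r W + ð'V =
D_t Ψ_DHR (`dhr_evolution`), from which `twist_radial` follows.

An axial symmetric tensor on a slice has only the components rφ and θφ. Moncrief's equations
therefore prescribe ∂_x of the first potential and ∂_x² of the second. So ∂_x² Q_RW is a multiple of
D_r W + ð'V, while f + ig satisfies r Ψ_DHR = -2 sin²θ ∂_x²(f + ig). Hence Q_RW + i ∂_t(f + ig) is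
linear in x, which is the freedom ℓ = 0, 1, and two vanishing moments remove it. The rφ component of
the momentum is a multiple of (þ + ρ)V, which gives both P_RW and ∂_θ ω; the θφ component gives ∂_r
ω. Since both derivatives are prescribed, ω is unique up to a function of t.

G is smooth for all real x, but the equations constrain it only for |x| ≤ 1. The identities in the
algebra therefore keep the Teukolsky expression `teukE` as an explicit remainder, and consequences
of the field equations are stated with `Vanishes`, a condition on [-1, 1] that is stable under the
three derivations. -/

section

/-- The region `r > 2M` in the coordinates `(t, r, cos θ)`; the third coordinate is unrestricted. -/
def region (M : ℝ) : Set (ℝ × ℝ × ℝ) := {x | 2 * M < x.2.1}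

theorem isOpen_region (M : ℝ) : IsOpen (region M) :=
  isOpen_lt continuous_const (continuous_fst.comp continuous_snd)

/-! ### Smooth dependence of integrals on parameters -/

section Parametric

variable {E : Type} [NormedAddCommGroup E] [NormedSpace ℝ E] [ProperSpace E]

/-- The x-derivative of K is continuous, hence bounded on the compact product of a small closed ball
with [0, 1]; this constant is the dominating function. Properness of E gives the compactness. -/
theorem hasFDerivAt_integral_of_contDiffOn {F : Type} [NormedAddCommGroup F] [NormedSpace ℝ F]
    [CompleteSpace F] {U : Set E} (hU : IsOpen U) {K : E × ℝ → F}
    (hK : ContDiffOn ℝ 1 K (U ×ˢ Set.univ)) {p : E} (hp : p ∈ U) :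
    HasFDerivAt (fun q => ∫ u in (0 : ℝ)..1, K (q, u))
      (∫ u in (0 : ℝ)..1, (fderiv ℝ K (p, u)).comp (ContinuousLinearMap.inl ℝ E ℝ)) p := by
  have hUo : IsOpen (U ×ˢ (Set.univ : Set ℝ)) := hU.prod isOpen_univ
  obtain ⟨ε, hε, hball⟩ := Metric.nhds_basis_closedBall.mem_iff.1 (hU.mem_nhds hp)
  have hK' : ContinuousOn
      (fun z : E × ℝ => (fderiv ℝ K z).comp (ContinuousLinearMap.inl ℝ E ℝ)) (U ×ˢ Set.univ) := by
    have := hK.continuousOn_fderiv_of_isOpen hUo le_rfl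
    exact this.clm_comp continuousOn_const
  have hline : ∀ q ∈ U, Set.MapsTo (fun u : ℝ => (q, u)) Set.univ (U ×ˢ Set.univ) :=
    fun q hq u _ => ⟨hq, trivial⟩
  have hcont : ∀ q ∈ U, Continuous (fun u : ℝ => K (q, u)) := fun q hq =>
    continuousOn_univ.1 (hK.continuousOn.comp (by fun_prop) (hline q hq))
  have hcont' : Continuous
      (fun u : ℝ => (fderiv ℝ K (p, u)).comp (ContinuousLinearMap.inl ℝ E ℝ)) :=
    continuousOn_univ.1 (hK'.comp (f := fun u : ℝ => (p, u)) (by fun_prop) (hline p hp))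
  obtain ⟨C, hC⟩ := ((isCompact_closedBall p ε).prod
    (isCompact_Icc (a := (0 : ℝ)) (b := 1))).exists_bound_of_continuousOn
    (hK'.mono (fun z hz => ⟨hball hz.1, trivial⟩))
  refine intervalIntegral.hasFDerivAt_integral_of_dominated_of_fderiv_le
    (s := Metric.ball p ε) (bound := fun _ => C)
    (F' := fun q u => (fderiv ℝ K (q, u)).comp (ContinuousLinearMap.inl ℝ E ℝ))
    (Metric.ball_mem_nhds p hε) ?_ ?_ ?_ ?_ ?_ ?_
  · filter_upwards [hU.mem_nhds hp] with q hq using (hcont q hq).aestronglyMeasurable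
  · exact (hcont p hp).intervalIntegrable _ _
  · exact hcont'.aestronglyMeasurable
  · refine Filter.Eventually.of_forall fun u hu q hq => hC (q, u) ⟨Metric.ball_subset_closedBall hq, ?_⟩
    rw [Set.uIoc_of_le zero_le_one] at hu
    exact ⟨hu.1.le, hu.2⟩
  · exact intervalIntegrable_const
  · refine Filter.Eventually.of_forall fun u _ q hq => ?_
    have hqU := hball (Metric.ball_subset_closedBall hq)
    have h1 : HasFDerivAt K (fderiv ℝ K (q, u)) (q, u) :=
      ((hK.contDiffAt (hUo.mem_nhds ⟨hqU, trivial⟩)).differentiableAt one_ne_zero).hasFDerivAt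
    exact h1.comp q (hasFDerivAt_prodMk_left q u)

/-- The derivative is again a parameter integral, but with values in the linear maps from E to F, so
the induction on the order has to quantify over the codomain. -/
theorem contDiffOn_integral_nat {U : Set E} (hU : IsOpen U) (n : ℕ) :
    ∀ {F : Type} [NormedAddCommGroup F] [NormedSpace ℝ F] [CompleteSpace F] {K : E × ℝ → F},
      ContDiffOn ℝ ((⊤ : ℕ∞) : WithTop ℕ∞) K (U ×ˢ Set.univ) →
      ContDiffOn ℝ n (fun q => ∫ u in (0 : ℝ)..1, K (q, u)) U := by
  have hUo : IsOpen (U ×ˢ (Set.univ : Set ℝ)) := hU.prod isOpen_univ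
  induction n with
  | zero =>
    intro F _ _ _ K hK
    refine contDiffOn_zero.2 fun p hp => ?_
    exact (hasFDerivAt_integral_of_contDiffOn hU (hK.of_le (by exact_mod_cast le_top))
      hp).continuousAt.continuousWithinAt
  | succ n ih =>
    intro F _ _ _ K hK
    have hder := fun p hp => hasFDerivAt_integral_of_contDiffOn hU
      (hK.of_le (by exact_mod_cast le_top)) (p := p) hp
    rw [Nat.cast_succ, contDiffOn_succ_iff_fderiv_of_isOpen hU]
    refine ⟨fun p hp => (hder p hp).differentiableAt.differentiableWithinAt, by simp, ?_⟩
    have hK' : ContDiffOn ℝ ((⊤ : ℕ∞) : WithTop ℕ∞)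
        (fun z : E × ℝ => (fderiv ℝ K z).comp (ContinuousLinearMap.inl ℝ E ℝ))
        (U ×ˢ Set.univ) :=
      (hK.fderiv_of_isOpen hUo (by simp)).clm_comp contDiffOn_const
    exact (ih hK').congr fun p hp => (hder p hp).fderiv

theorem contDiffOn_integral {U : Set E} (hU : IsOpen U)
    {F : Type} [NormedAddCommGroup F] [NormedSpace ℝ F] [CompleteSpace F] {K : E × ℝ → F}
    (hK : ContDiffOn ℝ ((⊤ : ℕ∞) : WithTop ℕ∞) K (U ×ˢ Set.univ)) :
    ContDiffOn ℝ ((⊤ : ℕ∞) : WithTop ℕ∞) (fun q => ∫ u in (0 : ℝ)..1, K (q, u)) U :=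
  contDiffOn_infty.2 fun n => contDiffOn_integral_nat hU n hK

end Parametric

theorem exists_primitive {M : ℝ} {F : ℝ × ℝ × ℝ → ℂ}
    (hF : ContDiffOn ℝ ((⊤ : ℕ∞) : WithTop ℕ∞) F (region M)) :
    ∃ P : ℝ × ℝ × ℝ → ℂ, ContDiffOn ℝ ((⊤ : ℕ∞) : WithTop ℕ∞) P (region M) ∧
      ∀ t r x : ℝ, 2 * M < r → HasDerivAt (fun y => P (t, r, y)) (F (t, r, x)) x := by
  -- This is the integral of F from 0 to x after the substitution y = xu: the limits become fixed.
  -- The points (t, r, xu) stay in the region because the third coordinate is unrestricted.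
  refine ⟨fun p => p.2.2 • ∫ u in (0 : ℝ)..1, F (p.1, p.2.1, p.2.2 * u), ?_, ?_⟩
  · refine ContDiffOn.smul (f := fun p : ℝ × ℝ × ℝ => p.2.2) (by fun_prop) ?_
    refine contDiffOn_integral (isOpen_region M)
      (K := fun z : (ℝ × ℝ × ℝ) × ℝ => F (z.1.1, z.1.2.1, z.1.2.2 * z.2)) ?_
    refine hF.comp (g := F) (f := fun z : (ℝ × ℝ × ℝ) × ℝ => (z.1.1, z.1.2.1, z.1.2.2 * z.2))
      ?_ fun z hz => hz.1
    fun_prop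
  · intro t r x hr
    have hc : Continuous fun y : ℝ => F (t, r, y) :=
      continuousOn_univ.1 (hF.continuousOn.comp (f := fun y : ℝ => (t, r, y)) (by fun_prop)
        (fun y _ => hr))
    have h1 := intervalIntegral.integral_hasDerivAt_right (hc.intervalIntegrable 0 x)
      (hc.stronglyMeasurableAtFilter _ _) hc.continuousAt
    refine h1.congr_of_eventuallyEq (Filter.Eventually.of_forall fun y => ?_)
    simp only
    rw [intervalIntegral.smul_integral_comp_mul_left (fun v => F (t, r, v)) y]
    simp

end

/-! ### The differential algebra of smooth functions of (t, r, x) and its radial generators -/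

section

/-! ### The algebra of smooth functions of `(t, r, cos θ)` and its derivations -/

/-- Extension by zero off the region. -/
def extendZero {M : ℝ} (f : region M → ℂ) : ℝ × ℝ × ℝ → ℂ := Function.extend Subtype.val f 0

theorem extendZero_coe {M : ℝ} (f : region M → ℂ) (p : region M) : extendZero f p = f p :=
  Subtype.val_injective.extend_apply f 0 p

theorem extendZero_restrict {M : ℝ} (F : ℝ × ℝ × ℝ → ℂ) :
    Set.EqOn (extendZero fun p : region M => F p) F (region M) :=
  fun p hp => extendZero_coe (fun p : region M => F p) ⟨p, hp⟩

/-- The smooth functions on the region. -/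
def smoothAlg (M : ℝ) : Subalgebra ℂ (region M → ℂ) where
  carrier := {f | ContDiffOn ℝ ((⊤ : ℕ∞) : WithTop ℕ∞) (extendZero f) (region M)}
  mul_mem' {f g} hf hg := (ContDiffOn.mul hf hg).congr fun p hp => by
    simp [extendZero_coe _ (⟨p, hp⟩ : region M)]
  add_mem' {f g} hf hg := (ContDiffOn.add hf hg).congr fun p hp => by
    simp [extendZero_coe _ (⟨p, hp⟩ : region M)]
  algebraMap_mem' c := (contDiffOn_const (c := c)).congr fun p hp => by
    simp [extendZero_coe _ (⟨p, hp⟩ : region M)]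

/-- The value of a smooth function at `(t, r, x)`. -/
def ev {M : ℝ} (G : smoothAlg M) (t r x : ℝ) : ℂ := extendZero G.1 (t, r, x)

/-- A function that is smooth on the region, as an element of the algebra. -/
def smoothAlg.mk {M : ℝ} (F : ℝ × ℝ × ℝ → ℂ)
    (hF : ContDiffOn ℝ ((⊤ : ℕ∞) : WithTop ℕ∞) F (region M)) : smoothAlg M :=
  ⟨fun p => F p, hF.congr (extendZero_restrict F)⟩

variable {M : ℝ}

theorem ev_mk {F : ℝ × ℝ × ℝ → ℂ} (hF : ContDiffOn ℝ ((⊤ : ℕ∞) : WithTop ℕ∞) F (region M))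
    {t r x : ℝ} (hr : 2 * M < r) : ev (smoothAlg.mk F hF) t r x = F (t, r, x) :=
  extendZero_restrict F (x := (t, r, x)) hr

/-- Elements are functions on the region itself, not on ℝ³, so equality needs to be tested only for
r > 2M, where r and √Δ are invertible. -/
theorem ev_ext {G H : smoothAlg M} (h : ∀ t r x, 2 * M < r → ev G t r x = ev H t r x) : G = H := by
  apply Subtype.ext
  funext p
  have := h p.1.1 p.1.2.1 p.1.2.2 p.2
  simpa only [ev, extendZero_coe _ p] using this

theorem contDiffOn_ev (G : smoothAlg M) :
    ContDiffOn ℝ ((⊤ : ℕ∞) : WithTop ℕ∞) (fun p : ℝ × ℝ × ℝ => ev G p.1 p.2.1 p.2.2) (region M) :=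
  G.2

section Eval

variable (G H : smoothAlg M) (t r x : ℝ)

theorem ev_add : ev (G + H) t r x = ev G t r x + ev H t r x := by
  by_cases h : (t, r, x) ∈ region M
  · simp [ev, extendZero_coe _ (⟨_, h⟩ : region M)]
  · simp [ev, extendZero, h]

theorem ev_mul : ev (G * H) t r x = ev G t r x * ev H t r x := by
  by_cases h : (t, r, x) ∈ region M
  · simp [ev, extendZero_coe _ (⟨_, h⟩ : region M)]
  · simp [ev, extendZero, h]

theorem ev_smul (c : ℂ) : ev (c • G) t r x = c * ev G t r x := by
  by_cases h : (t, r, x) ∈ region M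
  · simp [ev, extendZero_coe _ (⟨_, h⟩ : region M)]
  · simp [ev, extendZero, h]

theorem ev_sub : ev (G - H) t r x = ev G t r x - ev H t r x := by
  by_cases h : (t, r, x) ∈ region M
  · simp [ev, extendZero_coe _ (⟨_, h⟩ : region M)]
  · simp [ev, extendZero, h]

theorem ev_neg : ev (-G) t r x = -ev G t r x := by
  by_cases h : (t, r, x) ∈ region M
  · simp [ev, extendZero_coe _ (⟨_, h⟩ : region M)]
  · simp [ev, extendZero, h]

theorem ev_zero : ev (0 : smoothAlg M) t r x = 0 := by
  by_cases h : (t, r, x) ∈ region M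
  · simp [ev, extendZero_coe _ (⟨_, h⟩ : region M)]
  · simp [ev, extendZero, h]

/-- The extension by zero respects sums and products everywhere but not the unit; hence the
restriction to the region here and in `ev_one`. -/
theorem ev_pow (n : ℕ) (h : 2 * M < r) : ev (G ^ n) t r x = ev G t r x ^ n := by
  have h : (t, r, x) ∈ region M := h
  simp [ev, extendZero_coe _ (⟨_, h⟩ : region M)]

theorem ev_one (h : 2 * M < r) : ev (1 : smoothAlg M) t r x = 1 := by
  have h : (t, r, x) ∈ region M := h
  simp [ev, extendZero_coe _ (⟨_, h⟩ : region M)]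

end Eval

/-- The derivative in the constant direction `v`. -/
def partialV (v : ℝ × ℝ × ℝ) : Derivation ℂ (smoothAlg M) (smoothAlg M) :=
  Derivation.mk'
    { toFun := fun G => smoothAlg.mk (fun p => fderiv ℝ (extendZero G.1) p v)
        ((G.2.fderiv_of_isOpen (isOpen_region M) (by simp)).clm_apply contDiffOn_const)
      map_add' := fun G H => ev_ext fun t r x hr => by
        have hn := (isOpen_region M).mem_nhds (show (t, r, x) ∈ region M from hr)
        have hG := (G.2.contDiffAt hn).differentiableAt (by simp)
        have hH := (H.2.contDiffAt hn).differentiableAt (by simp)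
        have he : extendZero (G + H).1 = extendZero G.1 + extendZero H.1 :=
          funext fun p => ev_add G H p.1 p.2.1 p.2.2
        rw [ev_add, ev_mk _ hr, ev_mk _ hr, ev_mk _ hr, he, fderiv_add hG hH]
        rfl
      map_smul' := fun c G => ev_ext fun t r x hr => by
        have hn := (isOpen_region M).mem_nhds (show (t, r, x) ∈ region M from hr)
        have hG := (G.2.contDiffAt hn).differentiableAt (by simp)
        have he : extendZero (c • G).1 = c • extendZero G.1 :=
          funext fun p => ev_smul G p.1 p.2.1 p.2.2 c
        rw [RingHom.id_apply, ev_smul, ev_mk _ hr, ev_mk _ hr, he, fderiv_const_smul hG]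
        rfl }
    fun G H => ev_ext fun t r x hr => by
      have hn := (isOpen_region M).mem_nhds (show (t, r, x) ∈ region M from hr)
      have hG := (G.2.contDiffAt hn).differentiableAt (by simp)
      have hH := (H.2.contDiffAt hn).differentiableAt (by simp)
      have he : extendZero (G * H).1 = extendZero G.1 * extendZero H.1 :=
        funext fun p => ev_mul G H p.1 p.2.1 p.2.2
      simp only [LinearMap.coe_mk, AddHom.coe_mk, smul_eq_mul]
      rw [ev_add, ev_mul, ev_mul, ev_mk _ hr, ev_mk _ hr, ev_mk _ hr, he, fderiv_mul hG hH]
      simp [ev]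

theorem ev_partialV (v : ℝ × ℝ × ℝ) (G : smoothAlg M) {t r x : ℝ} (hr : 2 * M < r) :
    ev (partialV v G) t r x = fderiv ℝ (extendZero G.1) (t, r, x) v :=
  ev_mk _ hr

/-- Symmetry of the second derivative. The extension of `partialV u G` agrees with the derivative of
the extension only on the region, which is open, so the two have the same germ there. -/
theorem partialV_comm (v w : ℝ × ℝ × ℝ) (G : smoothAlg M) :
    partialV v (partialV w G) = partialV w (partialV v G) := by
  refine ev_ext fun t r x hr => ?_
  have hn := (isOpen_region M).mem_nhds (show (t, r, x) ∈ region M from hr)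
  have hG := G.2.contDiffAt hn
  have two_le : (2 : WithTop ℕ∞) ≤ ((⊤ : ℕ∞) : WithTop ℕ∞) :=
    WithTop.coe_le_coe.2 (le_top (a := (2 : ℕ∞)))
  have hd : DifferentiableAt ℝ (fderiv ℝ (extendZero G.1)) (t, r, x) :=
    (hG.fderiv_right (m := 1) (one_add_one_eq_two.trans_le two_le)).differentiableAt one_ne_zero
  have key : ∀ u : ℝ × ℝ × ℝ, fderiv ℝ (extendZero (partialV u G).1) (t, r, x) =
      (fderiv ℝ (fderiv ℝ (extendZero G.1)) (t, r, x)).flip u := by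
    intro u
    have he : extendZero (partialV u G).1 =ᶠ[nhds (t, r, x)]
        fun p => fderiv ℝ (extendZero G.1) p u := by
      filter_upwards [hn] with p hp using ev_partialV u G hp
    rw [he.fderiv_eq, fderiv_clm_apply hd (differentiableAt_const u)]
    simp
  rw [ev_partialV _ _ hr, ev_partialV _ _ hr, key, key]
  exact (hG.isSymmSndFDerivAt (by simpa using two_le)) v w

/-- The derivation `∂_t`. -/
def dT : Derivation ℂ (smoothAlg M) (smoothAlg M) := partialV (1, 0, 0)

/-- The derivation `∂_r`. -/
def dR : Derivation ℂ (smoothAlg M) (smoothAlg M) := partialV (0, 1, 0)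

/-- The derivation `∂_x`, `x = cos θ`. -/
def dX : Derivation ℂ (smoothAlg M) (smoothAlg M) := partialV (0, 0, 1)

theorem dR_dT (G : smoothAlg M) : dR (dT G) = dT (dR G) := partialV_comm _ _ G
theorem dX_dT (G : smoothAlg M) : dX (dT G) = dT (dX G) := partialV_comm _ _ G
theorem dX_dR (G : smoothAlg M) : dX (dR G) = dR (dX G) := partialV_comm _ _ G

section HasDeriv

variable (G : smoothAlg M) {t r x : ℝ} (hr : 2 * M < r)
include hr

theorem hasFDerivAt_ev :
    HasFDerivAt (fun p : ℝ × ℝ × ℝ => ev G p.1 p.2.1 p.2.2)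
      (fderiv ℝ (extendZero G.1) (t, r, x)) (t, r, x) :=
  ((G.2.contDiffAt ((isOpen_region M).mem_nhds
    (show (t, r, x) ∈ region M from hr))).differentiableAt (by simp)).hasFDerivAt

theorem hasDerivAt_ev_t : HasDerivAt (fun s => ev G s r x) (ev (dT G) t r x) t := by
  rw [dT, ev_partialV _ _ hr]
  exact (hasFDerivAt_ev G hr).comp_hasDerivAt (f := fun s => (s, r, x)) t
    ((hasDerivAt_id t).prodMk ((hasDerivAt_const t r).prodMk (hasDerivAt_const t x)))

theorem hasDerivAt_ev_r : HasDerivAt (fun s => ev G t s x) (ev (dR G) t r x) r := by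
  rw [dR, ev_partialV _ _ hr]
  exact (hasFDerivAt_ev G hr).comp_hasDerivAt (f := fun s => (t, s, x)) r
    ((hasDerivAt_const r t).prodMk ((hasDerivAt_id r).prodMk (hasDerivAt_const r x)))

theorem hasDerivAt_ev_x : HasDerivAt (fun s => ev G t r s) (ev (dX G) t r x) x := by
  rw [dX, ev_partialV _ _ hr]
  exact (hasFDerivAt_ev G hr).comp_hasDerivAt (f := fun s => (t, r, s)) x
    ((hasDerivAt_const x t).prodMk ((hasDerivAt_const x r).prodMk (hasDerivAt_id x)))

end HasDeriv

theorem dX_eq_of_hasDerivAt {G H : smoothAlg M}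
    (h : ∀ t r x, 2 * M < r → HasDerivAt (fun y => ev G t r y) (ev H t r x) x) : dX G = H :=
  ev_ext fun t r x hr => (hasDerivAt_ev_x G hr).unique (h t r x hr)

/-! ### Coordinate functions -/

section Coordinates

/-- The coordinate `x = cos θ`. -/
def xE : smoothAlg M := smoothAlg.mk (fun p => (p.2.2 : ℂ))
  (Complex.ofRealCLM.contDiff.comp (contDiff_snd.comp contDiff_snd)).contDiffOn

theorem ev_xE {t r x : ℝ} (hr : 2 * M < r) : ev (xE : smoothAlg M) t r x = x := ev_mk _ hr

/-- A smooth function of the radius alone. -/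
def radial (u : ℝ → ℝ) (hu : ContDiffOn ℝ ((⊤ : ℕ∞) : WithTop ℕ∞) u (Set.Ioi (2 * M))) :
    smoothAlg M :=
  smoothAlg.mk (fun p => (u p.2.1 : ℂ)) (Complex.ofRealCLM.contDiff.comp_contDiffOn
    (hu.comp (contDiff_fst.comp contDiff_snd).contDiffOn fun _ hp => hp))

theorem ev_radial {u : ℝ → ℝ} (hu : ContDiffOn ℝ ((⊤ : ℕ∞) : WithTop ℕ∞) u (Set.Ioi (2 * M)))
    {t r x : ℝ} (hr : 2 * M < r) : ev (radial u hu : smoothAlg M) t r x = u r := ev_mk _ hr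

/-- The coordinate `r`. -/
def rE : smoothAlg M := radial (fun r => r) contDiffOn_id

theorem ev_rE {t r x : ℝ} (hr : 2 * M < r) : ev (rE : smoothAlg M) t r x = r := ev_radial _ hr

theorem dX_xE : dX (xE : smoothAlg M) = 1 := dX_eq_of_hasDerivAt fun t r x hr => by
  rw [ev_one _ _ _ hr]
  refine ((hasDerivAt_id x).ofReal_comp).congr_of_eventuallyEq
    (Filter.Eventually.of_forall fun y => ?_)
  exact ev_xE hr

theorem dT_xE : dT (xE : smoothAlg M) = 0 := ev_ext fun t r x hr => by
  refine (hasDerivAt_ev_t xE hr).unique ?_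
  rw [ev_zero]
  exact (hasDerivAt_const t (x : ℂ)).congr_of_eventuallyEq
    (Filter.Eventually.of_forall fun y => ev_xE hr)

theorem dR_xE : dR (xE : smoothAlg M) = 0 := ev_ext fun t r x hr => by
  refine (hasDerivAt_ev_r xE hr).unique ?_
  rw [ev_zero]
  refine (hasDerivAt_const r (x : ℂ)).congr_of_eventuallyEq ?_
  filter_upwards [lt_mem_nhds hr] with y hy using ev_xE hy

variable {u : ℝ → ℝ} (hu : ContDiffOn ℝ ((⊤ : ℕ∞) : WithTop ℕ∞) u (Set.Ioi (2 * M)))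

theorem dT_radial : dT (radial u hu : smoothAlg M) = 0 := ev_ext fun t r x hr => by
  refine (hasDerivAt_ev_t _ hr).unique ?_
  rw [ev_zero]
  exact (hasDerivAt_const t (u r : ℂ)).congr_of_eventuallyEq
    (Filter.Eventually.of_forall fun y => ev_radial hu hr)

theorem dX_radial : dX (radial u hu : smoothAlg M) = 0 := dX_eq_of_hasDerivAt fun t r x hr => by
  rw [ev_zero]
  exact (hasDerivAt_const x (u r : ℂ)).congr_of_eventuallyEq
    (Filter.Eventually.of_forall fun y => ev_radial hu hr)

theorem ev_dR_radial {t r x u' : ℝ} (hr : 2 * M < r) (h : HasDerivAt u u' r) :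
    ev (dR (radial u hu : smoothAlg M)) t r x = u' := by
  refine (hasDerivAt_ev_r _ hr).unique (h.ofReal_comp.congr_of_eventuallyEq ?_)
  filter_upwards [lt_mem_nhds hr] with y hy using ev_radial hu hy

theorem dT_rE : dT (rE : smoothAlg M) = 0 := dT_radial _
theorem dX_rE : dX (rE : smoothAlg M) = 0 := dX_radial _
theorem dR_rE : dR (rE : smoothAlg M) = 1 := ev_ext fun t r x hr => by
  rw [ev_one _ _ _ hr, rE, ev_dR_radial _ hr (hasDerivAt_id' r), Complex.ofReal_one]

end Coordinates

/-! ### Radial functions of the exterior, for positive mass -/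

theorem Del_pos {r : ℝ} (hM : 0 < M) (hr : 2 * M < r) : 0 < Del M r :=
  mul_pos (by linarith) (by linarith)

section Positive

variable [hM : Fact (0 < M)]

theorem radius_ne_zero {r : ℝ} (hr : 2 * M < r) : r ≠ 0 := by
  have := hM.out
  linarith

theorem radius_cast_ne_zero {r : ℝ} (hr : 2 * M < r) : (r : ℂ) ≠ 0 := by
  exact_mod_cast radius_ne_zero hr

theorem sqrt_ne_zero {r : ℝ} (hr : 2 * M < r) : √(Del M r) ≠ 0 :=
  (Real.sqrt_pos.2 (Del_pos hM.out hr)).ne'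

theorem sqrt_cast_ne_zero {r : ℝ} (hr : 2 * M < r) : (√(Del M r) : ℂ) ≠ 0 := by
  exact_mod_cast sqrt_ne_zero hr

theorem contDiffOn_sqrt_Del :
    ContDiffOn ℝ ((⊤ : ℕ∞) : WithTop ℕ∞) (fun r => √(Del M r)) (Set.Ioi (2 * M)) := by
  refine ContDiffOn.sqrt ?_ fun r hr => (Del_pos hM.out hr).ne'
  unfold Del
  fun_prop

/-- `1 / r`. -/
def riE : smoothAlg M :=
  radial (fun r => r⁻¹) (contDiffOn_id.inv fun _ hr => radius_ne_zero hr)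

/-- `√Δ`. -/
def sE : smoothAlg M := radial _ contDiffOn_sqrt_Del

/-- `1 / √Δ`. -/
def siE : smoothAlg M :=
  radial (fun r => (√(Del M r))⁻¹) (contDiffOn_sqrt_Del.inv fun _ hr => sqrt_ne_zero hr)

variable {t r x : ℝ}

theorem ev_riE (hr : 2 * M < r) : ev (riE : smoothAlg M) t r x = (r : ℂ)⁻¹ := by
  rw [riE, ev_radial _ hr, Complex.ofReal_inv]

theorem ev_sE (hr : 2 * M < r) : ev (sE : smoothAlg M) t r x = √(Del M r) := by
  rw [sE, ev_radial _ hr]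

theorem ev_siE (hr : 2 * M < r) : ev (siE : smoothAlg M) t r x = (√(Del M r) : ℂ)⁻¹ := by
  rw [siE, ev_radial _ hr, Complex.ofReal_inv]

theorem dT_riE : dT (riE : smoothAlg M) = 0 := dT_radial _
theorem dX_riE : dX (riE : smoothAlg M) = 0 := dX_radial _
theorem dT_sE : dT (sE : smoothAlg M) = 0 := dT_radial _
theorem dX_sE : dX (sE : smoothAlg M) = 0 := dX_radial _
theorem dT_siE : dT (siE : smoothAlg M) = 0 := dT_radial _
theorem dX_siE : dX (siE : smoothAlg M) = 0 := dX_radial _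

theorem dR_riE : dR (riE : smoothAlg M) = -riE ^ 2 := ev_ext fun t r x hr => by
  rw [ev_neg, ev_pow _ _ _ _ _ hr, ev_riE hr, riE,
    ev_dR_radial _ hr (hasDerivAt_inv (radius_ne_zero hr))]
  push_cast
  rw [inv_pow]

/-- Used to eliminate M, so that all background quantities are polynomials in r, 1/r, √Δ and 1/√Δ.
-/
theorem mass_eq (hr : 2 * M < r) : M = (r ^ 2 - √(Del M r) ^ 2) / (2 * r) := by
  have := radius_ne_zero hr
  rw [Real.sq_sqrt (Del_pos hM.out hr).le, Del]
  field_simp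
  ring

theorem hasDerivAt_sqrt_Del (hr : 2 * M < r) :
    HasDerivAt (fun r => √(Del M r)) ((1 / 2) * (r * (√(Del M r))⁻¹ + √(Del M r) * r⁻¹)) r := by
  have h1 : HasDerivAt (Del M) (1 * (r - 2 * M) + r * 1) r :=
    (hasDerivAt_id r).mul ((hasDerivAt_id r).sub_const (2 * M))
  convert h1.sqrt (Del_pos hM.out hr).ne' using 1
  have h2 := sqrt_ne_zero hr
  have h3 := mass_eq hr
  have h4 := radius_ne_zero hr
  set σ := √(Del M r)
  rw [h3]
  field_simp
  ring

/-- The derivative is (r - M)/√Δ, and 2r(r - M) = r² + Δ. -/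
theorem dR_sE : dR (sE : smoothAlg M) = (1 / 2 : ℂ) • (rE * siE + sE * riE) :=
  ev_ext fun t r x hr => by
  rw [ev_smul, ev_add, ev_mul, ev_mul, ev_riE hr, ev_sE hr, ev_siE hr, ev_rE hr, sE,
    ev_dR_radial _ hr (hasDerivAt_sqrt_Del hr)]
  push_cast
  rfl

theorem dR_siE : dR (siE : smoothAlg M) = -((1 / 2 : ℂ) • (rE * siE + sE * riE)) * siE ^ 2 :=
  ev_ext fun t r x hr => by
  rw [ev_mul, ev_neg, ev_smul, ev_pow _ _ _ _ _ hr, ev_add, ev_mul, ev_mul, ev_riE hr, ev_sE hr,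
    ev_siE hr, ev_rE hr, siE,
    ev_dR_radial _ hr ((hasDerivAt_sqrt_Del hr).fun_inv (sqrt_ne_zero hr))]
  push_cast
  rw [inv_pow, div_eq_mul_inv]

end Positive

end

/-! ### The GHP calculus on coefficient functions, and the identities between V, W, η and Ψ_DHR -/

section

variable {M : ℝ} [hM : Fact (0 < M)]

/-! ### The operators of the Carter frame, without the factors `1 / √2` -/

/-- `√2 ε`. -/
def epsE : smoothAlg M := (1 / 4 : ℂ) • (siE - sE * riE ^ 2)

/-- `√2 ρ`. -/
def rhoE : smoothAlg M := -(sE * riE ^ 2)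

/-- `√2 D`. -/
def opD (G : smoothAlg M) : smoothAlg M := rE * siE * dT G + sE * riE * dR G

/-- `√2 D'`. -/
def opD' (G : smoothAlg M) : smoothAlg M := rE * siE * dT G - sE * riE * dR G

/-- `√2 þ` on weights with `p + q = c`. -/
def opThorn (c : ℂ) (G : smoothAlg M) : smoothAlg M := opD G - c • (epsE * G)

/-- `√2 þ'` on weights with `p + q = c`. -/
def opThorn' (c : ℂ) (G : smoothAlg M) : smoothAlg M := opD' G - c • (epsE * G)

/-- `√2 ð` on `sin^k θ G` with `q - p = 2 k`, after division by `sin^{k-1} θ`. -/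
def opEth (k : ℂ) (G : smoothAlg M) : smoothAlg M :=
  riE * ((2 * k) • (xE * G) - (1 - xE ^ 2) * dX G)

/-- `√2 ð'` on `sin^k θ G` with `p - q = -2 k`, after division by `sin^{k+1} θ`. -/
def opEth' (G : smoothAlg M) : smoothAlg M := -(riE * dX G)

/-- `√2 η` for the potential `sin² θ P`. -/
def etaE (P : smoothAlg M) : smoothAlg M := opThorn (-4) P + (3 : ℂ) • (rhoE * P)

/-- `2 Ψ_DHR`. -/
def dhrE (P : smoothAlg M) : smoothAlg M := opThorn (-2) (etaE P) + rhoE * etaE P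

/-- `2 W`. -/
def wE (P : smoothAlg M) : smoothAlg M := opThorn (-2) (etaE P) - rhoE * etaE P

/-- `2 V`. -/
def vE (P : smoothAlg M) : smoothAlg M := opThorn (-4) (opEth 2 P) + opEth 2 (etaE P)

/-- Twice the Teukolsky operator. -/
def teukE (P : smoothAlg M) : smoothAlg M :=
  opThorn' (-2) (etaE P) + rhoE * etaE P - opEth' (opEth 2 P)
    -- The bracket 1/r² - Δ/r⁴ equals 2M/r³ = -2Ψ₂.
    + (3 : ℂ) • ((riE ^ 2 - sE ^ 2 * riE ^ 4) * P)

/-! ### Commutation rules -/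

section Rules

variable (G H : smoothAlg M) (c k : ℂ)

theorem opD_add : opD (G + H) = opD G + opD H := by simp only [opD, map_add]; ring
theorem opD_sub : opD (G - H) = opD G - opD H := by simp only [opD, map_sub]; ring
theorem opD_neg : opD (-G) = -opD G := by simp only [opD, map_neg]; ring
theorem opD_smul : opD (c • G) = c • opD G := by
  simp only [opD, Derivation.map_smul]; simp only [Algebra.smul_def]; ring
theorem opD_mul : opD (G * H) = G * opD H + H * opD G := by
  simp only [opD, Derivation.leibniz, smul_eq_mul]; ring

theorem opD'_add : opD' (G + H) = opD' G + opD' H := by simp only [opD', map_add]; ring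
theorem opD'_sub : opD' (G - H) = opD' G - opD' H := by simp only [opD', map_sub]; ring
theorem opD'_smul : opD' (c • G) = c • opD' G := by
  simp only [opD', Derivation.map_smul]; simp only [Algebra.smul_def]; ring

theorem opEth_add : opEth k (G + H) = opEth k G + opEth k H := by
  simp only [opEth, map_add, Algebra.smul_def]; ring
theorem opEth_smul : opEth k (c • G) = c • opEth k G := by
  simp only [opEth, Derivation.map_smul]; simp only [Algebra.smul_def]; ring
theorem opEth_mul_radial (h : dX G = 0) : opEth k (G * H) = G * opEth k H := by
  simp only [opEth, Derivation.leibniz, smul_eq_mul, Algebra.smul_def, h]; ring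

theorem opEth'_add : opEth' (G + H) = opEth' G + opEth' H := by simp only [opEth', map_add]; ring
theorem opEth'_smul : opEth' (c • G) = c • opEth' G := by
  simp only [opEth', Derivation.map_smul]; simp only [Algebra.smul_def]; ring
theorem opEth'_mul_radial (h : dX G = 0) : opEth' (G * H) = G * opEth' H := by
  simp only [opEth', Derivation.leibniz, smul_eq_mul, h]; ring

end Rules

theorem dX_rhoE : dX (rhoE : smoothAlg M) = 0 := by
  simp [rhoE, Derivation.leibniz, Derivation.leibniz_pow, dX_sE, dX_riE]

theorem dX_epsE : dX (epsE : smoothAlg M) = 0 := by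
  simp [epsE, Derivation.leibniz, Derivation.leibniz_pow, dX_sE, dX_riE, dX_siE]

theorem dT_rhoE : dT (rhoE : smoothAlg M) = 0 := by
  simp [rhoE, Derivation.leibniz, Derivation.leibniz_pow, dT_sE, dT_riE]

theorem dT_epsE : dT (epsE : smoothAlg M) = 0 := by
  simp [epsE, Derivation.leibniz, Derivation.leibniz_pow, dT_sE, dT_riE, dT_siE]

theorem opD_riE : opD (riE : smoothAlg M) = rhoE * riE := by
  simp only [opD, dT_riE, dR_riE, rhoE]; ring

theorem rE_mul_riE : (rE * riE : smoothAlg M) = 1 := ev_ext fun t r x hr => by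
  rw [ev_mul, ev_rE hr, ev_riE hr, ev_one _ _ _ hr, mul_inv_cancel₀ (radius_cast_ne_zero hr)]

theorem sE_mul_siE : (sE * siE : smoothAlg M) = 1 := ev_ext fun t r x hr => by
  rw [ev_mul, ev_sE hr, ev_siE hr, ev_one _ _ _ hr, mul_inv_cancel₀ (sqrt_cast_ne_zero hr)]

/-- The Sachs equation þρ = ρ² without shear; the term 2ερ appears because ρ has weight (1, 1). -/
theorem opD_rhoE : opD (rhoE : smoothAlg M) = rhoE ^ 2 + (2 : ℂ) • (epsE * rhoE) := by
  refine ev_ext fun t r x hr => ?_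
  have hr0 := radius_cast_ne_zero hr
  have hs0 := sqrt_cast_ne_zero hr
  simp only [opD, dT_rhoE]
  simp only [rhoE, epsE, map_neg, Derivation.leibniz, Derivation.leibniz_pow, smul_eq_mul, dR_sE,
    dR_riE, nsmul_eq_mul]
  simp only [ev_add, ev_sub, ev_mul, ev_smul, ev_neg, ev_zero, ev_pow _ _ _ _ _ hr,
    ev_rE hr, ev_riE hr, ev_sE hr, ev_siE hr, Nat.cast_ofNat]
  have h2 : ev (2 : smoothAlg M) t r x = 2 := by
    rw [← one_add_one_eq_two, ev_add, ev_one _ _ _ hr, one_add_one_eq_two]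
  set σ : ℂ := (√(Del M r) : ℂ)
  simp only [h2, Nat.add_one_sub_one, pow_one]
  field_simp
  ring

/-- The commutator [þ, ð] = ρ ð: the operator ð is 1/r times an angular operator, and the derivative
of 1/r along l is ρ/r. -/
theorem opD_opEth (k : ℂ) (G : smoothAlg M) :
    opD (opEth k G) = opEth k (opD G) + rhoE * opEth k G := by
  simp only [opEth, opD_mul, opD_riE]
  simp only [opD, map_add, map_sub, Derivation.leibniz, Derivation.leibniz_pow, smul_eq_mul,
    Derivation.map_smul, Derivation.map_one_eq_zero, dT_xE, dR_xE, dX_rE, dX_siE, dX_sE, dX_riE,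
    dX_dT, dX_dR, smul_zero, mul_zero]
  simp only [Algebra.smul_def]
  ring

theorem opD_opEth' (G : smoothAlg M) :
    opD (opEth' G) = opEth' (opD G) + rhoE * opEth' G := by
  simp only [opEth', opD_mul, opD_neg, opD_riE]
  simp only [opD, map_add, Derivation.leibniz, smul_eq_mul,
    dX_rE, dX_siE, dX_sE, dX_riE, dX_dT, dX_dR, mul_zero]
  ring

/-- The scalar `χ = √2 (þ + 2ρ) ψ`, for which `V = √2 ð χ`. -/
def chiE (P : smoothAlg M) : smoothAlg M := opThorn (-4) P + (2 : ℂ) • (rhoE * P)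

/-- Moving ð to the left in þð + ð(þ + 3ρ) costs one ρ, so the sum is ð(2þ + 4ρ). -/
theorem vE_eq (P : smoothAlg M) : vE P = (2 : ℂ) • opEth 2 (chiE P) := by
  simp only [vE, chiE, etaE, opThorn, opD_opEth, opEth_add, opEth_smul, sub_eq_add_neg, ← neg_smul,
    opEth_mul_radial _ _ _ dX_epsE, opEth_mul_radial _ _ _ dX_rhoE]
  simp only [Algebra.smul_def, map_ofNat, map_neg]
  ring

/-- Because þρ = ρ², both (þ + ρ)(þ + 3ρ) and (þ + 2ρ)² equal þ² + 4ρþ + 6ρ². -/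
theorem dhrE_eq (P : smoothAlg M) :
    dhrE P = opThorn (-2) (chiE P) + (2 : ℂ) • (rhoE * chiE P) := by
  simp only [dhrE, chiE, etaE, opThorn, opD_add, opD_sub, opD_smul, opD_mul, opD_rhoE]
  simp only [Algebra.smul_def, map_ofNat, map_neg]
  ring

/-- Commuting þ past ð turns (þ + ρ)ð into ð(þ + 2ρ), which acts on χ to give Ψ_DHR. This holds for
every potential, without the Teukolsky equation. -/
theorem thorn_vE (P : smoothAlg M) :
    opThorn (-2) (vE P) + rhoE * vE P = (2 : ℂ) • opEth 2 (dhrE P) := by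
  simp only [vE_eq, dhrE_eq, opThorn, opD_smul, opD_opEth, opEth_add, opEth_smul, sub_eq_add_neg,
    ← neg_smul, opEth_mul_radial _ _ _ dX_epsE, opEth_mul_radial _ _ _ dX_rhoE]
  simp only [Algebra.smul_def, map_ofNat, map_neg]
  ring

/-- The Bianchi identity þΨ₂ = 3ρΨ₂, the expression being -2Ψ₂. -/
theorem opD_weyl : opD (riE ^ 2 - sE ^ 2 * riE ^ 4 : smoothAlg M) =
    (3 : ℂ) • (rhoE * (riE ^ 2 - sE ^ 2 * riE ^ 4)) := by
  have h1 := rE_mul_riE (M := M)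
  have h2 := sE_mul_siE (M := M)
  -- Complex scalars enter through `algebraMap` while 2 is a numeral of the algebra; the relation
  -- between them must be supplied to the polynomial arithmetic.
  have h : algebraMap ℂ (smoothAlg M) (1 / 2) * 2 = 1 := by
    rw [← map_ofNat (algebraMap ℂ (smoothAlg M)) 2, ← map_mul]; norm_num
  simp only [opD, map_sub, Derivation.leibniz, Derivation.leibniz_pow, smul_eq_mul, dT_sE, dT_riE,
    dR_sE, dR_riE, rhoE, Algebra.smul_def, map_ofNat]
  push_cast
  generalize algebraMap ℂ (smoothAlg M) (1 / 2) = c at *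
  linear_combination (-(sE * riE ^ 5 * rE * sE * siE) - riE ^ 6 * sE ^ 3) * h
    - sE * riE ^ 4 * sE * siE * h1 - sE * riE ^ 4 * h2

theorem dR_epsE : sE * riE * dR (epsE : smoothAlg M) =
    -((2 : ℂ) • epsE ^ 2 + epsE * rhoE + (3 / 4 : ℂ) • (riE ^ 2 - sE ^ 2 * riE ^ 4)) := by
  refine ev_ext fun t r x hr => ?_
  have hr0 := radius_cast_ne_zero hr
  have hs0 := sqrt_cast_ne_zero hr
  simp only [rhoE, epsE, map_sub, Derivation.map_smul, Derivation.leibniz, Derivation.leibniz_pow,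
    smul_eq_mul, dR_sE, dR_riE, dR_siE]
  simp only [ev_add, ev_sub, ev_mul, ev_smul, ev_neg, ev_pow _ _ _ _ _ hr, nsmul_eq_mul,
    ev_rE hr, ev_riE hr, ev_sE hr, ev_siE hr, Nat.cast_ofNat]
  have h2 : ev (2 : smoothAlg M) t r x = 2 := by
    rw [← one_add_one_eq_two, ev_add, ev_one _ _ _ hr, one_add_one_eq_two]
  set σ : ℂ := (√(Del M r) : ℂ)
  simp only [h2, Nat.add_one_sub_one, pow_one]
  field_simp
  ring

theorem dR_rE_mul_siE : sE * riE * dR (rE * siE : smoothAlg M) =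
    -((2 : ℂ) • (epsE * (rE * siE))) := by
  refine ev_ext fun t r x hr => ?_
  have hr0 := radius_cast_ne_zero hr
  have hs0 := sqrt_cast_ne_zero hr
  simp only [epsE, Derivation.leibniz, smul_eq_mul, dR_rE, dR_siE]
  simp only [ev_add, ev_sub, ev_mul, ev_smul, ev_neg, ev_pow _ _ _ _ _ hr, ev_one _ _ _ hr,
    ev_rE hr, ev_riE hr, ev_sE hr, ev_siE hr]
  set σ : ℂ := (√(Del M r) : ℂ)
  field_simp
  ring

/-- The GHP commutator [þ, þ'] = -(p + q)Ψ₂ for p + q = -2, multiplied by 2. All terms before the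
last two expand the commutator; the last two together are -4Ψ₂ H, since `epsE * rhoE` is Ψ₂/2. -/
theorem commutator_eta (H : smoothAlg M) :
    opD (opD' H) - opD' (opD H) + (4 : ℂ) • (epsE * opD' H) + (2 : ℂ) • opD (epsE * H)
      - (2 : ℂ) • opD' (epsE * H) + (8 : ℂ) • (epsE ^ 2 * H) + (4 : ℂ) • (epsE * rhoE * H)
      + (3 : ℂ) • ((riE ^ 2 - sE ^ 2 * riE ^ 4) * H) = 0 := by
  have h1 := dR_rE_mul_siE (M := M)
  have h2 := dR_epsE (M := M)
  have h3 : algebraMap ℂ (smoothAlg M) (3 / 4) * 4 = 3 := by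
    rw [← map_ofNat (algebraMap ℂ (smoothAlg M)) 4, ← map_mul, show (3 / 4 * 4 : ℂ) = 3 by norm_num,
      map_ofNat]
  have e1 : opD (opD' H) - opD' (opD H) = (2 : ℂ) • (sE * riE * dR (rE * siE) * dT H) := by
    simp only [opD, opD', map_add, map_sub, Derivation.leibniz, smul_eq_mul, dT_sE, dT_siE, dT_rE,
      dT_riE, dR_dT, Algebra.smul_def, map_ofNat]
    ring
  have e2 : opD (epsE * H) - opD' (epsE * H) =
      (2 : ℂ) • (sE * riE * dR H * epsE + sE * riE * dR epsE * H) := by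
    simp only [opD, opD', Derivation.leibniz, smul_eq_mul, dT_epsE, Algebra.smul_def, map_ofNat]
    ring
  rw [h1] at e1
  rw [h2] at e2
  simp only [Algebra.smul_def, map_ofNat, opD'] at e1 e2 ⊢
  linear_combination e1 + 2 * e2 - (riE ^ 2 - sE ^ 2 * riE ^ 4) * H * h3

/-- The Teukolsky equation implies `D_r W + ð' V = D_t Ψ_DHR`. -/
theorem dhr_evolution (P : smoothAlg M) :
    opD (wE P) - opD' (wE P) + opEth' (vE P) =
      opD (dhrE P) + opD' (dhrE P)
        - (2 : ℂ) • (opD (teukE P) + (4 : ℂ) • (epsE * teukE P)) := by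
  have hw : wE P = dhrE P - (2 : ℂ) • (rhoE * etaE P) := by
    simp only [wE, dhrE, Algebra.smul_def, map_ofNat]; ring
  -- This is ð'V = 2 þ ð'ðψ: the two commutations, with ð and with ð', absorb exactly the 2ρ in V =
  -- 2 ð(þ + 2ρ)ψ. Here ð'ðψ has weight (-4, 0), so þ acts as D + 4ε.
  have hS : opEth' (vE P) = (2 : ℂ) • (opD (opEth' (opEth 2 P))
      + (4 : ℂ) • (epsE * opEth' (opEth 2 P))) := by
    simp only [vE_eq, chiE, opThorn, opD_opEth, opD_opEth', opEth_add, opEth_smul, opEth'_add,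
      opEth'_smul, sub_eq_add_neg, ← neg_smul, opEth_mul_radial _ _ _ dX_epsE,
      opEth_mul_radial _ _ _ dX_rhoE, opEth'_mul_radial _ _ dX_epsE, opEth'_mul_radial _ _ dX_rhoE]
    simp only [Algebra.smul_def, map_ofNat, map_neg]
    ring
  -- The Teukolsky equation solved for ð'ðψ, with its residual kept.
  have hT : opEth' (opEth 2 P) = opThorn' (-2) (etaE P) + rhoE * etaE P
      + (3 : ℂ) • ((riE ^ 2 - sE ^ 2 * riE ^ 4) * P) - teukE P := by
    simp only [teukE]; ring
  have hP : opD P = etaE P - (4 : ℂ) • (epsE * P) - (3 : ℂ) • (rhoE * P) := by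
    simp only [etaE, opThorn, Algebra.smul_def, map_ofNat, map_neg]; ring
  have hΨ : dhrE P = opThorn (-2) (etaE P) + rhoE * etaE P := rfl
  have hc := commutator_eta (etaE P)
  rw [hS, hT, hw]
  simp only [hΨ]
  simp only [opThorn, opThorn', opD_add, opD_sub, opD_smul, opD'_add, opD'_sub, opD'_smul]
  rw [opD_mul _ P, opD_weyl, hP]
  simp only [Algebra.smul_def, map_ofNat, map_neg] at hc ⊢
  linear_combination 2 * hc

/-- The radial component of the equation for the twist potential. -/
theorem twist_radial (P : smoothAlg M) :
    rE * siE * (-(rE ^ 2 * dT (wE P)) - (1 / 2 : ℂ) • (sE * dX (vE P)))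
      + sE * riE * dR (rE ^ 2 * dhrE P)
      + rE ^ 2 * (opD (teukE P) + (4 : ℂ) • (epsE * teukE P)) = 0 := by
  have h0 := dhr_evolution P
  have h1 := rE_mul_riE (M := M)
  have h2 := sE_mul_siE (M := M)
  have h : algebraMap ℂ (smoothAlg M) (1 / 2) * 2 = 1 := by
    rw [← map_ofNat (algebraMap ℂ (smoothAlg M)) 2, ← map_mul]; norm_num
  have hw : wE P = dhrE P - (2 : ℂ) • (rhoE * etaE P) := by
    simp only [wE, dhrE, Algebra.smul_def, map_ofNat]; ring
  -- The Sachs equation again, now solved for ∂_r ρ, as ρ does not depend on t.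
  have hρ : dR (rhoE : smoothAlg M) = -(riE * (rhoE + (2 : ℂ) • epsE)) := by
    have e : (sE * riE) * (rE * siE) = (1 : smoothAlg M) := by
      linear_combination rE * riE * h2 + h1
    have := opD_rhoE (M := M)
    simp only [opD, dT_rhoE, Algebra.smul_def, map_ofNat] at this ⊢
    have hs : (rhoE : smoothAlg M) = -(sE * riE ^ 2) := rfl
    have e2 : rE * siE * (rhoE : smoothAlg M) = -riE := by
      rw [hs]; linear_combination -riE * e
    linear_combination rE * siE * this - dR rhoE * e + (rhoE + 2 * epsE) * e2
  have hΨ : dhrE P = opThorn (-2) (etaE P) + rhoE * etaE P := rfl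
  have hT : opD (wE P) - opD' (wE P) = 2 * (sE * riE * dR (wE P)) := by
    simp only [opD, opD']; ring
  have hT' : opD (dhrE P) + opD' (dhrE P) = 2 * (rE * siE * dT (dhrE P)) := by
    simp only [opD, opD']; ring
  rw [hT, hT'] at h0
  have hw1 : dT (wE P) = dT (dhrE P) - 2 * (rhoE * dT (etaE P)) := by
    rw [hw]
    simp only [map_sub, Derivation.map_smul, Derivation.leibniz, dT_rhoE, smul_eq_mul]
    simp only [Algebra.smul_def, map_ofNat]; ring
  have hw2 : dR (wE P) = dR (dhrE P)
      - 2 * (rhoE * dR (etaE P) - etaE P * (riE * (rhoE + 2 * epsE))) := by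
    rw [hw]
    simp only [map_sub, Derivation.map_smul, Derivation.leibniz, hρ, smul_eq_mul]
    simp only [Algebra.smul_def, map_ofNat]; ring
  have hr2 : dR (rE ^ 2 * dhrE P) = rE ^ 2 * dR (dhrE P) + 2 * rE * dhrE P := by
    simp only [Derivation.leibniz, Derivation.leibniz_pow, dR_rE, smul_eq_mul, nsmul_eq_mul]
    push_cast
    ring
  have hs : (rhoE : smoothAlg M) = -(sE * riE ^ 2) := rfl
  rw [hr2, hw1]
  rw [hw2] at h0
  generalize opD (teukE P) + (4 : ℂ) • (epsE * teukE P) = T at *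
  simp only [opThorn, opD] at hΨ
  simp only [opEth'] at h0
  generalize dR (dhrE P) = Ψr at *
  generalize dT (dhrE P) = Ψt at *
  generalize dX (vE P) = vx at *
  generalize dhrE P = Ψ at *
  refine ev_ext fun t r x hr => ?_
  have hr0 := radius_cast_ne_zero hr
  have hs0 := sqrt_cast_ne_zero hr
  have e2 : ev (2 : smoothAlg M) t r x = 2 := by
    rw [← one_add_one_eq_two, ev_add, ev_one _ _ _ hr, one_add_one_eq_two]
  replace h0 := congrArg (fun G => ev G t r x) h0
  replace hΨ := congrArg (fun G => ev G t r x) hΨ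
  simp only [hs, ev_add, ev_sub, ev_mul, ev_smul, ev_neg, ev_pow _ _ _ _ _ hr, e2,
    ev_rE hr, ev_riE hr, ev_sE hr, ev_siE hr, ev_zero] at h0 hΨ ⊢
  set σ : ℂ := (√(Del M r) : ℂ)
  -- `dhr_evolution` solved for ∂_x V. Once it is inserted, the definition of Ψ_DHR in terms of η
  -- eliminates the remaining first derivatives of η.
  have hv : ev vx t r x = r * (2 * (σ * (r : ℂ)⁻¹ * (ev Ψr t r x
      - 2 * (-(σ * (r : ℂ)⁻¹ ^ 2) * ev (dR (etaE P)) t r x - ev (etaE P) t r x *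
        ((r : ℂ)⁻¹ * (-(σ * (r : ℂ)⁻¹ ^ 2) + 2 * ev (epsE : smoothAlg M) t r x)))))
      - 2 * (r * σ⁻¹ * ev Ψt t r x) + 2 * ev T t r x) := by
    have : (r : ℂ) * (r : ℂ)⁻¹ = 1 := mul_inv_cancel₀ hr0
    linear_combination -r * h0 - ev vx t r x * this
  rw [hv, hΨ]
  field_simp
  ring

end

/-! ### Integration in x, the modes ℓ = 0, 1, and vanishing on [-1, 1] -/

section

variable {M : ℝ}

/-! ### Primitives and moments in `x = cos θ` -/

theorem exists_dX_eq (G : smoothAlg M) : ∃ H : smoothAlg M, dX H = G := by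
  obtain ⟨P, hP, hd⟩ := exists_primitive (contDiffOn_ev G)
  refine ⟨smoothAlg.mk P hP, dX_eq_of_hasDerivAt fun t r x hr => ?_⟩
  exact (hd t r x hr).congr_of_eventuallyEq (Filter.Eventually.of_forall fun y => ev_mk hP hr)

/-- A primitive with respect to `x`. -/
def intX (G : smoothAlg M) : smoothAlg M := (exists_dX_eq G).choose

theorem dX_intX (G : smoothAlg M) : dX (intX G) = G := (exists_dX_eq G).choose_spec

/-- The restriction to `x = c`, as a function independent of `x`. -/
def atX (c : ℝ) (G : smoothAlg M) : smoothAlg M :=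
  smoothAlg.mk (fun p => ev G p.1 p.2.1 c) <|
    (contDiffOn_ev G).comp (f := fun p : ℝ × ℝ × ℝ => (p.1, p.2.1, c)) (by fun_prop) fun _ hp => hp

section

variable {t r x : ℝ}

theorem ev_atX (c : ℝ) (G : smoothAlg M) (hr : 2 * M < r) : ev (atX c G) t r x = ev G t r c :=
  ev_mk _ hr

end

theorem dX_atX (c : ℝ) (G : smoothAlg M) : dX (atX c G) = 0 :=
  dX_eq_of_hasDerivAt fun t r x hr => by
    rw [ev_zero]
    exact (hasDerivAt_const x (ev G t r c)).congr_of_eventuallyEq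
      (Filter.Eventually.of_forall fun y => ev_atX c G hr)

theorem dR_atX (c : ℝ) (G : smoothAlg M) : dR (atX c G) = atX c (dR G) :=
  ev_ext fun t r x hr => by
    rw [ev_atX c _ hr]
    refine (hasDerivAt_ev_r _ hr).unique ((hasDerivAt_ev_r G hr).congr_of_eventuallyEq ?_)
    filter_upwards [lt_mem_nhds hr] with y hy using ev_atX c G hy

theorem dT_atX (c : ℝ) (G : smoothAlg M) : dT (atX c G) = atX c (dT G) :=
  ev_ext fun t r x hr => by
    rw [ev_atX c _ hr]
    refine (hasDerivAt_ev_t _ hr).unique ((hasDerivAt_ev_t G hr).congr_of_eventuallyEq ?_)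
    exact Filter.Eventually.of_forall fun y => ev_atX c G hr

theorem ev_eq_of_dX_eq_zero {G : smoothAlg M} (h : dX G = 0) {t r : ℝ} (x y : ℝ)
    (hr : 2 * M < r) : ev G t r x = ev G t r y := by
  refine is_const_of_deriv_eq_zero (f := fun x => ev G t r x)
    (fun x => (hasDerivAt_ev_x G hr).differentiableAt) (fun x => ?_) x y
  rw [(hasDerivAt_ev_x G hr).deriv, h, ev_zero]

/-- The integral over `-1 ≤ x ≤ 1`. -/
def moment (G : smoothAlg M) : smoothAlg M := atX 1 (intX G) - atX (-1) (intX G)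

/-- Primitives in x differ by a function of (t, r), so the chosen one may be replaced by any other.
-/
theorem moment_eq {G H : smoothAlg M} (h : dX H = G) : moment G = atX 1 H - atX (-1) H := by
  refine ev_ext fun t r x hr => ?_
  have h0 : dX (intX G - H) = 0 := by rw [map_sub, dX_intX, h, sub_self]
  have := ev_eq_of_dX_eq_zero (t := t) h0 1 (-1) hr
  simp only [moment, ev_sub, ev_atX _ _ hr] at this ⊢
  linear_combination this

theorem dX_moment (G : smoothAlg M) : dX (moment G) = 0 := by
  rw [moment, map_sub, dX_atX, dX_atX, sub_self]

theorem moment_add (G H : smoothAlg M) : moment (G + H) = moment G + moment H := by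
  rw [moment_eq (H := intX G + intX H) (by rw [map_add, dX_intX, dX_intX])]
  refine ev_ext fun t r x hr => ?_
  simp only [moment, ev_sub, ev_add, ev_atX _ _ hr]
  ring

theorem moment_mul {G : smoothAlg M} (H : smoothAlg M) (hG : dX G = 0) :
    moment (G * H) = G * moment H := by
  rw [moment_eq (H := G * intX H) (by simp [Derivation.leibniz, dX_intX, hG])]
  refine ev_ext fun t r x hr => ?_
  simp only [moment, ev_sub, ev_mul, ev_atX _ _ hr, ev_eq_of_dX_eq_zero hG _ x hr]
  ring

theorem moment_smul (c : ℂ) (G : smoothAlg M) : moment (c • G) = c • moment G := by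
  rw [Algebra.smul_def, moment_mul _ (Derivation.map_algebraMap _ _), Algebra.smul_def]

theorem moment_sub (G H : smoothAlg M) : moment (G - H) = moment G - moment H := by
  rw [sub_eq_add_neg, ← neg_one_smul ℂ H, moment_add, moment_smul, neg_one_smul, sub_eq_add_neg]

theorem moment_dR (G : smoothAlg M) : moment (dR G) = dR (moment G) := by
  rw [moment_eq (H := dR (intX G)) (by rw [dX_dR, dX_intX]), moment, map_sub, dR_atX, dR_atX]

theorem moment_dT (G : smoothAlg M) : moment (dT G) = dT (moment G) := by
  rw [moment_eq (H := dT (intX G)) (by rw [dX_dT, dX_intX]), moment, map_sub, dT_atX, dT_atX]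

theorem moment_pow (n : ℕ) :
    moment (xE ^ n : smoothAlg M) = ((1 - (-1) ^ (n + 1)) / (n + 1) : ℂ) • 1 := by
  have hn : (n + 1 : ℂ) ≠ 0 := by exact_mod_cast n.succ_ne_zero
  rw [moment_eq (H := (1 / (n + 1) : ℂ) • xE ^ (n + 1))]
  · refine ev_ext fun t r x hr => ?_
    simp only [ev_sub, ev_smul, ev_atX _ _ hr, ev_pow _ _ _ _ _ hr, ev_xE hr, ev_one _ _ _ hr]
    push_cast
    ring
  · rw [Derivation.map_smul, Derivation.leibniz_pow, dX_xE, smul_eq_mul, mul_one,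
      Nat.add_sub_cancel, ← Nat.cast_smul_eq_nsmul ℂ, smul_smul]
    push_cast
    rw [one_div, inv_mul_cancel₀ hn, one_smul]

/-- Subtraction of the modes `ℓ = 0, 1`. -/
def removeLow (G : smoothAlg M) : smoothAlg M :=
  -- The factors (2ℓ + 1)/2 normalise the Legendre polynomials 1 and x.
  G - ((1 / 2 : ℂ) • (moment G * xE ^ 0) + (3 / 2 : ℂ) • (moment (xE * G) * xE ^ 1))

theorem dX_dX_removeLow (G : smoothAlg M) : dX (dX (removeLow G)) = dX (dX G) := by
  simp [removeLow, Derivation.leibniz, Derivation.map_smul, dX_moment, dX_xE]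

theorem moment_removeLow (G : smoothAlg M) : moment (removeLow G) = 0 := by
  rw [removeLow, moment_sub, moment_add, moment_smul, moment_smul, moment_mul _ (dX_moment _),
    moment_mul _ (dX_moment _), moment_pow, moment_pow]
  norm_num [Algebra.smul_def]
  rw [mul_left_comm, ← map_mul]
  norm_num

theorem moment_xE_mul_removeLow (G : smoothAlg M) : moment (xE * removeLow G) = 0 := by
  have e : xE * removeLow G = xE * G - ((1 / 2 : ℂ) • (moment G * xE ^ 1)
      + (3 / 2 : ℂ) • (moment (xE * G) * xE ^ 2)) := by
    simp only [removeLow, Algebra.smul_def]; ring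
  rw [e, moment_sub, moment_add, moment_smul, moment_smul, moment_mul _ (dX_moment _),
    moment_mul _ (dX_moment _), moment_pow, moment_pow]
  norm_num [Algebra.smul_def]
  rw [mul_left_comm, ← map_mul]
  norm_num

/-! ### Vanishing on the spheres -/

/-- `G` vanishes for `-1 ≤ x ≤ 1`. -/
def Vanishes (G : smoothAlg M) : Prop :=
  ∀ t r x : ℝ, 2 * M < r → x ∈ Set.Icc (-1 : ℝ) 1 → ev G t r x = 0

theorem continuous_ev_x (G : smoothAlg M) (t : ℝ) {r : ℝ} (hr : 2 * M < r) :
    Continuous fun x => ev G t r x :=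
  continuous_iff_continuousAt.2 fun _ => (hasDerivAt_ev_x G hr).continuousAt

theorem vanishes_of_interior {G : smoothAlg M}
    (h : ∀ t r x : ℝ, 2 * M < r → x ∈ Set.Ioo (-1 : ℝ) 1 → ev G t r x = 0) : Vanishes G := by
  intro t r x hr hx
  rw [← closure_Ioo (by norm_num : (-1 : ℝ) ≠ 1)] at hx
  exact (isClosed_eq (continuous_ev_x G t hr) continuous_const).closure_subset_iff.2
    (fun y hy => h t r y hr hy) hx

theorem Vanishes.dT {G : smoothAlg M} (h : Vanishes G) : Vanishes (dT G) := fun t r x hr hx =>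
  (hasDerivAt_ev_t G hr).unique ((hasDerivAt_const t (0 : ℂ)).congr_of_eventuallyEq
    (Filter.Eventually.of_forall fun y => h y r x hr hx))

theorem Vanishes.dR {G : smoothAlg M} (h : Vanishes G) : Vanishes (dR G) := fun t r x hr hx => by
  refine (hasDerivAt_ev_r G hr).unique ((hasDerivAt_const r (0 : ℂ)).congr_of_eventuallyEq ?_)
  filter_upwards [lt_mem_nhds hr] with y hy using h t y x hy hx

/-- In the open interval a neighbourhood is available; the endpoints follow by continuity, as G is
not controlled beyond |x| = 1. -/
theorem Vanishes.dX {G : smoothAlg M} (h : Vanishes G) : Vanishes (dX G) :=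
  vanishes_of_interior fun t r x hr hx => by
    refine (hasDerivAt_ev_x G hr).unique ((hasDerivAt_const x (0 : ℂ)).congr_of_eventuallyEq ?_)
    filter_upwards [isOpen_Ioo.mem_nhds hx] with y hy using h t r y hr (Set.Ioo_subset_Icc_self hy)

theorem Vanishes.add {G H : smoothAlg M} (hG : Vanishes G) (hH : Vanishes H) : Vanishes (G + H) :=
  fun t r x hr hx => by rw [ev_add, hG t r x hr hx, hH t r x hr hx, add_zero]

theorem Vanishes.sub {G H : smoothAlg M} (hG : Vanishes G) (hH : Vanishes H) : Vanishes (G - H) :=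
  fun t r x hr hx => by rw [ev_sub, hG t r x hr hx, hH t r x hr hx, sub_zero]

theorem Vanishes.mul_left {G : smoothAlg M} (hG : Vanishes G) (H : smoothAlg M) :
    Vanishes (H * G) :=
  fun t r x hr hx => by rw [ev_mul, hG t r x hr hx, mul_zero]

theorem Vanishes.smul {G : smoothAlg M} (hG : Vanishes G) (c : ℂ) : Vanishes (c • G) :=
  fun t r x hr hx => by rw [ev_smul, hG t r x hr hx, mul_zero]

theorem Vanishes.ev_eq {G : smoothAlg M} (h : Vanishes (Schwarzschild.dX G)) {t r x y : ℝ}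
    (hr : 2 * M < r) (hx : x ∈ Set.Icc (-1 : ℝ) 1) (hy : y ∈ Set.Icc (-1 : ℝ) 1) :
    ev G t r x = ev G t r y := by
  have key := constant_of_has_deriv_right_zero (continuous_ev_x G t hr).continuousOn
    (fun x hx => by
      have := (hasDerivAt_ev_x G (t := t) (x := x) hr).hasDerivWithinAt (s := Set.Ici x)
      rwa [h t r x hr (Set.Ico_subset_Icc_self hx)] at this) (a := -1) (b := 1)
  rw [key x hx, key y hy]

theorem Vanishes.ev_moment {G : smoothAlg M} (h : Vanishes G) {t r x : ℝ} (hr : 2 * M < r) :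
    ev (moment G) t r x = 0 := by
  rw [moment, ev_sub, ev_atX _ _ hr, ev_atX _ _ hr, sub_eq_zero]
  exact Vanishes.ev_eq (by rwa [dX_intX]) hr (by norm_num) (by norm_num)

/-- The linear function with the given values at `x = 0` of `G` and of its derivative. -/
def linearPart (G : smoothAlg M) : smoothAlg M :=
  atX 0 G * xE ^ 0 + atX 0 (dX G) * xE ^ 1

theorem vanishes_sub_linearPart {G : smoothAlg M} (h : Vanishes (dX (dX G))) :
    Vanishes (G - linearPart G) := by
  have h1 : Vanishes (dX (G - linearPart G)) := by
    intro t r x hr hx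
    have := Vanishes.ev_eq h (t := t) hr hx (y := 0) (by norm_num)
    simp only [linearPart, map_sub, map_add, Derivation.leibniz, dX_atX, pow_zero, pow_one, dX_xE,
      smul_eq_mul, mul_zero, mul_one, zero_add, add_zero]
    rw [ev_sub, ev_atX _ _ hr, this, sub_self]
  intro t r x hr hx
  rw [Vanishes.ev_eq h1 hr hx (y := 0) (by norm_num)]
  simp [linearPart, ev_sub, ev_add, ev_mul, ev_atX _ _ hr, ev_xE hr]

/-- On [-1, 1] the function is a + bx, and its two moments are 2a and 2b/3. -/
theorem vanishes_of_moments {G : smoothAlg M} (h : Vanishes (dX (dX G)))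
    (h0 : moment G = 0) (h1 : moment (xE * G) = 0) : Vanishes G := by
  have hv := vanishes_sub_linearPart h
  have hx : xE * (G - linearPart G) =
      xE * G - (atX 0 G * xE ^ 1 + atX 0 (dX G) * xE ^ 2) := by
    rw [linearPart]; ring
  intro t r x hr hx'
  have e0 := hv.ev_moment (t := t) (x := x) hr
  have e1 := (hv.mul_left xE).ev_moment (t := t) (x := x) hr
  rw [hx, moment_sub, h1, moment_add, moment_mul _ (dX_atX _ _), moment_mul _ (dX_atX _ _),
    moment_pow, moment_pow] at e1
  rw [linearPart, moment_sub, h0, moment_add, moment_mul _ (dX_atX _ _),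
    moment_mul _ (dX_atX _ _), moment_pow, moment_pow] at e0
  have e2 := hv t r x hr hx'
  simp only [linearPart, ev_sub, ev_add, ev_mul, ev_smul, ev_zero, ev_one _ _ _ hr, ev_atX _ _ hr,
    ev_pow _ _ _ _ _ hr, ev_xE hr] at e0 e1 e2
  norm_num at e0 e1
  rw [e0, e1] at e2
  simpa using e2

end

/-! ### The dictionary between spin-weighted fields and coefficient functions -/

section

variable {M : ℝ}

/-! ### Axisymmetric fields as elements of the algebra -/

/-- `ξ = sin^k θ G(t, r, cos θ)` off the axis. -/
def Rep (M : ℝ) (k : ℕ) (ξ : Field) (G : smoothAlg M) : Prop :=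
  ∀ t r θ, Exterior M r θ → ξ t r θ = (Real.sin θ : ℂ) ^ k * ev G t r (Real.cos θ)

theorem Exterior.sin_ne_zero {r θ : ℝ} (h : Exterior M r θ) : (Real.sin θ : ℂ) ≠ 0 := by
  exact_mod_cast (Real.sin_pos_of_pos_of_lt_pi h.2.1 h.2.2).ne'

theorem Exterior.eventually_r {r θ : ℝ} (h : Exterior M r θ) : ∀ᶠ s in nhds r, Exterior M s θ := by
  filter_upwards [lt_mem_nhds h.1] with s hs using ⟨hs, h.2⟩

theorem Exterior.eventually_θ {r θ : ℝ} (h : Exterior M r θ) : ∀ᶠ s in nhds θ, Exterior M r s := by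
  filter_upwards [lt_mem_nhds h.2.1, gt_mem_nhds h.2.2] with s hs hs' using ⟨h.1, hs, hs'⟩

theorem Exterior.cos_mem {r θ : ℝ} (h : Exterior M r θ) :
    Real.cos θ ∈ Set.Ioo (-1 : ℝ) 1 := by
  have h1 := Real.sin_pos_of_pos_of_lt_pi h.2.1 h.2.2
  have h2 := Real.sin_sq_add_cos_sq θ
  constructor <;> nlinarith

theorem cos_sq_cast (θ : ℝ) : (Real.cos θ : ℂ) ^ 2 = 1 - (Real.sin θ : ℂ) ^ 2 := by
  have := Real.cos_sq' θ
  exact_mod_cast this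

theorem vanishes_of_exterior {G : smoothAlg M}
    (h : ∀ t r θ, Exterior M r θ → ev G t r (Real.cos θ) = 0) : Vanishes G :=
  vanishes_of_interior fun t r x hr hx => by
    have := h t r (Real.arccos x) ⟨hr, Real.arccos_pos.2 hx.2, ?_⟩
    · rwa [Real.cos_arccos hx.1.le hx.2.le] at this
    · exact lt_of_le_of_ne (Real.arccos_le_pi x) fun h => by
        rw [Real.arccos_eq_pi] at h
        exact absurd hx.1 (not_lt.2 h)

theorem Vanishes.exterior {G : smoothAlg M} (h : Vanishes G) {t r θ : ℝ} (he : Exterior M r θ) :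
    ev G t r (Real.cos θ) = 0 :=
  h t r _ he.1 (Set.Ioo_subset_Icc_self he.cos_mem)

section Rules

variable {k : ℕ} {ξ η : Field} {G H : smoothAlg M}

/-- The truncated exponent k - 1 is harmless: for k = 0 the factor k removes the term. -/
theorem Rep.hasDerivAt_θ (h : Rep M k ξ G) {t r θ : ℝ} (he : Exterior M r θ) :
    HasDerivAt (fun s => ξ t r s)
      (k * (Real.sin θ : ℂ) ^ (k - 1) * Real.cos θ * ev G t r (Real.cos θ)
        - (Real.sin θ : ℂ) ^ (k + 1) * ev (dX G) t r (Real.cos θ)) θ := by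
  have h1 : HasDerivAt (fun s : ℝ => (Real.sin s : ℂ)) (Real.cos θ : ℂ) θ :=
    (Real.hasDerivAt_sin θ).ofReal_comp
  have h2 : HasDerivAt (fun s : ℝ => ev G t r (Real.cos s))
      (-Real.sin θ • ev (dX G) t r (Real.cos θ)) θ :=
    (hasDerivAt_ev_x G he.1).scomp θ (Real.hasDerivAt_cos θ)
  refine (((h1.pow k).mul h2).congr_deriv ?_).congr_of_eventuallyEq ?_
  · rw [Complex.real_smul]
    push_cast
    simp only [Pi.pow_apply]
    ring
  · filter_upwards [he.eventually_θ] with s hs using h t r s hs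

theorem pd_three (ξ : Field) (t r θ : ℝ) : pd 3 ξ t r θ = 0 := rfl

theorem Rep.pd_two (h : Rep M k ξ G) {t r θ : ℝ} (he : Exterior M r θ) :
    pd 2 ξ t r θ = k * (Real.sin θ : ℂ) ^ (k - 1) * Real.cos θ * ev G t r (Real.cos θ)
        - (Real.sin θ : ℂ) ^ (k + 1) * ev (dX G) t r (Real.cos θ) :=
  (h.hasDerivAt_θ he).deriv

theorem Rep.pd_two_zero (h : Rep M 0 ξ G) : Rep M 1 (pd 2 ξ) (-dX G) := fun t r θ he => by
  rw [h.pd_two he, ev_neg]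
  simp

theorem Rep.pd_zero (h : Rep M k ξ G) : Rep M k (pd 0 ξ) (dT G) := fun t r θ he => by
  have := ((hasDerivAt_ev_t G (t := t) he.1).const_mul ((Real.sin θ : ℂ) ^ k)).congr_of_eventuallyEq
    (f₁ := fun s => ξ s r θ) (Filter.Eventually.of_forall fun s => h s r θ he)
  exact this.deriv

theorem Rep.pd_one (h : Rep M k ξ G) : Rep M k (pd 1 ξ) (dR G) := fun t r θ he => by
  refine (((hasDerivAt_ev_r G he.1).const_mul
    ((Real.sin θ : ℂ) ^ k)).congr_of_eventuallyEq ?_).deriv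
  filter_upwards [he.eventually_r] with s hs using h t s θ hs

theorem Rep.add (h : Rep M k ξ G) (h' : Rep M k η H) : Rep M k (ξ + η) (G + H) :=
  fun t r θ he => by
    rw [Pi.add_apply, Pi.add_apply, Pi.add_apply, h t r θ he, h' t r θ he, ev_add]; ring

theorem Rep.sub (h : Rep M k ξ G) (h' : Rep M k η H) : Rep M k (ξ - η) (G - H) :=
  fun t r θ he => by
    rw [Pi.sub_apply, Pi.sub_apply, Pi.sub_apply, h t r θ he, h' t r θ he, ev_sub]; ring

theorem Rep.smul (h : Rep M k ξ G) (c : ℂ) : Rep M k (c • ξ) (c • G) := fun t r θ he => by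
  rw [Pi.smul_apply, Pi.smul_apply, Pi.smul_apply, h t r θ he, ev_smul, smul_eq_mul]; ring

theorem Rep.mul {j : ℕ} (h : Rep M k ξ G) (h' : Rep M j η H) : Rep M (k + j) (ξ * η) (G * H) :=
  fun t r θ he => by
    rw [Pi.mul_apply, Pi.mul_apply, Pi.mul_apply, h t r θ he, h' t r θ he, ev_mul, pow_add]; ring

theorem Rep.radial_mul (h : Rep M 0 ξ G) (h' : Rep M k η H) : Rep M k (ξ * η) (G * H) := by
  simpa using h.mul h'

theorem Rep.congr (h : Rep M k ξ G) (e : G = H) : Rep M k ξ H := e ▸ h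

end Rules

/-! ### The frame operators -/

theorem rt2_sq : rt2 ^ 2 = 2 := by
  rw [rt2]
  exact_mod_cast Real.sq_sqrt (zero_le_two (α := ℝ))

theorem rt2_ne_zero : rt2 ≠ 0 := fun h => by
  have := rt2_sq
  rw [h] at this
  norm_num at this

theorem rt2_inv_sq : rt2⁻¹ * rt2⁻¹ = 1 / 2 := by
  rw [← mul_inv, ← sq, rt2_sq, one_div]

section Positive

variable [hM : Fact (0 < M)]

theorem rep_sqrtDel : Rep M 0 (sqrtDel M) sE := fun t r θ he => by
  rw [ev_sE he.1, pow_zero, one_mul, sqrtDel]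

theorem rep_spinRho : Rep M 0 (spinRho M) (rt2⁻¹ • rhoE) := fun t r θ he => by
  have hr0 := radius_cast_ne_zero he.1
  have h2 := rt2_ne_zero
  simp only [rhoE, ev_smul, ev_neg, ev_mul, ev_sE he.1, ev_riE he.1, ev_pow _ _ _ _ _ he.1, spinRho]
  push_cast
  rw [show ((√2 : ℝ) : ℂ) = rt2 from rfl]
  field_simp

theorem rep_spinEps : Rep M 0 (spinEps M) (rt2⁻¹ • epsE) := fun t r θ he => by
  have hr0 := radius_cast_ne_zero he.1
  have hs0 := sqrt_cast_ne_zero he.1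
  have h2 := rt2_ne_zero
  have hm : (M : ℂ) = ((r : ℂ) ^ 2 - (√(Del M r) : ℂ) ^ 2) / (2 * r) := by
    exact_mod_cast mass_eq he.1
  simp only [epsE, ev_smul, ev_sub, ev_mul, ev_sE he.1, ev_riE he.1, ev_siE he.1,
    ev_pow _ _ _ _ _ he.1, spinEps, Real.sqrt_mul (zero_le_two (α := ℝ))]
  push_cast
  rw [show ((√2 : ℝ) : ℂ) = rt2 from rfl]
  generalize (√(Del M r) : ℂ) = σ at *
  rw [hm]
  field_simp
  ring

theorem rep_weyl2 : Rep M 0 (weyl2 M) (-((1 / 2 : ℂ) • (riE ^ 2 - sE ^ 2 * riE ^ 4))) :=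
  fun t r θ he => by
  have hr0 := radius_cast_ne_zero he.1
  have hm : (M : ℂ) = ((r : ℂ) ^ 2 - (√(Del M r) : ℂ) ^ 2) / (2 * r) := by
    exact_mod_cast mass_eq he.1
  simp only [ev_smul, ev_sub, ev_neg, ev_mul, ev_sE he.1, ev_riE he.1,
    ev_pow _ _ _ _ _ he.1, weyl2]
  push_cast
  generalize (√(Del M r) : ℂ) = σ at *
  rw [hm]
  field_simp

section Operators

variable {k : ℕ} {ξ : Field} {G : smoothAlg M}

theorem Rep.npD (h : Rep M k ξ G) : Rep M k (npD M ξ) (rt2⁻¹ • opD G) := fun t r θ he => by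
  have hr0 := radius_cast_ne_zero he.1
  have hs0 := sqrt_cast_ne_zero he.1
  have h2 := rt2_ne_zero
  simp only [Schwarzschild.npD, h.pd_zero t r θ he, h.pd_one t r θ he, opD, ev_smul, ev_add, ev_mul,
    ev_rE he.1, ev_sE he.1, ev_siE he.1, ev_riE he.1, sqrtDel]
  field_simp

theorem Rep.npD' (h : Rep M k ξ G) : Rep M k (npD' M ξ) (rt2⁻¹ • opD' G) := fun t r θ he => by
  have hr0 := radius_cast_ne_zero he.1
  have hs0 := sqrt_cast_ne_zero he.1
  have h2 := rt2_ne_zero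
  simp only [Schwarzschild.npD', h.pd_zero t r θ he, h.pd_one t r θ he, opD', ev_smul, ev_sub,
    ev_mul, ev_rE he.1, ev_sE he.1, ev_siE he.1, ev_riE he.1, sqrtDel]
  field_simp

theorem Rep.thorn (h : Rep M k ξ G) (p q : ℤ) {c : ℂ} (hc : (p + q : ℂ) = c) :
    Rep M k (thorn M p q ξ) (rt2⁻¹ • opThorn c G) := by
  refine ((h.npD.sub ((rep_spinEps.radial_mul h).smul p)).sub
    ((rep_spinEps.radial_mul h).smul q)).congr ?_
  simp only [opThorn, ← hc, Algebra.smul_def, map_add]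
  ring

theorem Rep.thorn' (h : Rep M k ξ G) (p q : ℤ) {c : ℂ} (hc : (p + q : ℂ) = c) :
    Rep M k (thorn' M p q ξ) (rt2⁻¹ • opThorn' c G) := by
  have he : Rep M 0 (spinEps' M) ((-1 : ℂ) • (rt2⁻¹ • epsE)) := by
    have := (rep_spinEps (M := M)).smul (-1)
    rwa [neg_one_smul ℂ (spinEps M)] at this
  refine ((h.npD'.add ((he.radial_mul h).smul p)).add ((he.radial_mul h).smul q)).congr ?_
  simp only [opThorn', ← hc, Algebra.smul_def, map_add, map_neg, map_one]
  ring

/-- The spin coefficient contributes a second copy of the term c cot θ coming from the derivative of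
the power of sin θ, and sin²θ = 1 - x² supplies the other term. One power of sin θ is lost, hence
the index k + 1 in the hypothesis. -/
theorem Rep.eth (h : Rep M (k + 1) ξ G) (p q : ℤ) {c : ℂ} (hc : c = k + 1)
    (hpq : (q - p : ℂ) = 2 * c) : Rep M k (eth p q ξ) (rt2⁻¹ • opEth c G) := fun t r θ he => by
  have hr0 := radius_cast_ne_zero he.1
  have hs0 := he.sin_ne_zero
  have h2 := rt2_ne_zero
  have hp : (q : ℂ) = p + 2 * c := by linear_combination hpq
  have hcos := cos_sq_cast θ
  simp only [Schwarzschild.eth, npDelta, Pi.sub_apply, Pi.add_apply, Pi.smul_apply, Pi.mul_apply,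
    smul_eq_mul, h.pd_two he, h t r θ he, opEth, ev_smul, ev_sub, ev_mul, ev_pow _ _ _ _ _ he.1,
    ev_riE he.1, ev_xE he.1, ev_one _ _ _ he.1, spinBeta, pd_three, hp, mul_zero, add_zero, hcos]
  rw [hc]
  push_cast
  rw [show ((√2 : ℝ) : ℂ) = rt2 from rfl]
  push_cast at hs0 ⊢
  field_simp
  ring

/-- For this weight the two cot θ terms cancel and only -sin θ ∂_x survives. -/
theorem Rep.eth' (h : Rep M k ξ G) (p q : ℤ) (hpq : (q - p : ℂ) = 2 * k) :
    Rep M (k + 1) (eth' p q ξ) (rt2⁻¹ • opEth' G) := fun t r θ he => by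
  have hr0 := radius_cast_ne_zero he.1
  have hs0 := he.sin_ne_zero
  have h2 := rt2_ne_zero
  have hp : (q : ℂ) = p + 2 * k := by linear_combination hpq
  simp only [Schwarzschild.eth', npDelta', Pi.sub_apply, Pi.add_apply, Pi.smul_apply, Pi.mul_apply,
    smul_eq_mul, h.pd_two he, h t r θ he, opEth', ev_smul, ev_neg, ev_mul,
    ev_riE he.1, spinBeta, pd_three, hp, mul_zero, sub_zero]
  push_cast at hs0 ⊢
  rw [show ((√2 : ℝ) : ℂ) = rt2 from rfl]
  rcases k with _ | k
  · simp
    field_simp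
  · push_cast
    field_simp
    ring

theorem opThorn_smul (c a : ℂ) (G : smoothAlg M) : opThorn c (a • G) = a • opThorn c G := by
  simp only [opThorn, opD_smul]; simp only [Algebra.smul_def]; ring

theorem opThorn'_smul (c a : ℂ) (G : smoothAlg M) : opThorn' c (a • G) = a • opThorn' c G := by
  simp only [opThorn', opD'_smul]; simp only [Algebra.smul_def]; ring

end Operators

/-! ### The scalars generated by the Hertz potential -/

section Hertz

variable {ψ : Field} {P : smoothAlg M} (h : Rep M 2 ψ P)
include h

theorem Rep.eta : Rep M 2 (hertzEta M ψ) (rt2⁻¹ • etaE P) := by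
  refine ((h.thorn (-4) 0 (c := -4) (by norm_num)).add
    ((rep_spinRho.radial_mul h).smul 3)).congr ?_
  simp only [etaE, Algebra.smul_def]; ring

theorem Rep.dhr : Rep M 2 (dhrScalar M ψ) ((1 / 2 : ℂ) • dhrE P) := by
  refine ((h.eta.thorn (-3) 1 (c := -2) (by norm_num)).add
    (rep_spinRho.radial_mul h.eta)).congr ?_
  rw [← rt2_inv_sq, opThorn_smul]
  simp only [dhrE, Algebra.smul_def, map_mul]; ring

theorem Rep.hertzW : Rep M 2 (hertzW M ψ) ((1 / 2 : ℂ) • wE P) := by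
  refine ((h.eta.thorn (-3) 1 (c := -2) (by norm_num)).sub
    (rep_spinRho.radial_mul h.eta)).congr ?_
  rw [← rt2_inv_sq, opThorn_smul]
  simp only [wE, Algebra.smul_def, map_mul]; ring

theorem Rep.hertzV : Rep M 1 (hertzV M ψ) ((1 / 2 : ℂ) • vE P) := by
  refine (((h.eth (-4) 0 (c := 2) (by norm_num) (by norm_num)).thorn (-3) (-1) (c := -4)
    (by norm_num)).add (h.eta.eth (-3) 1 (c := 2) (by norm_num) (by norm_num))).congr ?_
  rw [← rt2_inv_sq, opThorn_smul, opEth_smul]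
  simp only [vE, Algebra.smul_def, map_mul]; ring

theorem Rep.teukolsky : Rep M 2 (teukolsky M ψ) ((1 / 2 : ℂ) • teukE P) := by
  have hρ : Rep M 0 (spinRho' M) ((-1 : ℂ) • (rt2⁻¹ • rhoE)) := by
    have := (rep_spinRho (M := M)).smul (-1)
    rwa [neg_one_smul ℂ (spinRho M)] at this
  refine ((((h.eta.thorn' (-3) 1 (c := -2) (by norm_num)).sub (hρ.radial_mul h.eta)).sub
    ((h.eth (-4) 0 (c := 2) (by norm_num) (by norm_num)).eth' (-3) (-1) (by norm_num))).sub
    ((rep_weyl2.radial_mul h).smul 3)).congr ?_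
  have e : ∀ G : smoothAlg M, (3 : ℂ) • (-((1 / 2 : ℂ) • G) * P) =
      -((rt2⁻¹ * rt2⁻¹) • (3 : ℂ) • (G * P)) := fun G => by
    rw [rt2_inv_sq]
    simp only [Algebra.smul_def]; ring
  rw [e, ← rt2_inv_sq, opThorn'_smul, opEth'_smul]
  simp only [teukE, Algebra.smul_def, map_mul, map_neg, map_one]; ring

/-- The factor sin²θ can be divided out off the axis; continuity then reaches x = ±1. -/
theorem vanishes_teukE (hT : IsHertzPotential M ψ) : Vanishes (teukE P) :=
  vanishes_of_exterior fun t r θ he => by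
    have := h.teukolsky t r θ he
    rw [hT t r θ he, ev_smul, eq_comm, mul_eq_zero, mul_eq_zero] at this
    exact (this.resolve_left (pow_ne_zero _ he.sin_ne_zero)).resolve_left (by norm_num)

end Hertz

end Positive

end

section

variable {M : ℝ}

/-! ### Christoffel symbols and tensor components -/

theorem pd_zero_field (i : Fin 4) : pd i (0 : Field) = 0 := by
  funext t r θ
  fin_cases i <;> simp [pd]

theorem metric_self (a : Fin 4) : metric M a a = metricDiag M a := if_pos rfl

theorem metric_of_ne {a b : Fin 4} (h : a ≠ b) : metric M a b = 0 := if_neg h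

theorem invMetric_self (a : Fin 4) : invMetric M a a = (metricDiag M a)⁻¹ := if_pos rfl

theorem invMetric_of_ne {a b : Fin 4} (h : a ≠ b) : invMetric M a b = 0 := if_neg h

theorem christoffel_eq {S : Finset (Fin 4)} {c : Fin 4} (hc : c ∈ S) (a b : Fin 4) :
    christoffel M S c a b = (1 / 2 : ℂ) • (invMetric M c c *
      (pd a (metric M c b) + pd b (metric M c a) - pd c (metric M a b))) := by
  rw [christoffel, Finset.sum_eq_single_of_mem c hc fun d _ hd => by
    rw [invMetric_of_ne hd.symm, zero_mul]]

theorem pd_one_metric_three (t r θ : ℝ) :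
    pd 1 (metricDiag M 3) t r θ = -(2 * r * (Real.sin θ : ℂ) ^ 2) := by
  have h : HasDerivAt (fun s : ℝ => ((-(s ^ 2 * Real.sin θ ^ 2) : ℝ) : ℂ))
      ((-(2 * r * Real.sin θ ^ 2) : ℝ) : ℂ) r :=
    ((((hasDerivAt_pow 2 r).mul_const (Real.sin θ ^ 2)).neg).congr_deriv (by simp)).ofReal_comp
  simpa [pd, metricDiag] using h.deriv

theorem pd_two_metric_two (t r θ : ℝ) : pd 2 (metricDiag M 2) t r θ = 0 := by
  simp [pd, metricDiag]

theorem pd_two_metric_three (t r θ : ℝ) :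
    pd 2 (metricDiag M 3) t r θ = -(2 * (r : ℂ) ^ 2 * Real.sin θ * Real.cos θ) := by
  have h : HasDerivAt (fun s : ℝ => ((-(r ^ 2 * Real.sin s ^ 2) : ℝ) : ℂ))
      ((-(2 * r ^ 2 * Real.sin θ * Real.cos θ) : ℝ) : ℂ) θ :=
    (((((Real.hasDerivAt_sin θ).pow 2).const_mul (r ^ 2)).neg).congr_deriv
      (by simp; ring)).ofReal_comp
  simpa [pd, metricDiag] using h.deriv

/-- Simplification of the components of `covD`. -/
theorem covD_slice_eq (v : Covector) {a b : Fin 4} (ha : a ∈ slice) (hb : b ∈ slice) :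
    covD M slice v a b = pd a (v b) - (christoffel M slice 1 a b * v 1
      + (christoffel M slice 2 a b * v 2 + christoffel M slice 3 a b * v 3)) := by
  rw [covD, if_pos ⟨ha, hb⟩]
  simp [slice]

theorem covD_sphere_eq (v : Covector) {a b : Fin 4} (ha : a ∈ sphere) (hb : b ∈ sphere) :
    covD M sphere v a b = pd a (v b) - (christoffel M sphere 2 a b * v 2
      + christoffel M sphere 3 a b * v 3) := by
  rw [covD, if_pos ⟨ha, hb⟩]
  simp [sphere]

section

variable [hM : Fact (0 < M)] {t r θ : ℝ}

theorem shiftTerm_one_three (γ : Tensor2) (he : Exterior M r θ) :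
    shiftTerm M γ 1 3 t r θ = pd 1 (γ 3 0) t r θ - 2 / r * γ 3 0 t r θ := by
  have hr0 := radius_cast_ne_zero he.1
  have hs0 := he.sin_ne_zero
  rw [shiftTerm, covD_slice_eq _ (by decide) (by decide), covD_slice_eq _ (by decide) (by decide)]
  simp only [christoffel_eq (show (1 : Fin 4) ∈ slice by decide),
    christoffel_eq (show (2 : Fin 4) ∈ slice by decide),
    christoffel_eq (show (3 : Fin 4) ∈ slice by decide), invMetric_self, metric_self,
    metric_of_ne (show (1 : Fin 4) ≠ 3 by decide), metric_of_ne (show (2 : Fin 4) ≠ 3 by decide),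
    metric_of_ne (show (2 : Fin 4) ≠ 1 by decide), metric_of_ne (show (3 : Fin 4) ≠ 1 by decide),
    pd_zero_field, Pi.add_apply, Pi.sub_apply, Pi.mul_apply, Pi.smul_apply, Pi.inv_apply,
    Pi.zero_apply, pd_three, pd_one_metric_three, smul_eq_mul]
  simp only [metricDiag]
  push_cast at hs0 ⊢
  field_simp
  ring

theorem shiftTerm_two_three (γ : Tensor2) (he : Exterior M r θ) :
    shiftTerm M γ 2 3 t r θ =
      pd 2 (γ 3 0) t r θ - 2 * (Real.cos θ / Real.sin θ) * γ 3 0 t r θ := by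
  have hr0 := radius_cast_ne_zero he.1
  have hs0 := he.sin_ne_zero
  rw [shiftTerm, covD_slice_eq _ (by decide) (by decide), covD_slice_eq _ (by decide) (by decide)]
  simp only [christoffel_eq (show (1 : Fin 4) ∈ slice by decide),
    christoffel_eq (show (2 : Fin 4) ∈ slice by decide),
    christoffel_eq (show (3 : Fin 4) ∈ slice by decide), invMetric_self, metric_self,
    metric_of_ne (show (1 : Fin 4) ≠ 2 by decide), metric_of_ne (show (1 : Fin 4) ≠ 3 by decide),
    metric_of_ne (show (2 : Fin 4) ≠ 3 by decide), metric_of_ne (show (3 : Fin 4) ≠ 2 by decide),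
    pd_zero_field, Pi.add_apply, Pi.sub_apply, Pi.mul_apply, Pi.smul_apply, Pi.inv_apply,
    Pi.zero_apply, pd_three, pd_two_metric_three, smul_eq_mul]
  simp only [metricDiag]
  push_cast at hs0 ⊢
  field_simp
  ring

omit hM in
theorem hessS_two_two (u : Field) :
    hessS M u 2 2 t r θ = pd 2 (pd 2 u) t r θ := by
  rw [hessS, covD_sphere_eq _ (by decide) (by decide)]
  simp [christoffel_eq (show (2 : Fin 4) ∈ sphere by decide),
    christoffel_eq (show (3 : Fin 4) ∈ sphere by decide), metric_self,
    metric_of_ne (show (3 : Fin 4) ≠ 2 by decide), pd_zero_field, pd_three, pd_two_metric_two]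

theorem hessS_three_three (u : Field) (he : Exterior M r θ) :
    hessS M u 3 3 t r θ = Real.sin θ * Real.cos θ * pd 2 u t r θ := by
  have hr0 := radius_cast_ne_zero he.1
  rw [hessS, covD_sphere_eq _ (by decide) (by decide)]
  simp only [christoffel_eq (show (2 : Fin 4) ∈ sphere by decide),
    christoffel_eq (show (3 : Fin 4) ∈ sphere by decide), invMetric_self, metric_self,
    metric_of_ne (show (2 : Fin 4) ≠ 3 by decide), pd_zero_field, Pi.add_apply, Pi.sub_apply,
    Pi.mul_apply, Pi.smul_apply, Pi.inv_apply,
    Pi.zero_apply, pd_three, pd_two_metric_three, smul_eq_mul]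
  simp only [metricDiag]
  push_cast
  field_simp
  ring

omit hM in
theorem hessS_two_three (u : Field) : hessS M u 2 3 t r θ = 0 := by
  have h : pd 3 u = 0 := rfl
  rw [hessS, covD_sphere_eq _ (by decide) (by decide)]
  simp [christoffel_eq (show (2 : Fin 4) ∈ sphere by decide), metric_self,
    metric_of_ne (show (2 : Fin 4) ≠ 3 by decide), pd_zero_field, h, pd_three]

omit hM in
theorem hessS_three_two (u : Field) : hessS M u 3 2 t r θ = 0 := by
  have h : pd 3 u = 0 := rfl
  rw [hessS, covD_sphere_eq _ (by decide) (by decide)]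
  simp [christoffel_eq (show (2 : Fin 4) ∈ sphere by decide), metric_self,
    metric_of_ne (show (3 : Fin 4) ≠ 2 by decide), metric_of_ne (show (2 : Fin 4) ≠ 3 by decide),
    pd_zero_field, h, pd_three]

theorem lapS_eq (u : Field) (he : Exterior M r θ) :
    lapS M u t r θ = -(pd 2 (pd 2 u) t r θ + Real.cos θ / Real.sin θ * pd 2 u t r θ) / r ^ 2 := by
  have hr0 := radius_cast_ne_zero he.1
  have hs0 := he.sin_ne_zero
  have e : lapS M u = invMetric M 2 2 * hessS M u 2 2 + invMetric M 3 3 * hessS M u 3 3 := by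
    simp [lapS, sphere, invMetric_of_ne (show (2 : Fin 4) ≠ 3 by decide),
      invMetric_of_ne (show (3 : Fin 4) ≠ 2 by decide)]
  rw [e]
  simp only [Pi.add_apply, Pi.mul_apply, hessS_two_two u, hessS_three_three u he,
    invMetric_self, Pi.inv_apply, metricDiag]
  push_cast at hs0 ⊢
  field_simp
  ring

theorem volS_two_three (t r θ : ℝ) : volS 2 3 t r θ = r ^ 2 * Real.sin θ := by
  have h2 := rt2_ne_zero
  have hc : (starRingEnd ℂ) rt2 = rt2 := Complex.conj_ofReal _
  simp only [volS, coM, coMbar, conjF, Pi.smul_apply, Pi.sub_apply, Pi.mul_apply, smul_eq_mul,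
    map_neg, map_mul, map_div₀, Complex.conj_ofReal, Complex.conj_I, hc]
  field_simp
  rw [rt2_sq]
  linear_combination (-2 * (r : ℂ) ^ 2 * Real.sin θ) * Complex.I_sq

theorem volS_three_two (t r θ : ℝ) : volS 3 2 t r θ = -(r ^ 2 * Real.sin θ) := by
  rw [← volS_two_three t r θ]
  simp only [volS, Pi.smul_apply, Pi.sub_apply, Pi.mul_apply, smul_eq_mul]
  ring

theorem volS_self (a : Fin 4) (t r θ : ℝ) : volS a a t r θ = 0 := by
  simp [volS, mul_comm]

theorem volS_one (a : Fin 4) : volS 1 a = 0 ∧ volS a 1 = 0 := by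
  constructor <;> funext t r θ <;> simp [volS, coM, coMbar, conjF]

theorem volSMixed_two_three (he : Exterior M r θ) :
    volSMixed M 2 3 t r θ = -(1 / Real.sin θ) := by
  have hr0 := radius_cast_ne_zero he.1
  have hs0 := he.sin_ne_zero
  simp only [volSMixed, sphere, Finset.sum_insert (show (2 : Fin 4) ∉ ({3} : Finset (Fin 4)) by decide),
    Finset.sum_singleton, invMetric_of_ne (show (2 : Fin 4) ≠ 3 by decide), invMetric_self,
    Pi.add_apply, Pi.mul_apply, volS_two_three, Pi.zero_apply, Pi.inv_apply, metricDiag]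
  push_cast at hs0 ⊢
  field_simp
  ring

theorem volSMixed_three_two (he : Exterior M r θ) :
    volSMixed M 3 2 t r θ = Real.sin θ := by
  have hr0 := radius_cast_ne_zero he.1
  simp only [volSMixed, sphere, Finset.sum_insert (show (2 : Fin 4) ∉ ({3} : Finset (Fin 4)) by decide),
    Finset.sum_singleton, invMetric_of_ne (show (3 : Fin 4) ≠ 2 by decide), invMetric_self,
    Pi.add_apply, Pi.mul_apply, volS_three_two, Pi.zero_apply, Pi.inv_apply, metricDiag]
  push_cast
  field_simp
  ring

omit hM in
theorem volSMixed_two_two : volSMixed M 2 2 t r θ = 0 := by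
  simp [volSMixed, sphere, invMetric_of_ne (show (3 : Fin 4) ≠ 2 by decide), volS_self]

omit hM in
theorem volSMixed_three_three : volSMixed M 3 3 t r θ = 0 := by
  simp [volSMixed, sphere, invMetric_of_ne (show (2 : Fin 4) ≠ 3 by decide), volS_self]

omit hM in
theorem volSMixed_one (c : Fin 4) : volSMixed M 1 c t r θ = 0 := by
  simp [volSMixed, (volS_one _).1]

theorem coR_one (he : Exterior M r θ) : coR M 1 t r θ = r / √(Del M r) := by
  have hr0 := radius_cast_ne_zero he.1
  have hs0 := sqrt_cast_ne_zero he.1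
  have h2 := rt2_ne_zero
  simp only [coR, coN, coL, Pi.smul_apply, Pi.sub_apply, smul_eq_mul, sqrtDel]
  field_simp
  rw [rt2_sq]
  ring

omit hM in
theorem coR_two : coR M 2 = 0 := by simp [coR, coN, coL]
omit hM in
theorem coR_three : coR M 3 = 0 := by simp [coR, coN, coL]

/-- An axial tensor has the two independent components `T 1 3` and `T 2 3`. -/
theorem isMoncrief_iff {T : Tensor2}
    (hT : ∀ t r θ, T 3 1 t r θ = T 1 3 t r θ ∧ T 3 2 t r θ = T 2 3 t r θ) (u₁ u₂ : Field) :
    IsMoncrief M (axial T) u₁ u₂ ↔ ∀ t r θ, Exterior M r θ →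
      T 1 3 t r θ = r / √(Del M r) * Real.sin θ * pd 2 u₁ t r θ ∧
      T 2 3 t r θ = Real.cos θ * pd 2 u₂ t r θ - Real.sin θ * pd 2 (pd 2 u₂) t r θ := by
  have hsum : ∀ a b, ∀ t r θ, moncriefForm M u₁ u₂ a b t r θ =
      (coR M a t r θ * volSMixed M b 2 t r θ + coR M b t r θ * volSMixed M a 2 t r θ)
        * pd 2 u₁ t r θ
      - ((volSMixed M a 2 t r θ * hessS M u₂ b 2 t r θ
            + volSMixed M b 2 t r θ * hessS M u₂ a 2 t r θ)
          + (volSMixed M a 3 t r θ * hessS M u₂ b 3 t r θ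
            + volSMixed M b 3 t r θ * hessS M u₂ a 3 t r θ)) := by
    intro a b t r θ
    simp [moncriefForm, sphere, pd_three]
  refine forall₄_congr fun t r θ he => ?_
  have hr0 := radius_cast_ne_zero he.1
  have hs0 := he.sin_ne_zero
  have hσ0 := sqrt_cast_ne_zero he.1
  have e13 : moncriefForm M u₁ u₂ 1 3 t r θ =
      r / √(Del M r) * Real.sin θ * pd 2 u₁ t r θ := by
    rw [hsum, volSMixed_three_two he, volSMixed_one, volSMixed_one, volSMixed_three_three,
      coR_one he, coR_three]
    simp [hessS, covD, sphere]
  have e23 : moncriefForm M u₁ u₂ 2 3 t r θ =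
      Real.cos θ * pd 2 u₂ t r θ - Real.sin θ * pd 2 (pd 2 u₂) t r θ := by
    rw [hsum, volSMixed_three_two he, volSMixed_two_three he, volSMixed_two_two,
      volSMixed_three_three, coR_two, coR_three, hessS_two_two u₂, hessS_three_three u₂ he]
    push_cast at hs0 ⊢
    field_simp
    simp
    ring
  have esymm : ∀ a b, moncriefForm M u₁ u₂ a b t r θ = moncriefForm M u₁ u₂ b a t r θ := by
    intro a b
    rw [hsum, hsum]
    ring
  have e11 : moncriefForm M u₁ u₂ 1 1 t r θ = 0 := by
    rw [hsum]; simp [volSMixed_one]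
  have e12 : moncriefForm M u₁ u₂ 1 2 t r θ = 0 := by
    rw [hsum]; simp [volSMixed_one, volSMixed_two_two, hessS, covD, sphere]
  have e22 : moncriefForm M u₁ u₂ 2 2 t r θ = 0 := by
    rw [hsum]; simp [coR_two, volSMixed_two_two, hessS_two_three]
  have e33 : moncriefForm M u₁ u₂ 3 3 t r θ = 0 := by
    rw [hsum]; simp [coR_three, volSMixed_three_three, hessS_three_two]
  have a31 := esymm 3 1
  have a32 := esymm 3 2
  have a21 := esymm 2 1
  have := hT t r θ
  have s1 : reflSign 1 = 1 := if_neg (by decide)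
  have s2 : reflSign 2 = 1 := if_neg (by decide)
  have s3 : reflSign 3 = -1 := if_pos rfl
  simp only [slice, Finset.mem_insert, Finset.mem_singleton, forall_eq_or_imp, forall_eq,
    axial, Pi.smul_apply, Pi.sub_apply, smul_eq_mul, s1, s2, s3, a31, a32, a21, e11, e12, e22, e33,
    e13, e23, this]
  have half : ∀ z : ℂ, 1 / 2 * (z - 1 * -1 * z) = z ∧ 1 / 2 * (z - -1 * 1 * z) = z :=
    fun z => ⟨by ring, by ring⟩
  have none : ∀ z : ℂ, 1 / 2 * (z - 1 * 1 * z) = 0 ∧ 1 / 2 * (z - -1 * -1 * z) = 0 :=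
    fun z => ⟨by ring, by ring⟩
  simp only [half, none]
  tauto

end

end

/-! ### Axial components of the perturbation and of the momentum, and the DHR tensor -/

section

variable {M : ℝ}

/-! ### Components of the metric perturbation and of its momentum -/

theorem hertzMetric_symm (ψ : Field) (a b : Fin 4) :
    hertzMetric M ψ a b = hertzMetric M ψ b a := by
  simp only [hertzMetric, mul_comm (coL M b), mul_comm (coM b), add_comm]

theorem admMomentum_symm {γ : Tensor2} (hγ : ∀ a b, γ a b = γ b a) (a b : Fin 4) :
    admMomentum M γ a b = admMomentum M γ b a := by
  have hm : metric M a b = metric M b a := by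
    by_cases h : a = b
    · rw [h]
    · rw [metric_of_ne h, metric_of_ne (Ne.symm h)]
  simp only [admMomentum, velocity, hm, hγ a b, shiftTerm,
    add_comm (covD M slice (fun c => γ c 0) a b)]

section

variable [hM : Fact (0 < M)] {ψ : Field} {P : smoothAlg M} (h : Rep M 2 ψ P)

/-- Off the diagonal the trace term drops out, the background metric being diagonal. -/
theorem admMomentum_of_ne (γ : Tensor2) {a b : Fin 4} (hab : a ≠ b) {t r θ : ℝ}
    (he : Exterior M r θ) :
    admMomentum M γ a b t r θ =
      1 / 2 * (r / √(Del M r) * (pd 0 (γ a b) t r θ - shiftTerm M γ a b t r θ)) := by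
  have hr0 := radius_cast_ne_zero he.1
  have hσ0 := sqrt_cast_ne_zero he.1
  simp only [admMomentum, velocity, metric_of_ne hab, lapse, sqrtDel, rad, Pi.sub_apply,
    Pi.mul_apply, Pi.smul_apply, Pi.inv_apply,
    Pi.zero_apply, smul_eq_mul, mul_zero, sub_zero]
  field_simp

include h

/-- The covector l has no angular and m no radial component, so only the V term contributes; for the
same reason the θφ component sees only W. -/
theorem Rep.hertzMetric_one_three :
    Rep M 2 (hertzMetric M ψ 1 3) ((Complex.I / 8) • (rE ^ 2 * siE * vE P)) := fun t r θ he => by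
  have hr0 := radius_cast_ne_zero he.1
  have hσ0 := sqrt_cast_ne_zero he.1
  have h2 := rt2_ne_zero
  simp only [hertzMetric, Pi.sub_apply, Pi.add_apply, Pi.neg_apply, Pi.mul_apply, Pi.smul_apply,
    smul_eq_mul, coL, coM, Pi.zero_apply, h.hertzV t r θ he, ev_smul, ev_mul, ev_siE he.1,
    ev_pow _ _ _ _ _ he.1, ev_rE he.1, sqrtDel]
  field_simp
  rw [rt2_sq]
  ring

theorem Rep.hertzMetric_two_three :
    Rep M 3 (hertzMetric M ψ 2 3) (-((Complex.I / 4) • (rE ^ 2 * wE P))) := fun t r θ he => by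
  have hr0 := radius_cast_ne_zero he.1
  have h2 := rt2_ne_zero
  simp only [hertzMetric, Pi.sub_apply, Pi.add_apply, Pi.neg_apply, Pi.mul_apply, Pi.smul_apply,
    smul_eq_mul, coL, coM, Pi.zero_apply, h.hertzW t r θ he, ev_smul, ev_neg, ev_mul,
    ev_pow _ _ _ _ _ he.1, ev_rE he.1]
  field_simp
  rw [rt2_sq]
  ring

theorem Rep.hertzMetric_three_zero :
    Rep M 2 (hertzMetric M ψ 3 0) (-((Complex.I / 8) • (sE * vE P))) := fun t r θ he => by
  have hr0 := radius_cast_ne_zero he.1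
  have h2 := rt2_ne_zero
  simp only [hertzMetric, Pi.sub_apply, Pi.add_apply, Pi.neg_apply, Pi.mul_apply, Pi.smul_apply,
    smul_eq_mul, coL, coM, Pi.zero_apply, h.hertzV t r θ he, ev_smul, ev_neg, ev_mul, ev_sE he.1,
    sqrtDel]
  field_simp
  rw [rt2_sq]
  ring

/-- The time derivative of the rφ component and the radial derivative of the shift combine to (þ +
ρ)V, which `thorn_vE` turns into 2 ð Ψ_DHR. -/
theorem Rep.momentum_one_three :
    Rep M 2 (admMomentum M (hertzMetric M ψ) 1 3)
      ((Complex.I / 8) • (rE ^ 2 * siE * opEth 2 (dhrE P))) := fun t r θ he => by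
  have hr0 := radius_cast_ne_zero he.1
  have hσ0 := sqrt_cast_ne_zero he.1
  have hm : Complex.I * ev (opThorn (-2) (vE P) + rhoE * vE P) t r (Real.cos θ) =
      Complex.I * ev ((2 : ℂ) • opEth 2 (dhrE P)) t r (Real.cos θ) := by rw [thorn_vE]
  rw [admMomentum_of_ne _ (by decide) he, shiftTerm_one_three _ he,
    h.hertzMetric_one_three.pd_zero t r θ he, h.hertzMetric_three_zero.pd_one t r θ he,
    h.hertzMetric_three_zero t r θ he]
  simp only [opThorn, opD, epsE, rhoE, map_neg, Derivation.map_smul, Derivation.leibniz,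
    Derivation.leibniz_pow, dT_rE, dT_siE, dR_sE, smul_zero, mul_zero, add_zero, smul_eq_mul,
    ev_add, ev_sub, ev_neg, ev_smul, ev_mul, ev_pow _ _ _ _ _ he.1, ev_rE he.1, ev_riE he.1,
    ev_sE he.1, ev_siE he.1] at hm ⊢
  generalize (√(Del M r) : ℂ) = σ at *
  field_simp at hm ⊢
  linear_combination (1 / 2 : ℂ) * (Real.sin θ : ℂ) ^ 2 * hm

/-- W and V are kept here; relating this expression to Ψ_DHR needs the Teukolsky equation, see
`twist_radial`. -/
theorem Rep.momentum_two_three :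
    Rep M 3 (admMomentum M (hertzMetric M ψ) 2 3)
      ((Complex.I / 8) • (rE * siE * (-(rE ^ 2 * dT (wE P)) - (1 / 2 : ℂ) • (sE * dX (vE P))))) :=
  fun t r θ he => by
  have hr0 := radius_cast_ne_zero he.1
  have hs0 := he.sin_ne_zero
  have hσ0 := sqrt_cast_ne_zero he.1
  rw [admMomentum_of_ne _ (by decide) he, shiftTerm_two_three _ he,
    h.hertzMetric_two_three.pd_zero t r θ he, h.hertzMetric_three_zero.pd_two he,
    h.hertzMetric_three_zero t r θ he]
  simp only [map_neg, Derivation.map_smul, Derivation.leibniz,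
    Derivation.leibniz_pow, dT_rE, dX_sE, smul_zero, mul_zero, add_zero, smul_eq_mul,
    ev_sub, ev_neg, ev_smul, ev_mul, ev_pow _ _ _ _ _ he.1, ev_rE he.1,
    ev_sE he.1, ev_siE he.1]
  generalize (√(Del M r) : ℂ) = σ at *
  push_cast at hs0 ⊢
  field_simp
  ring

end

section

variable [hM : Fact (0 < M)]

/-- Moncrief's equations for potentials in the algebra. -/
theorem isMoncrief_iff_vanishes {T : Tensor2} (hT : ∀ a b, T a b = T b a) {K₁ K₂ A₁ A₂ : smoothAlg M}
    (h13 : Rep M 2 (T 1 3) K₁) (h23 : Rep M 3 (T 2 3) K₂) {u₁ u₂ : Field}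
    (h₁ : Rep M 0 u₁ A₁) (h₂ : Rep M 0 u₂ A₂) :
    IsMoncrief M (axial T) u₁ u₂ ↔
      Vanishes (rE * siE * dX A₁ + K₁) ∧ Vanishes (dX (dX A₂) + K₂) := by
  have e : ∀ t r θ, Exterior M r θ →
      ((T 1 3 t r θ = r / √(Del M r) * Real.sin θ * pd 2 u₁ t r θ ↔
        ev (rE * siE * dX A₁ + K₁) t r (Real.cos θ) = 0) ∧
      (T 2 3 t r θ = Real.cos θ * pd 2 u₂ t r θ - Real.sin θ * pd 2 (pd 2 u₂) t r θ ↔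
        ev (dX (dX A₂) + K₂) t r (Real.cos θ) = 0)) := by
    intro t r θ he
    have hs0 := he.sin_ne_zero
    rw [h13 t r θ he, h23 t r θ he, h₂.pd_two_zero.pd_two he, h₂.pd_two_zero t r θ he,
      h₁.pd_two_zero t r θ he]
    simp only [ev_add, ev_mul, ev_rE he.1, ev_siE he.1, ev_neg, map_neg]
    constructor
    · constructor <;> intro hh
      · exact (mul_eq_zero.1 (show (Real.sin θ : ℂ) ^ 2 * _ = 0 by
          linear_combination hh)).resolve_left (pow_ne_zero 2 hs0)
      · linear_combination (Real.sin θ : ℂ) ^ 2 * hh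
    · constructor <;> intro hh
      · refine (mul_eq_zero.1 (show (Real.sin θ : ℂ) ^ 3 * _ = 0 from ?_)).resolve_left
          (pow_ne_zero 3 hs0)
        push_cast at hh ⊢
        linear_combination hh
      · push_cast
        linear_combination (Complex.sin θ) ^ 3 * hh
  rw [isMoncrief_iff fun t r θ => ⟨by rw [hT], by rw [hT]⟩]
  constructor
  · intro hh
    exact ⟨vanishes_of_exterior fun t r θ he => (e t r θ he).1.1 (hh t r θ he).1,
      vanishes_of_exterior fun t r θ he => (e t r θ he).2.1 (hh t r θ he).2⟩
  · rintro ⟨v₁, v₂⟩ t r θ he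
    exact ⟨(e t r θ he).1.2 (v₁.exterior he), (e t r θ he).2.2 (v₂.exterior he)⟩

end

/-! ### Potentials of the DHR tensor -/

/-- Valid also where f is not differentiable, as both derivatives are then 0 by default. It keeps
the derivatives of f and g real, as complex conjugation below requires. -/
theorem deriv_ofReal (f : ℝ → ℝ) (x : ℝ) : deriv (fun s => (f s : ℂ)) x = ((deriv f x : ℝ) : ℂ) := by
  by_cases h : DifferentiableAt ℝ f x
  · exact h.hasDerivAt.ofReal_comp.deriv
  · have h' : ¬ DifferentiableAt ℝ (fun s => (f s : ℂ)) x := fun hd =>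
      h (Complex.reCLM.differentiableAt.comp x hd)
    rw [deriv_zero_of_not_differentiableAt h, deriv_zero_of_not_differentiableAt h',
      Complex.ofReal_zero]

theorem pd_two_ofRealF (f : ℝ → ℝ → ℝ → ℝ) :
    pd 2 (ofRealF f) = ofRealF fun t r θ => deriv (f t r) θ := by
  funext t r θ
  exact deriv_ofReal (f t r) θ

section

variable [hM : Fact (0 < M)]

/-- Both sides are real, symmetric and trace-free tensors on the sphere, so they are equal exactly
when their complex spin components are. -/
theorem isDHRPotentials_iff (ψ : Field) (f g : ℝ → ℝ → ℝ → ℝ) :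
    IsDHRPotentials M ψ f g ↔ ∀ t r θ, Exterior M r θ →
      dhrScalar M ψ t r θ = -(2 / r) *
        ((pd 2 (pd 2 (ofRealF f)) t r θ - Real.cos θ / Real.sin θ * pd 2 (ofRealF f) t r θ)
        + Complex.I * (pd 2 (pd 2 (ofRealF g)) t r θ
            - Real.cos θ / Real.sin θ * pd 2 (ofRealF g) t r θ)) := by
  refine forall₄_congr fun t r θ he => ?_
  have hr0 := radius_cast_ne_zero he.1
  have hs0 := he.sin_ne_zero
  have h2 := rt2_ne_zero
  have hc : (starRingEnd ℂ) rt2 = rt2 := Complex.conj_ofReal _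
  simp only [sphere, Finset.mem_insert, Finset.mem_singleton, forall_eq_or_imp, forall_eq,
    Finset.sum_insert (show (2 : Fin 4) ∉ ({3} : Finset (Fin 4)) by decide), Finset.sum_singleton,
    volSMixed_two_two, volSMixed_three_three, volSMixed_two_three he, volSMixed_three_two he,
    hessS_two_three, hessS_three_two, hessS_two_two, hessS_three_three _ he, lapS_eq _ he,
    metric_self, metric_of_ne (show (2 : Fin 4) ≠ 3 by decide),
    metric_of_ne (show (3 : Fin 4) ≠ 2 by decide), metricDiag, pd_two_ofRealF, ofRealF,
    dhrTensor, coM, coMbar, conjF, Pi.smul_apply, Pi.add_apply, Pi.mul_apply, Pi.neg_apply,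
    Pi.zero_apply, smul_eq_mul, map_neg, map_mul, map_div₀, Complex.conj_ofReal, Complex.conj_I,
    hc, rad]
  generalize dhrScalar M ψ t r θ = Ψ
  generalize deriv (fun θ => deriv (f t r) θ) θ = f₂
  generalize deriv (fun θ => deriv (g t r) θ) θ = g₂
  generalize deriv (f t r) θ = f₁
  generalize deriv (g t r) θ = g₁
  have hI := Complex.I_sq
  push_cast at hs0 ⊢
  generalize hΨ' : (starRingEnd ℂ) Ψ = Ψ'
  constructor
  · rintro ⟨⟨h22, h23⟩, -⟩
    field_simp at h22 h23 ⊢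
    simp only [rt2_sq] at h22 h23
    refine mul_left_cancel₀ (mul_ne_zero (pow_ne_zero 2 hr0) hs0) ?_
    -- The θθ and θφ components are combined with a relative factor i so that the conjugate of Ψ_DHR
    -- cancels.
    linear_combination (-((r : ℂ) ^ 2 * Complex.sin θ) / 4) * h22 + (Complex.I / 4) * h23
      + (1 / 2 * (r : ℂ) ^ 3 * Complex.sin θ ^ 2 * (Ψ - Ψ')) * hI
  · intro hΨ
    have hconj := congrArg (starRingEnd ℂ) hΨ
    simp only [hΨ', map_mul, map_neg, map_div₀, map_add, map_sub, Complex.conj_ofReal,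
      Complex.conj_I, map_ofNat, ← Complex.ofReal_sin, ← Complex.ofReal_cos] at hconj
    push_cast at hconj
    rw [hΨ, hconj]
    refine ⟨⟨?_, ?_⟩, ?_, ?_⟩ <;> field_simp <;> simp only [rt2_sq] <;> ring_nf <;>
      simp only [Complex.I_sq] <;> ring

end

end

/-! ### Regularity at the axis, potentials without low modes, and Moncrief's variables in the
algebra -/

section

variable {M : ℝ}

/-! ### Functions that are smooth up to the axis -/

/-- `ξ = G(t, r, cos θ)` up to the axis. -/
def AxisRep (M : ℝ) (ξ : Field) (G : smoothAlg M) : Prop :=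
  ∀ t r θ : ℝ, 2 * M < r → 0 ≤ θ → θ ≤ Real.pi → ξ t r θ = ev G t r (Real.cos θ)

theorem AxisRep.rep {ξ : Field} {G : smoothAlg M} (h : AxisRep M ξ G) : Rep M 0 ξ G :=
  fun t r θ he => by rw [pow_zero, one_mul, h t r θ he.1 he.2.1.le he.2.2.le]

theorem SmoothSpin.exists_rep {k : ℕ} {ξ : Field} (h : SmoothSpin M k ξ) :
    ∃ G, Rep M k ξ G := by
  obtain ⟨F, hF, he⟩ := h
  exact ⟨smoothAlg.mk F hF, fun t r θ hx => by
    rw [ev_mk hF hx.1, he t r θ hx.1 hx.2.1.le hx.2.2.le]⟩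

theorem SmoothSpin.exists_axisRep {ξ : Field} (h : SmoothSpin M 0 ξ) : ∃ G, AxisRep M ξ G := by
  obtain ⟨F, hF, he⟩ := h
  exact ⟨smoothAlg.mk F hF, fun t r θ hr h0 hπ => by
    rw [ev_mk hF hr, he t r θ hr h0 hπ, pow_zero, one_mul]⟩

theorem AxisRep.smoothSpin {ξ : Field} {G : smoothAlg M} (h : AxisRep M ξ G) : SmoothSpin M 0 ξ :=
  ⟨fun p => ev G p.1 p.2.1 p.2.2, contDiffOn_ev G, fun t r θ hr h0 hπ => by
    rw [pow_zero, one_mul, h t r θ hr h0 hπ]⟩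

/-- The substitution x = cos θ, carried out by the fundamental theorem of calculus. -/
theorem integral_ev_cos (G : smoothAlg M) {t r : ℝ} (hr : 2 * M < r) :
    ∫ θ in (0 : ℝ)..Real.pi, ev G t r (Real.cos θ) * Real.sin θ = ev (moment G) t r 0 := by
  have hd : ∀ θ ∈ Set.uIcc (0 : ℝ) Real.pi, HasDerivAt (fun s => -ev (intX G) t r (Real.cos s))
      (ev G t r (Real.cos θ) * Real.sin θ) θ := fun θ _ => by
    have h2 := (hasDerivAt_ev_x (intX G) (t := t) hr).scomp θ (Real.hasDerivAt_cos θ)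
    rw [dX_intX] at h2
    refine h2.neg.congr_deriv ?_
    rw [Complex.real_smul]
    push_cast
    ring
  have hc : Continuous fun θ : ℝ => ev G t r (Real.cos θ) * (Real.sin θ : ℂ) :=
    ((continuous_ev_x G t hr).comp Real.continuous_cos).mul
      (Complex.continuous_ofReal.comp Real.continuous_sin)
  rw [intervalIntegral.integral_eq_sub_of_hasDerivAt hd (hc.intervalIntegrable _ _), moment, ev_sub,
    ev_atX _ _ hr, ev_atX _ _ hr, Real.cos_pi, Real.cos_zero]
  ring

theorem AxisRep.noLowModes_iff {ξ : Field} {G : smoothAlg M} (h : AxisRep M ξ G) :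
    NoLowModes M ξ ↔ moment G = 0 ∧ moment (xE * G) = 0 := by
  have e0 : ∀ t r : ℝ, 2 * M < r →
      ∫ θ in (0 : ℝ)..Real.pi, ξ t r θ * Real.sin θ = ev (moment G) t r 0 := fun t r hr => by
    rw [← integral_ev_cos G hr]
    refine intervalIntegral.integral_congr fun θ hθ => ?_
    rw [Set.uIcc_of_le Real.pi_pos.le] at hθ
    simp only [h t r θ hr hθ.1 hθ.2]
  have e1 : ∀ t r : ℝ, 2 * M < r →
      ∫ θ in (0 : ℝ)..Real.pi, ξ t r θ * Real.cos θ * Real.sin θ = ev (moment (xE * G)) t r 0 :=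
    fun t r hr => by
    rw [← integral_ev_cos _ hr]
    refine intervalIntegral.integral_congr fun θ hθ => ?_
    rw [Set.uIcc_of_le Real.pi_pos.le] at hθ
    simp only [h t r θ hr hθ.1 hθ.2, ev_mul, ev_xE hr, mul_comm (ev G t r _)]
  constructor
  · intro hl
    constructor <;> refine ev_ext fun t r x hr => ?_ <;>
      rw [ev_eq_of_dX_eq_zero (dX_moment _) x 0 hr, ev_zero]
    · rw [← e0 t r hr, (hl t r hr).1]
    · rw [← e1 t r hr, (hl t r hr).2]
  · rintro ⟨h0, h1⟩ t r hr
    rw [e0 t r hr, e1 t r hr, h0, h1, ev_zero]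
    exact ⟨rfl, rfl⟩

/-! ### Real parts -/

/-- The image of a smooth function under a real-linear map. -/
def mapE (L : ℂ →L[ℝ] ℂ) (G : smoothAlg M) : smoothAlg M :=
  smoothAlg.mk (fun p => L (ev G p.1 p.2.1 p.2.2)) (L.contDiff.comp_contDiffOn (contDiffOn_ev G))

section

variable (L : ℂ →L[ℝ] ℂ) (G : smoothAlg M)

theorem ev_mapE {t r x : ℝ} (hr : 2 * M < r) : ev (mapE L G) t r x = L (ev G t r x) := ev_mk _ hr

theorem dX_mapE : dX (mapE L G) = mapE L (dX G) := dX_eq_of_hasDerivAt fun t r x hr => by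
  rw [ev_mapE L _ hr]
  exact (L.hasFDerivAt.comp_hasDerivAt x (hasDerivAt_ev_x G hr)).congr_of_eventuallyEq
    (Filter.Eventually.of_forall fun y => ev_mapE L G hr)

theorem moment_mapE : moment (mapE L G) = mapE L (moment G) := by
  rw [moment_eq (H := mapE L (intX G)) (by rw [dX_mapE, dX_intX])]
  refine ev_ext fun t r x hr => ?_
  simp only [moment, ev_sub, ev_atX _ _ hr, ev_mapE L _ hr, map_sub]

theorem xE_mul_mapE : xE * mapE L G = mapE L (xE * G) := ev_ext fun t r x hr => by
  rw [ev_mul, ev_mapE L _ hr, ev_mapE L _ hr, ev_mul, ev_xE hr, ← Complex.real_smul,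
    ← Complex.real_smul, map_smul]

theorem mapE_zero : mapE L (0 : smoothAlg M) = 0 := ev_ext fun t r x hr => by
  rw [ev_mapE L _ hr, ev_zero, map_zero]

end

/-! ### Existence of potentials without low modes -/

/-- Only a function of (t, r) is free in A, and it is spent on ℓ = 0. The ℓ = 1 moment vanishes by
itself: integration by parts turns it into half the integral of (1 - x²)∂_x A, and (1 - x²) r `opEth
2 Z` is -∂_x((1 - x²)² Z). In other words, ð of a field of spin weight -2 has no ℓ = 1 part. -/
theorem exists_primitive_noLowModes [hM : Fact (0 < M)] (c : ℂ) (Z : smoothAlg M) :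
    ∃ A : smoothAlg M, dX A = c • (rE * opEth 2 Z) ∧ moment A = 0 ∧ moment (xE * A) = 0 := by
  have hA : dX (intX (c • (rE * opEth 2 Z)) - (1 / 2 : ℂ) • moment (intX (c • (rE * opEth 2 Z))))
      = c • (rE * opEth 2 Z) := by
    rw [map_sub, Derivation.map_smul, dX_moment, smul_zero, sub_zero, dX_intX]
  refine ⟨_, hA, ?_, ?_⟩
  · generalize intX (c • (rE * opEth 2 Z)) = A
    have : moment (moment A * xE ^ 0) = moment A * moment (xE ^ 0) := moment_mul _ (dX_moment A)
    rw [pow_zero, mul_one, ← pow_zero (xE : smoothAlg M), moment_pow] at this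
    rw [moment_sub, moment_smul, this]
    norm_num [Algebra.smul_def]
    rw [mul_left_comm, ← map_mul]
    norm_num
  · generalize intX (c • (rE * opEth 2 Z)) - (1 / 2 : ℂ) • moment (intX (c • (rE * opEth 2 Z))) = A
      at hA
    have h1 := rE_mul_riE (M := M)
    have h2 : algebraMap ℂ (smoothAlg M) (1 / 2) * 2 = 1 := by
      rw [← map_ofNat (algebraMap ℂ (smoothAlg M)) 2, ← map_mul]; norm_num
    -- An explicit primitive of xA that vanishes at x = ±1.
    rw [moment_eq (H := -((1 / 2 : ℂ) • ((1 - xE ^ 2) * A + c • ((1 - xE ^ 2) ^ 2 * Z))))]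
    · refine ev_ext fun t r x hr => ?_
      simp [ev_sub, ev_neg, ev_smul, ev_add, ev_mul, ev_atX _ _ hr, ev_pow _ _ _ _ _ hr, ev_xE hr,
        ev_one _ _ _ hr, ev_zero]
    · simp only [map_neg, map_add, map_sub, Derivation.map_smul, Derivation.leibniz,
        Derivation.leibniz_pow, Derivation.map_one_eq_zero, dX_xE, hA, smul_eq_mul, nsmul_eq_mul]
      simp only [opEth, Algebra.smul_def, map_mul, map_ofNat]
      push_cast
      generalize algebraMap ℂ (smoothAlg M) (1 / 2) = a at *
      linear_combination (xE * A) * h2 + (a * algebraMap ℂ (smoothAlg M) c * (1 - xE ^ 2)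
        * ((1 - xE ^ 2) * dX Z - 4 * xE * Z)) * h1

theorem exists_second_primitive_noLowModes (K : smoothAlg M) :
    ∃ A : smoothAlg M, dX (dX A) = K ∧ moment A = 0 ∧ moment (xE * A) = 0 :=
  ⟨removeLow (intX (intX K)), by rw [dX_dX_removeLow, dX_intX, dX_intX], moment_removeLow _,
    moment_xE_mul_removeLow _⟩

/-- The function of `(t, r, θ)` with a given expression in `cos θ`. -/
def toField (G : smoothAlg M) : Field := fun t r θ => ev G t r (Real.cos θ)

theorem axisRep_toField (G : smoothAlg M) : AxisRep M (toField G) G := fun _ _ _ _ _ _ => rfl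

/-! ### Moncrief's variables -/

/-- Without φ-dependence δ and δ' coincide, so the operator is ð'ð' on weight (0, 0), and no
separate rule is needed. -/
theorem deltaDelta_eq (u : Field) : deltaDelta u = eth' 0 2 (eth' 0 0 u) := by
  have h : ∀ v : Field, npDelta v = npDelta' v := fun v => by
    funext t r θ
    simp only [npDelta, npDelta', pd_three, mul_zero, add_zero, sub_zero]
  funext t r θ
  simp [deltaDelta, eth', h]

section

variable [hM : Fact (0 < M)]

theorem Rep.deltaDelta {u : Field} {A : smoothAlg M} (h : Rep M 0 u A) :
    Rep M 2 (deltaDelta u) ((1 / 2 : ℂ) • (riE ^ 2 * dX (dX A))) := by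
  rw [deltaDelta_eq]
  refine ((h.eth' 0 0 (by norm_num)).eth' 0 2 (by norm_num)).congr ?_
  rw [opEth'_smul, smul_smul, rt2_inv_sq]
  simp only [opEth', map_neg, Derivation.leibniz, dX_riE, smul_eq_mul]
  congr 1
  ring

/-- The Regge-Wheeler variable of potentials in the algebra. -/
def rwE (A₁ A₂ : smoothAlg M) : smoothAlg M :=
  sE * (A₁ * riE ^ 2 + sE * riE * dR (A₂ * riE ^ 2))

theorem Rep.rwQ {q₁ q₂ : Field} {A₁ A₂ : smoothAlg M} (h₁ : Rep M 0 q₁ A₁) (h₂ : Rep M 0 q₂ A₂) :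
    Rep M 0 (rwQ M q₁ q₂) (rwE A₁ A₂) := by
  have hi : Rep M 0 (rad⁻¹ : Field) riE := fun t r θ he => by
    rw [ev_riE he.1, pow_zero, one_mul]; rfl
  have hi2 : Rep M 0 ((rad ^ 2)⁻¹ : Field) (riE ^ 2) := fun t r θ he => by
    rw [ev_pow _ _ _ _ _ he.1, ev_riE he.1, pow_zero, one_mul, inv_pow]; rfl
  exact rep_sqrtDel.mul ((h₁.mul hi2).add ((rep_sqrtDel.mul hi).mul (h₂.mul hi2).pd_one))

theorem dX_dX_rwE (A₁ A₂ : smoothAlg M) : dX (dX (rwE A₁ A₂)) = rwE (dX (dX A₁)) (dX (dX A₂)) := by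
  have e1 : ∀ G : smoothAlg M, dX (G * riE ^ 2) = dX G * riE ^ 2 := fun G => by
    simp [Derivation.leibniz, Derivation.leibniz_pow, dX_riE, mul_comm]
  have e2 : ∀ G : smoothAlg M, dX (sE * riE * G) = sE * riE * dX G := fun G => by
    simp [Derivation.leibniz, dX_riE, dX_sE]
  have e3 : ∀ G : smoothAlg M, dX (sE * G) = sE * dX G := fun G => by
    simp [Derivation.leibniz, dX_sE]
  simp only [rwE, e3, e2, map_add, e1, dX_dR]

theorem moment_rwE {A₁ A₂ : smoothAlg M} (h₁ : moment A₁ = 0) (h₂ : moment A₂ = 0) :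
    moment (rwE A₁ A₂) = 0 := by
  have hr : dX (riE ^ 2 : smoothAlg M) = 0 := by simp [Derivation.leibniz_pow, dX_riE]
  have hs : dX (sE * riE : smoothAlg M) = 0 := by simp [Derivation.leibniz, dX_riE, dX_sE]
  rw [rwE, moment_mul _ dX_sE, moment_add, mul_comm A₁, mul_comm A₂, moment_mul _ hr,
    moment_mul _ hs, moment_dR, moment_mul _ hr, h₁, h₂]
  simp

/-- Q_RW differentiates only in r, so the ℓ = 1 moment reduces to the plain moment of x times the
potentials. -/
theorem xE_mul_rwE (A₁ A₂ : smoothAlg M) : xE * rwE A₁ A₂ = rwE (xE * A₁) (xE * A₂) := by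
  have e : dR (xE * A₂ * riE ^ 2) = xE * dR (A₂ * riE ^ 2) := by
    rw [mul_assoc, Derivation.leibniz, dR_xE, smul_zero, add_zero, smul_eq_mul]
  simp only [rwE, e]
  ring

end

end

section

variable {M : ℝ} [hM : Fact (0 < M)]

/-! ### The Regge-Wheeler variable and its momentum -/

section Hertz

variable {ψ : Field} {P : smoothAlg M} (h : Rep M 2 ψ P)
include h

theorem Rep.isMoncrief_metric_iff {q₁ q₂ : Field} {A₁ A₂ : smoothAlg M}
    (h₁ : Rep M 0 q₁ A₁) (h₂ : Rep M 0 q₂ A₂) :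
    IsMoncrief M (axial (hertzMetric M ψ)) q₁ q₂ ↔
      Vanishes (rE * siE * dX A₁ + (Complex.I / 8) • (rE ^ 2 * siE * vE P)) ∧
      Vanishes (dX (dX A₂) + -((Complex.I / 4) • (rE ^ 2 * wE P))) :=
  isMoncrief_iff_vanishes (hertzMetric_symm ψ) h.hertzMetric_one_three h.hertzMetric_two_three h₁ h₂

theorem Rep.isMoncrief_momentum_iff {p₁ p₂ : Field} {B₁ B₂ : smoothAlg M}
    (h₁ : Rep M 0 p₁ B₁) (h₂ : Rep M 0 p₂ B₂) :
    IsMoncrief M (axial (admMomentum M (hertzMetric M ψ))) p₁ p₂ ↔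
      Vanishes (rE * siE * dX B₁ + (Complex.I / 8) • (rE ^ 2 * siE * opEth 2 (dhrE P))) ∧
      Vanishes (dX (dX B₂) + (Complex.I / 8) •
        (rE * siE * (-(rE ^ 2 * dT (wE P)) - (1 / 2 : ℂ) • (sE * dX (vE P))))) :=
  isMoncrief_iff_vanishes (admMomentum_symm (hertzMetric_symm ψ)) h.momentum_one_three
    h.momentum_two_three h₁ h₂

theorem Rep.isDHRPotentials_iff {f g : ℝ → ℝ → ℝ → ℝ} {F G : smoothAlg M}
    (hf : Rep M 0 (ofRealF f) F) (hg : Rep M 0 (ofRealF g) G) :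
    IsDHRPotentials M ψ f g ↔
      Vanishes (rE * dhrE P + (4 : ℂ) • dX (dX (F + Complex.I • G))) := by
  have e : ∀ t r θ, Exterior M r θ →
      (dhrScalar M ψ t r θ = -(2 / r) *
        ((pd 2 (pd 2 (ofRealF f)) t r θ - Real.cos θ / Real.sin θ * pd 2 (ofRealF f) t r θ)
        + Complex.I * (pd 2 (pd 2 (ofRealF g)) t r θ
            - Real.cos θ / Real.sin θ * pd 2 (ofRealF g) t r θ)) ↔
      ev (rE * dhrE P + (4 : ℂ) • dX (dX (F + Complex.I • G))) t r (Real.cos θ) = 0) := by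
    intro t r θ he
    have hr0 := radius_cast_ne_zero he.1
    have hs0 := he.sin_ne_zero
    rw [h.dhr t r θ he, hf.pd_two_zero.pd_two he, hg.pd_two_zero.pd_two he,
      hf.pd_two_zero t r θ he, hg.pd_two_zero t r θ he]
    simp only [map_add, Derivation.map_smul, ev_add, ev_mul, ev_smul, ev_rE he.1, ev_neg, map_neg]
    push_cast at hs0 ⊢
    constructor <;> intro hh
    · refine (mul_eq_zero.1 (show Complex.sin θ ^ 2 * _ = 0 from ?_)).resolve_left
        (pow_ne_zero 2 hs0)
      field_simp at hh
      linear_combination hh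
    · field_simp
      linear_combination Complex.sin θ ^ 2 * hh
  rw [Schwarzschild.isDHRPotentials_iff]
  exact ⟨fun hh => vanishes_of_exterior fun t r θ he => (e t r θ he).1 (hh t r θ he),
    fun v t r θ he => (e t r θ he).2 (v.exterior he)⟩

/-- The Laplacian needs ∂_x and ∂_x² of p₁; both come from the rφ equation, which prescribes ∂_x p₁
as a multiple of r ð Ψ_DHR. -/
theorem rwP_of_isMoncrief {p₁ p₂ : Field} {B₁ B₂ : smoothAlg M}
    (h₁ : Rep M 0 p₁ B₁) (h₂ : Rep M 0 p₂ B₂)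
    (hm : IsMoncrief M (axial (admMomentum M (hertzMetric M ψ))) p₁ p₂) {t r θ : ℝ}
    (he : Exterior M r θ) :
    rwP M p₁ t r θ = -Complex.I * (r / (2 * Del M r)) *
      eth (-1) 1 (thorn M (-2) 0 (hertzV M ψ) + spinRho M * hertzV M ψ) t r θ ∧
    rwP M p₁ t r θ = -Complex.I * (r / Del M r) *
      eth (-1) 1 (eth (-2) 2 (dhrScalar M ψ)) t r θ := by
  have hr0 := radius_cast_ne_zero he.1
  have hs0 := he.sin_ne_zero
  have hσ0 := sqrt_cast_ne_zero he.1
  have hΔ : (Del M r : ℂ) ≠ 0 := by exact_mod_cast (Del_pos hM.out he.1).ne'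
  have v := ((h.isMoncrief_momentum_iff h₁ h₂).1 hm).1
  have d1 := v.exterior (t := t) he
  have d2 := v.dX.exterior (t := t) he
  have r1 : Rep M 1 (thorn M (-2) 0 (hertzV M ψ) + spinRho M * hertzV M ψ)
      (rt2⁻¹ • opEth 2 (dhrE P)) := by
    refine ((h.hertzV.thorn (-2) 0 (c := -2) (by norm_num)).add
      (rep_spinRho.radial_mul h.hertzV)).congr ?_
    have e2 : (rt2⁻¹ * (1 / 2) : ℂ) • (opThorn (-2) (vE P) + rhoE * vE P) =
        (rt2⁻¹ * (1 / 2) : ℂ) • ((2 : ℂ) • opEth 2 (dhrE P)) := by rw [thorn_vE]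
    rw [opThorn_smul]
    rw [smul_smul, mul_assoc] at e2
    norm_num at e2 ⊢
    rw [← e2]
    simp only [Algebra.smul_def, map_mul]
    ring
  have e1 := r1.eth (-1) 1 (c := 1) (by norm_num) (by norm_num) t r θ he
  have e2 := (h.dhr.eth (-2) 2 (c := 2) (by norm_num) (by norm_num)).eth (-1) 1 (c := 1)
    (by norm_num) (by norm_num) t r θ he
  rw [e1, e2, rwP, lapS_eq _ he, h₁.pd_two_zero.pd_two he, h₁.pd_two_zero t r θ he, opEth_smul,
    opEth_smul, opEth_smul]
  generalize opEth 2 (dhrE P) = Y at *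
  simp only [opEth, Derivation.leibniz, Derivation.map_smul, dX_rE, dX_siE, map_add,
    Derivation.leibniz_pow, smul_zero, mul_zero, add_zero, smul_eq_mul, ev_smul, ev_mul, ev_add,
    ev_sub, ev_neg, map_neg,
    ev_pow _ _ _ _ _ he.1, ev_rE he.1, ev_siE he.1, ev_xE he.1, ev_riE he.1, ev_one _ _ _ he.1]
    at d1 d2 ⊢
  have hrt := rt2_inv_sq
  have f1 : ev (dX B₁) t r (Real.cos θ) = -(Complex.I / 8) * (r * ev Y t r (Real.cos θ)) := by
    field_simp at d1
    refine mul_left_cancel₀ hr0 ?_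
    linear_combination (1 / 8 : ℂ) * d1
  have f2 : ev (dX (dX B₁)) t r (Real.cos θ) =
      -(Complex.I / 8) * (r * ev (dX Y) t r (Real.cos θ)) := by
    field_simp at d2
    refine mul_left_cancel₀ hr0 ?_
    linear_combination (1 / 8 : ℂ) * d2
  rw [f1, f2, cos_sq_cast]
  constructor
  · rw [← mul_assoc rt2⁻¹ rt2⁻¹, hrt]
    push_cast at hs0 ⊢
    field_simp
    ring
  · rw [← mul_assoc rt2⁻¹ rt2⁻¹, hrt]
    push_cast at hs0 ⊢
    field_simp
    ring

/-- The Regge-Wheeler variable in terms of `V` and `W`. -/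
theorem Rep.vanishes_rwE {q₁ q₂ : Field} {A₁ A₂ : smoothAlg M}
    (h₁ : Rep M 0 q₁ A₁) (h₂ : Rep M 0 q₂ A₂)
    (hm : IsMoncrief M (axial (hertzMetric M ψ)) q₁ q₂) :
    Vanishes (dX (dX (rwE A₁ A₂)) - (Complex.I / 8) •
      (sE * (opD (wE P) - opD' (wE P) + opEth' (vE P)))) := by
  obtain ⟨v₁, v₂⟩ := (h.isMoncrief_metric_iff h₁ h₂).1 hm
  -- Q_RW is assembled at the level of the equations: ∂_x of the first, and ∂_r of the second
  -- divided by r², with the weights that q₁ and q₂ have in Q_RW.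
  have key := (v₁.dX.mul_left (sE ^ 2 * riE ^ 3)).add
    (((v₂.mul_left (riE ^ 2)).dR).mul_left (sE ^ 2 * riE))
  convert key using 1
  have e1 : dR (riE ^ 2 * rE ^ 2 : smoothAlg M) = 0 := by
    rw [← mul_pow, mul_comm riE, rE_mul_riE, one_pow, Derivation.map_one_eq_zero]
  have e2 : dR (riE ^ 2 * (dX (dX A₂) + -((Complex.I / 4) • (rE ^ 2 * wE P)))) =
      dR (dX (dX A₂) * riE ^ 2) - (Complex.I / 4) • dR (wE P) := by
    have : riE ^ 2 * (dX (dX A₂) + -((Complex.I / 4) • (rE ^ 2 * wE P))) =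
        dX (dX A₂) * riE ^ 2 - (Complex.I / 4) • wE P := by
      simp only [Algebra.smul_def]
      linear_combination (-(algebraMap ℂ (smoothAlg M) (Complex.I / 4)) * wE P
        * (rE * riE + 1)) * rE_mul_riE (M := M)
    rw [this, map_sub, Derivation.map_smul]
  have e3 : dX (rE * siE * dX A₁ + (Complex.I / 8) • (rE ^ 2 * siE * vE P)) =
      rE * siE * dX (dX A₁) + (Complex.I / 8) • (rE ^ 2 * siE * dX (vE P)) := by
    simp [Derivation.leibniz, Derivation.leibniz_pow, dX_rE, dX_siE]
  have e4 : (Complex.I / 4 : ℂ) = Complex.I / 8 * 2 := by ring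
  rw [e2, e3, dX_dX_rwE, e4]
  refine ev_ext fun t r x hr => ?_
  have hr0 := radius_cast_ne_zero hr
  have hσ0 := sqrt_cast_ne_zero hr
  simp only [rwE, opD, opD', opEth', ev_add, ev_sub, ev_mul, ev_smul, ev_neg, ev_rE hr, ev_riE hr,
    ev_sE hr, ev_siE hr, ev_pow _ _ _ _ _ hr]
  generalize (√(Del M r) : ℂ) = σ at *
  field_simp
  ring

theorem Rep.vanishes_evolution (hT : IsHertzPotential M ψ) :
    Vanishes (opD (wE P) - opD' (wE P) + opEth' (vE P) - (opD (dhrE P) + opD' (dhrE P))) := by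
  have hv := vanishes_teukE h hT
  -- This is -2(D + 4ε) applied to the Teukolsky expression, the remainder in `dhr_evolution`.
  have key := ((((hv.dT.mul_left (rE * siE)).add (hv.dR.mul_left (sE * riE))).add
    ((hv.mul_left epsE).smul 4)).smul (-2))
  convert key using 1
  rw [dhr_evolution]
  simp only [opD, Algebra.smul_def, map_neg, map_ofNat]
  ring

theorem deltaDelta_rwQ_of_isMoncrief (hT : IsHertzPotential M ψ) {q₁ q₂ : Field} {A₁ A₂ : smoothAlg M}
    (h₁ : Rep M 0 q₁ A₁) (h₂ : Rep M 0 q₂ A₂)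
    (hm : IsMoncrief M (axial (hertzMetric M ψ)) q₁ q₂) {t r θ : ℝ} (he : Exterior M r θ) :
    deltaDelta (rwQ M q₁ q₂) t r θ =
      Complex.I * sqrtDel M t r θ / (4 * rt2 * (r : ℂ) ^ 2) *
        (Dr M (hertzW M ψ) t r θ + eth' (-2) 0 (hertzV M ψ) t r θ) ∧
    deltaDelta (rwQ M q₁ q₂) t r θ =
      Complex.I * sqrtDel M t r θ / (4 * rt2 * (r : ℂ) ^ 2) * Dt M (dhrScalar M ψ) t r θ := by
  have hr0 := radius_cast_ne_zero he.1
  have h2 := rt2_ne_zero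
  have d1 := (h.vanishes_rwE h₁ h₂ hm).exterior (t := t) he
  have d2 := (h.vanishes_evolution hT).exterior (t := t) he
  have e1 := (h₁.rwQ h₂).deltaDelta t r θ he
  have e2 := ((h.hertzW.npD.sub h.hertzW.npD').add
    (h.hertzV.eth' (-2) 0 (by norm_num))) t r θ he
  have e3 := (h.dhr.npD.add h.dhr.npD') t r θ he
  have e4 : Dr M (hertzW M ψ) t r θ + eth' (-2) 0 (hertzV M ψ) t r θ =
      (npD M (hertzW M ψ) - npD' M (hertzW M ψ) + eth' (-2) 0 (hertzV M ψ)) t r θ := rfl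
  have e5 : Dt M (dhrScalar M ψ) t r θ =
      (npD M (dhrScalar M ψ) + npD' M (dhrScalar M ψ)) t r θ := rfl
  rw [e4, e5, e1, e2, e3]
  simp only [opD_smul, opD'_smul, opEth'_smul, ev_add, ev_sub, ev_smul, ev_mul, ev_sE he.1,
    ev_riE he.1, ev_pow _ _ _ _ _ he.1, sqrtDel] at d1 d2 ⊢
  generalize (√(Del M r) : ℂ) = σ at *
  have hrt := rt2_sq
  constructor
  · rw [sub_eq_zero.1 d1]
    field_simp
    rw [hrt]
    ring
  · rw [sub_eq_zero.1 d1, sub_eq_zero.1 d2]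
    field_simp
    rw [hrt]
    ring

/-- The difference of the Regge-Wheeler variable and of `-i ∂_t (f + i g)` has only modes
`ℓ = 0, 1`. -/
theorem Rep.vanishes_rwE_add (hT : IsHertzPotential M ψ) {q₁ q₂ : Field} {A₁ A₂ : smoothAlg M}
    (h₁ : Rep M 0 q₁ A₁) (h₂ : Rep M 0 q₂ A₂)
    (hm : IsMoncrief M (axial (hertzMetric M ψ)) q₁ q₂) {C : smoothAlg M}
    (hC : Vanishes (rE * dhrE P + (4 : ℂ) • dX (dX C))) :
    Vanishes (dX (dX (rwE A₁ A₂ + Complex.I • dT C))) := by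
  -- The last summand cancels the D_t Ψ_DHR that the first two leave in ∂_x² Q_RW.
  have key := ((h.vanishes_rwE h₁ h₂ hm).add
    (((h.vanishes_evolution hT).mul_left sE).smul (Complex.I / 8))).add
    (hC.dT.smul (Complex.I / 4))
  convert key using 1
  rw [map_add, map_add, Derivation.map_smul, Derivation.map_smul, dX_dT, dX_dT, map_add,
    Derivation.map_smul, Derivation.leibniz, dT_rE, smul_zero, add_zero, smul_eq_mul]
  refine ev_ext fun t r x hr => ?_
  have hσ0 := sqrt_cast_ne_zero hr
  simp only [opD, opD', ev_add, ev_sub, ev_mul, ev_smul, ev_rE hr, ev_sE hr, ev_siE hr]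
  generalize (√(Del M r) : ℂ) = σ at *
  field_simp
  ring

end Hertz

end

section

variable {M : ℝ} [hM : Fact (0 < M)]

/-! ### The twist potential -/

omit hM in
theorem volH_eq (o : ℝ) (a b c : Fin 4) (t r θ : ℝ) : volH M o a b c t r θ =
    o * (coR M a t r θ * volS b c t r θ + coR M b t r θ * volS c a t r θ
      + coR M c t r θ * volS a b t r θ) := rfl

/-- The contraction of the volume form with ∂_φ rotates the gradient of ω: the rφ component sees ∂_θ
ω, the θφ component sees ∂_r ω, and the φφ component is trivial. -/
theorem isTwistPotential_iff (o : ℝ) (p : Tensor2) (ω : Field) :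
    IsTwistPotential M o (axial p) ω ↔ ∀ t r θ, Exterior M r θ →
      p 1 3 t r θ = -(o / (2 * r * √(Del M r) * Real.sin θ) * pd 2 ω t r θ) ∧
      p 2 3 t r θ = o * √(Del M r) / (2 * r * Real.sin θ) * pd 1 ω t r θ := by
  refine forall₄_congr fun t r θ he => ?_
  have hr0 := radius_cast_ne_zero he.1
  have hs0 := he.sin_ne_zero
  have hσ0 := sqrt_cast_ne_zero he.1
  have hΔ : (Del M r : ℂ) = (√(Del M r) : ℂ) ^ 2 := by
    rw [← Complex.ofReal_pow, Real.sq_sqrt (Del_pos hM.out he.1).le]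
  have hsum : ∀ a, ∑ b ∈ slice, ∑ c ∈ slice, (∑ d ∈ slice, ∑ e ∈ slice,
        volH M o a d e t r θ * invMetric M d b t r θ * invMetric M e c t r θ)
          * metric M c 3 t r θ * pd b ω t r θ =
      volH M o a 1 3 t r θ * invMetric M 1 1 t r θ * pd 1 ω t r θ
        + volH M o a 2 3 t r θ * invMetric M 2 2 t r θ * pd 2 ω t r θ := by
    intro a
    have hm : invMetric M 3 3 t r θ * metric M 3 3 t r θ = 1 := by
      rw [invMetric_self, metric_self]
      simp only [metricDiag, Pi.inv_apply]
      push_cast at hs0 ⊢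
      field_simp
    simp only [slice, Finset.sum_insert (show (1 : Fin 4) ∉ ({2, 3} : Finset (Fin 4)) by decide),
      Finset.sum_insert (show (2 : Fin 4) ∉ ({3} : Finset (Fin 4)) by decide), Finset.sum_singleton,
      invMetric_of_ne (show (1 : Fin 4) ≠ 2 by decide),
      invMetric_of_ne (show (1 : Fin 4) ≠ 3 by decide),
      invMetric_of_ne (show (2 : Fin 4) ≠ 1 by decide),
      invMetric_of_ne (show (2 : Fin 4) ≠ 3 by decide),
      invMetric_of_ne (show (3 : Fin 4) ≠ 1 by decide),
      invMetric_of_ne (show (3 : Fin 4) ≠ 2 by decide),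
      metric_of_ne (show (1 : Fin 4) ≠ 3 by decide), metric_of_ne (show (2 : Fin 4) ≠ 3 by decide),
      Pi.zero_apply, pd_three]
    linear_combination (volH M o a 1 3 t r θ * invMetric M 1 1 t r θ * pd 1 ω t r θ
        + volH M o a 2 3 t r θ * invMetric M 2 2 t r θ * pd 2 ω t r θ) * hm
  have s1 : reflSign 1 = 1 := if_neg (by decide)
  have s2 : reflSign 2 = 1 := if_neg (by decide)
  have s3 : reflSign 3 = -1 := if_pos rfl
  have half : ∀ z : ℂ, 1 / 2 * (z - 1 * -1 * z) = z := fun z => by ring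
  have none : ∀ z : ℂ, 1 / 2 * (z - -1 * -1 * z) = 0 := fun z => by ring
  have v13 : ∀ t r θ, volS 1 3 t r θ = 0 := fun t r θ => by rw [(volS_one 3).1]; rfl
  have v31 : ∀ t r θ, volS 3 1 t r θ = 0 := fun t r θ => by rw [(volS_one 3).2]; rfl
  have v12 : ∀ t r θ, volS 1 2 t r θ = 0 := fun t r θ => by rw [(volS_one 2).1]; rfl
  have v21 : ∀ t r θ, volS 2 1 t r θ = 0 := fun t r θ => by rw [(volS_one 2).2]; rfl
  have v32 : volS 3 2 t r θ = -volS 2 3 t r θ := by rw [volS_three_two, volS_two_three]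
  simp only [hsum]
  simp only [slice, Finset.mem_insert, Finset.mem_singleton, forall_eq_or_imp, forall_eq,
    axial, Pi.smul_apply, Pi.sub_apply, smul_eq_mul, s1, s2, s3, half, none, volH_eq, v13, v31, v12,
    v21, v32, volS_self, coR_one he, coR_two, coR_three, Pi.zero_apply, volS_two_three,
    metric_self, invMetric_self, Pi.inv_apply, metricDiag]
  push_cast at hs0 ⊢
  rw [hΔ]
  generalize (√(Del M r) : ℂ) = σ at *
  simp only [mul_zero, zero_mul, add_zero, zero_add, and_true]
  refine and_congr (Eq.congr_right ?_) (Eq.congr_right ?_) <;> field_simp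

section Hertz

variable {ψ : Field} {P : smoothAlg M} (h : Rep M 2 ψ P)
include h

theorem Rep.isTwistPotential_iff {o : ℝ} (ho : o = 1 ∨ o = -1) {ω : Field} {A : smoothAlg M}
    (hω : Rep M 0 ω A) :
    IsTwistPotential M o (axial (admMomentum M (hertzMetric M ψ))) ω ↔
      Vanishes (dX A - (o * (Complex.I / 4)) • ((1 - xE ^ 2) * (rE ^ 3 * opEth 2 (dhrE P)))) ∧
      Vanishes (dR A - (o * (Complex.I / 4)) • ((1 - xE ^ 2) ^ 2 * (rE * siE *
        (rE * siE * (-(rE ^ 2 * dT (wE P)) - (1 / 2 : ℂ) • (sE * dX (vE P))))))) := by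
  -- As o² = 1, the orientation sign can be moved across the equations.
  have ho2 : (o : ℂ) * o = 1 := by rcases ho with rfl | rfl <;> norm_num
  have e : ∀ t r θ, Exterior M r θ →
      ((admMomentum M (hertzMetric M ψ) 1 3 t r θ =
          -(o / (2 * r * √(Del M r) * Real.sin θ) * pd 2 ω t r θ) ↔
        ev (dX A - (o * (Complex.I / 4)) • ((1 - xE ^ 2) * (rE ^ 3 * opEth 2 (dhrE P))))
          t r (Real.cos θ) = 0) ∧
      (admMomentum M (hertzMetric M ψ) 2 3 t r θ =
          o * √(Del M r) / (2 * r * Real.sin θ) * pd 1 ω t r θ ↔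
        ev (dR A - (o * (Complex.I / 4)) • ((1 - xE ^ 2) ^ 2 * (rE * siE *
        (rE * siE * (-(rE ^ 2 * dT (wE P)) - (1 / 2 : ℂ) • (sE * dX (vE P)))))))
          t r (Real.cos θ) = 0)) := by
    intro t r θ he
    have hr0 := radius_cast_ne_zero he.1
    have hs0 := he.sin_ne_zero
    have hσ0 := sqrt_cast_ne_zero he.1
    rw [h.momentum_one_three t r θ he, h.momentum_two_three t r θ he, hω.pd_two_zero t r θ he,
      hω.pd_one t r θ he]
    generalize opEth 2 (dhrE P) = Y
    generalize -(rE ^ 2 * dT (wE P)) - (1 / 2 : ℂ) • (sE * dX (vE P)) = X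
    simp only [ev_sub, ev_mul, ev_smul, ev_neg, ev_pow _ _ _ _ _ he.1, ev_rE he.1, ev_siE he.1,
      ev_xE he.1, ev_one _ _ _ he.1, cos_sq_cast, sub_sub_cancel]
    generalize (√(Del M r) : ℂ) = σ at *
    push_cast at hs0 ⊢
    constructor
    · constructor <;> intro hh
      · field_simp at hh
        linear_combination (-(o : ℂ) / 8) * hh - ev (dX A) t r (Real.cos θ) * ho2
      · field_simp
        linear_combination (-8 * (o : ℂ)) * hh
          - 2 * Complex.I * Complex.sin θ ^ 2 * r ^ 3 * ev Y t r (Real.cos θ) * ho2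
    · constructor <;> intro hh
      · field_simp at hh ⊢
        linear_combination (-(o : ℂ) / 2) * hh - 4 * σ ^ 2 * ev (dR A) t r (Real.cos θ) * ho2
      · field_simp at hh ⊢
        linear_combination (-2 * (o : ℂ)) * hh
          - 2 * Complex.I * Complex.sin θ ^ 4 * r ^ 2 * ev X t r (Real.cos θ) * ho2
  rw [Schwarzschild.isTwistPotential_iff]
  constructor
  · intro hh
    exact ⟨vanishes_of_exterior fun t r θ he => (e t r θ he).1.1 (hh t r θ he).1,
      vanishes_of_exterior fun t r θ he => (e t r θ he).2.1 (hh t r θ he).2⟩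
  · rintro ⟨v₁, v₂⟩ t r θ he
    exact ⟨(e t r θ he).1.2 (v₁.exterior he), (e t r θ he).2.2 (v₂.exterior he)⟩

/-- The twist potential in the algebra. -/
def twistE (o : ℝ) (P : smoothAlg M) : smoothAlg M :=
  (-(o : ℂ) * (Complex.I / 4)) • ((1 - xE ^ 2) ^ 2 * (rE ^ 2 * dhrE P))

theorem Rep.axisRep_twist (o : ℝ) :
    AxisRep M ((-(o : ℂ) * (Complex.I / 2)) • (rad ^ 2 * sinF ^ 2 * dhrScalar M ψ))
      (twistE o P) := by
  intro t r θ hr h0 hπ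
  have hcos := cos_sq_cast θ
  simp only [twistE, Pi.smul_apply, Pi.mul_apply, Pi.pow_apply, smul_eq_mul, rad, sinF, ev_smul,
    ev_mul, ev_sub, ev_pow _ _ _ _ _ hr, ev_xE hr, ev_rE hr, ev_one _ _ _ hr, hcos, sub_sub_cancel]
  by_cases hs : Real.sin θ = 0
  -- On the axis the value of Ψ_DHR is irrelevant, because both sides carry a factor sin θ.
  · simp [hs]
  · have he : Exterior M r θ := by
      refine ⟨hr, lt_of_le_of_ne h0 ?_, lt_of_le_of_ne hπ ?_⟩
      · rintro rfl
        exact hs Real.sin_zero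
      · rintro rfl
        exact hs Real.sin_pi
    rw [h.dhr t r θ he, ev_smul]
    ring

/-- The θ-equation is an identity, since (1 - x²) r `opEth 2` is -∂_x of (1 - x²)² times the
argument. Only the r-equation uses the Teukolsky equation, through `twist_radial`. -/
theorem Rep.isTwistPotential_twist (hT : IsHertzPotential M ψ) {o : ℝ} (ho : o = 1 ∨ o = -1) :
    IsTwistPotential M o (axial (admMomentum M (hertzMetric M ψ)))
      ((-(o : ℂ) * (Complex.I / 2)) • (rad ^ 2 * sinF ^ 2 * dhrScalar M ψ)) := by
  rw [h.isTwistPotential_iff ho (h.axisRep_twist o).rep]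
  have hv := vanishes_teukE h hT
  constructor
  · have e : dX (twistE o P) -
        (o * (Complex.I / 4)) • ((1 - xE ^ 2) * (rE ^ 3 * opEth 2 (dhrE P))) = 0 := by
      have h1 := rE_mul_riE (M := M)
      simp only [twistE, opEth, Derivation.leibniz, Derivation.leibniz_pow, Derivation.map_smul,
        map_sub, Derivation.map_one_eq_zero, dX_xE, dX_rE, smul_eq_mul, nsmul_eq_mul]
      simp only [Algebra.smul_def, map_mul, map_neg, map_ofNat]
      push_cast
      generalize algebraMap ℂ (smoothAlg M) o = a
      generalize algebraMap ℂ (smoothAlg M) (Complex.I / 4) = b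
      linear_combination (-a * b * (1 - xE ^ 2) * rE ^ 2 *
        (4 * xE * dhrE P - (1 - xE ^ 2) * dX (dhrE P))) * h1
    rw [e]
    exact fun t r x hr _ => ev_zero _ _ _
  · have key := ((((hv.dT.mul_left (rE * siE)).add (hv.dR.mul_left (sE * riE))).add
      ((hv.mul_left epsE).smul 4)).mul_left ((1 - xE ^ 2) ^ 2 * (rE ^ 3 * siE))).smul
        (o * (Complex.I / 4))
    convert key using 1
    have ht := twist_radial P
    have h1 := rE_mul_riE (M := M)
    have h2 := sE_mul_siE (M := M)
    generalize -(rE ^ 2 * dT (wE P)) - (1 / 2 : ℂ) • (sE * dX (vE P)) = X at *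
    have e : dR (twistE o P) =
        (-(o : ℂ) * (Complex.I / 4)) • ((1 - xE ^ 2) ^ 2 * dR (rE ^ 2 * dhrE P)) := by
      rw [twistE, Derivation.map_smul, Derivation.leibniz]
      simp [Derivation.leibniz_pow, dR_xE]
    rw [e]
    simp only [opD, Algebra.smul_def, map_mul, map_neg, map_ofNat] at ht ⊢
    generalize algebraMap ℂ (smoothAlg M) o = a
    generalize algebraMap ℂ (smoothAlg M) (Complex.I / 4) = b
    generalize dR (rE ^ 2 * dhrE P) = Z at *
    have h3 : (rE * siE) * (sE * riE) = (1 : smoothAlg M) := by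
      linear_combination rE * riE * h2 + h1
    linear_combination (-a * b * (1 - xE ^ 2) ^ 2 * rE * siE) * ht
      + a * b * (1 - xE ^ 2) ^ 2 * Z * h3

/-- The difference of two twist potentials has vanishing ∂_x and ∂_r on [-1, 1] and on the connected
half-line r > 2M, so it depends on t alone. -/
theorem Rep.twist_unique (hT : IsHertzPotential M ψ) {o : ℝ} (ho : o = 1 ∨ o = -1) {ω : Field}
    {A : smoothAlg M} (hA : AxisRep M ω A)
    (hω : IsTwistPotential M o (axial (admMomentum M (hertzMetric M ψ))) ω) :
    ∀ t r r' x x' : ℝ, 2 * M < r → 2 * M < r' → x ∈ Set.Icc (-1 : ℝ) 1 →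
      x' ∈ Set.Icc (-1 : ℝ) 1 →
      ev (A - twistE o P) t r x = ev (A - twistE o P) t r' x' := by
  obtain ⟨v₁, v₂⟩ := (h.isTwistPotential_iff ho hA.rep).1 hω
  obtain ⟨w₁, w₂⟩ := (h.isTwistPotential_iff ho (h.axisRep_twist o).rep).1
    (h.isTwistPotential_twist hT ho)
  have d₁ : Vanishes (dX (A - twistE o P)) := by
    rw [map_sub, ← sub_sub_sub_cancel_right]
    exact v₁.sub w₁
  have d₂ : Vanishes (dR (A - twistE o P)) := by
    rw [map_sub, ← sub_sub_sub_cancel_right]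
    exact v₂.sub w₂
  intro t r r' x x' hr hr' hx hx'
  rw [d₁.ev_eq hr hx hx']
  refine isOpen_Ioi.is_const_of_deriv_eq_zero (f := fun s => ev (A - twistE o P) t s x')
    (s := Set.Ioi (2 * M)) isPreconnected_Ioi (fun s hs =>
      (hasDerivAt_ev_r _ hs).differentiableAt.differentiableWithinAt) (fun s hs => ?_) hr hr'
  rw [(hasDerivAt_ev_r _ hs).deriv]
  exact d₂ t s x' hs hx'

end Hertz

end

/-! ### Existence of the potentials and their relation to Ψ_DHR and Q_RW -/

section

variable {M : ℝ} [hM : Fact (0 < M)]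

section Hertz

variable {ψ : Field} {P : smoothAlg M} (h : Rep M 2 ψ P)
include h

theorem exists_potentials :
    ∃ q₁ q₂ p₁ p₂ : Field, ∃ f g : ℝ → ℝ → ℝ → ℝ,
      (∀ ξ ∈ ({q₁, q₂, p₁, p₂, ofRealF f, ofRealF g} : Set Field),
        SmoothSpin M 0 ξ ∧ NoLowModes M ξ) ∧
      IsMoncrief M (axial (hertzMetric M ψ)) q₁ q₂ ∧
      IsMoncrief M (axial (admMomentum M (hertzMetric M ψ))) p₁ p₂ ∧
      IsDHRPotentials M ψ f g := by
  -- The extra factor 2 is the one in `vE_eq`, which exhibits V as ð of χ, the form needed for the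
  -- absence of an ℓ = 1 mode.
  obtain ⟨A₁, hA₁, lA₁⟩ := exists_primitive_noLowModes (-(Complex.I / 8) * 2) (chiE P)
  obtain ⟨A₂, hA₂, lA₂⟩ := exists_second_primitive_noLowModes ((Complex.I / 4) • (rE ^ 2 * wE P))
  obtain ⟨B₁, hB₁, lB₁⟩ := exists_primitive_noLowModes (-(Complex.I / 8)) (dhrE P)
  obtain ⟨B₂, hB₂, lB₂⟩ := exists_second_primitive_noLowModes (-((Complex.I / 8) •
        (rE * siE * (-(rE ^ 2 * dT (wE P)) - (1 / 2 : ℂ) • (sE * dX (vE P))))))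
  -- The complex potential f + ig; f and g are its real and imaginary parts.
  obtain ⟨C, hC, lC⟩ := exists_second_primitive_noLowModes (-((1 / 4 : ℂ) • (rE * dhrE P)))
  let reL : ℂ →L[ℝ] ℂ := Complex.ofRealCLM.comp Complex.reCLM
  let imL : ℂ →L[ℝ] ℂ := Complex.ofRealCLM.comp Complex.imCLM
  have hf : AxisRep M (ofRealF fun t r θ => (ev C t r (Real.cos θ)).re) (mapE reL C) :=
    fun t r θ hr _ _ => (ev_mapE reL C hr).symm
  have hg : AxisRep M (ofRealF fun t r θ => (ev C t r (Real.cos θ)).im) (mapE imL C) :=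
    fun t r θ hr _ _ => (ev_mapE imL C hr).symm
  have hsum : mapE reL C + Complex.I • mapE imL C = C := ev_ext fun t r x hr => by
    rw [ev_add, ev_smul, ev_mapE _ _ hr, ev_mapE _ _ hr, mul_comm]
    exact Complex.re_add_im _
  have low : ∀ L : ℂ →L[ℝ] ℂ, moment (mapE L C) = 0 ∧ moment (xE * mapE L C) = 0 := fun L =>
    ⟨by rw [moment_mapE, lC.1, mapE_zero], by rw [xE_mul_mapE, moment_mapE, lC.2, mapE_zero]⟩
  have van : ∀ G : smoothAlg M, G = 0 → Vanishes G := fun G hG t r x _ _ => by rw [hG, ev_zero]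
  refine ⟨toField A₁, toField A₂, toField B₁, toField B₂, _, _, ?_,
    (h.isMoncrief_metric_iff (axisRep_toField A₁).rep (axisRep_toField A₂).rep).2
      ⟨van _ ?_, van _ ?_⟩,
    (h.isMoncrief_momentum_iff (axisRep_toField B₁).rep (axisRep_toField B₂).rep).2
      ⟨van _ ?_, van _ ?_⟩,
    (h.isDHRPotentials_iff hf.rep hg.rep).2 (van _ ?_)⟩
  · have good : ∀ {ξ : Field} {G : smoothAlg M}, AxisRep M ξ G →
        (moment G = 0 ∧ moment (xE * G) = 0) → SmoothSpin M 0 ξ ∧ NoLowModes M ξ :=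
      fun hr hl => ⟨hr.smoothSpin, hr.noLowModes_iff.2 hl⟩
    simp only [Set.mem_insert_iff, Set.mem_singleton_iff]
    rintro ξ (rfl | rfl | rfl | rfl | rfl | rfl)
    exacts [good (axisRep_toField A₁) lA₁, good (axisRep_toField A₂) lA₂,
      good (axisRep_toField B₁) lB₁, good (axisRep_toField B₂) lB₂, good hf (low _),
      good hg (low _)]
  · rw [hA₁, vE_eq]
    simp only [Algebra.smul_def, map_mul, map_neg, map_ofNat]
    ring
  · rw [hA₂, add_neg_cancel]
  · rw [hB₁]
    simp only [Algebra.smul_def, map_neg]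
    ring
  · rw [hB₂, neg_add_cancel]
  · rw [hsum, hC, smul_neg, smul_smul]
    norm_num

theorem dhrScalar_eq_deltaDelta {f g : ℝ → ℝ → ℝ → ℝ} {F G : smoothAlg M}
    (hf : Rep M 0 (ofRealF f) F) (hg : Rep M 0 (ofRealF g) G) (hfg : IsDHRPotentials M ψ f g)
    {t r θ : ℝ} (he : Exterior M r θ) :
    dhrScalar M ψ t r θ = -4 * r * deltaDelta (ofRealF f + Complex.I • ofRealF g) t r θ := by
  have hr0 := radius_cast_ne_zero he.1
  have v := ((h.isDHRPotentials_iff hf hg).1 hfg).exterior (t := t) he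
  rw [(hf.add (hg.smul Complex.I)).deltaDelta t r θ he, h.dhr t r θ he]
  simp only [ev_add, ev_smul, ev_mul, ev_rE he.1, ev_riE he.1, ev_pow _ _ _ _ _ he.1] at v ⊢
  generalize ev (dX (dX (F + Complex.I • G))) t r (Real.cos θ) = c at *
  field_simp
  linear_combination (Real.sin θ : ℂ) ^ 2 * v

theorem rwQ_eq_pd {f g : ℝ → ℝ → ℝ → ℝ} {F G : smoothAlg M} (hT : IsHertzPotential M ψ)
    (hf : AxisRep M (ofRealF f) F) (hg : AxisRep M (ofRealF g) G)
    (hfg : IsDHRPotentials M ψ f g) {q₁ q₂ : Field} {A₁ A₂ : smoothAlg M}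
    (h₁ : AxisRep M q₁ A₁) (h₂ : AxisRep M q₂ A₂)
    (hm : IsMoncrief M (axial (hertzMetric M ψ)) q₁ q₂) :
    (∃ a b : ℝ → ℝ → ℂ, ∀ t r θ, Exterior M r θ →
      rwQ M q₁ q₂ t r θ = -Complex.I * pd 0 (ofRealF f + Complex.I • ofRealF g) t r θ
        + (a t r + b t r * Real.cos θ)) ∧
    (NoLowModes M q₁ → NoLowModes M q₂ → NoLowModes M (ofRealF f) → NoLowModes M (ofRealF g) →
      ∀ t r θ, Exterior M r θ →
        rwQ M q₁ q₂ t r θ = -Complex.I * pd 0 (ofRealF f + Complex.I • ofRealF g) t r θ) := by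
  have v := h.vanishes_rwE_add hT h₁.rep h₂.rep hm ((h.isDHRPotentials_iff hf.rep hg.rep).1 hfg)
  have hC := (hf.rep.add (hg.rep.smul Complex.I)).pd_zero
  have hQ := h₁.rep.rwQ h₂.rep
  constructor
  · set S := rwE A₁ A₂ + Complex.I • dT (F + Complex.I • G) with hS
    -- The value and the slope at x = 0 of a function that is linear on [-1, 1].
    refine ⟨fun t r => ev S t r 0, fun t r => ev (dX S) t r 0, fun t r θ he => ?_⟩
    have w := (vanishes_sub_linearPart v).exterior (t := t) he
    rw [hQ t r θ he, hC t r θ he]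
    simp only [linearPart, ev_sub, ev_add, ev_mul, ev_atX _ _ he.1, ev_pow _ _ _ _ _ he.1,
      ev_xE he.1] at w
    have e : ev S t r (Real.cos θ) = ev (rwE A₁ A₂) t r (Real.cos θ)
        + Complex.I * ev (dT (F + Complex.I • G)) t r (Real.cos θ) := by
      rw [hS, ev_add, ev_smul]
    linear_combination w - e
  · intro l₁ l₂ lf lg t r θ he
    rw [h₁.noLowModes_iff] at l₁
    rw [h₂.noLowModes_iff] at l₂
    rw [hf.noLowModes_iff] at lf
    rw [hg.noLowModes_iff] at lg
    have w := (vanishes_of_moments v ?_ ?_).exterior (t := t) he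
    · rw [hQ t r θ he, hC t r θ he]
      rw [ev_add, ev_smul] at w
      linear_combination w
    · rw [moment_add, moment_rwE l₁.1 l₂.1, moment_smul, moment_dT, moment_add, moment_smul, lf.1,
        lg.1]
      simp
    · have e : xE * (rwE A₁ A₂ + Complex.I • dT (F + Complex.I • G)) =
          rwE (xE * A₁) (xE * A₂) + Complex.I • dT (xE * F + Complex.I • (xE * G)) := by
        rw [← xE_mul_rwE, map_add, map_add, Derivation.map_smul, Derivation.map_smul,
          Derivation.leibniz, Derivation.leibniz, dT_xE]
        simp only [smul_eq_mul]
        simp only [Algebra.smul_def]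
        ring
      rw [e, moment_add, moment_rwE l₁.2 l₂.2, moment_smul, moment_dT, moment_add, moment_smul,
        lf.2, lg.2]
      simp

end Hertz

end

end Schwarzschild

end

/-! ### The main theorem -/

open Schwarzschild in
theorem mainTheorem5 (M : ℝ) (hM : 0 < M) (psi4 ψ : Field) (hreg : SmoothSpin M 2 psi4)
    (hψ : ψ = rad ^ 4 * psi4) (hTeu : IsHertzPotential M ψ) :
    -- the potentials exist
    (∃ q₁ q₂ p₁ p₂ : Field, ∃ f g : ℝ → ℝ → ℝ → ℝ,
      (∀ ξ ∈ ({q₁, q₂, p₁, p₂, ofRealF f, ofRealF g} : Set Field),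
        SmoothSpin M 0 ξ ∧ NoLowModes M ξ) ∧
      IsMoncrief M (axial (hertzMetric M ψ)) q₁ q₂ ∧
      IsMoncrief M (axial (admMomentum M (hertzMetric M ψ))) p₁ p₂ ∧
      IsDHRPotentials M ψ f g) ∧
    -- the Regge-Wheeler variable
    (∀ q₁ q₂ : Field, SmoothSpin M 0 q₁ → SmoothSpin M 0 q₂ →
      IsMoncrief M (axial (hertzMetric M ψ)) q₁ q₂ →
      ∀ t r θ, Exterior M r θ →
        deltaDelta (rwQ M q₁ q₂) t r θ =
          Complex.I * sqrtDel M t r θ / (4 * rt2 * (r : ℂ) ^ 2) *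
            (Dr M (hertzW M ψ) t r θ + eth' (-2) 0 (hertzV M ψ) t r θ) ∧
        deltaDelta (rwQ M q₁ q₂) t r θ =
          Complex.I * sqrtDel M t r θ / (4 * rt2 * (r : ℂ) ^ 2) * Dt M (dhrScalar M ψ) t r θ) ∧
    -- its conjugate momentum
    (∀ p₁ p₂ : Field, SmoothSpin M 0 p₁ → SmoothSpin M 0 p₂ →
      IsMoncrief M (axial (admMomentum M (hertzMetric M ψ))) p₁ p₂ →
      ∀ t r θ, Exterior M r θ →
        rwP M p₁ t r θ = -Complex.I * (r / (2 * Del M r)) *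
          eth (-1) 1 (thorn M (-2) 0 (hertzV M ψ) + spinRho M * hertzV M ψ) t r θ ∧
        rwP M p₁ t r θ = -Complex.I * (r / Del M r) *
          eth (-1) 1 (eth (-2) 2 (dhrScalar M ψ)) t r θ) ∧
    -- the potentials of the DHR variable
    (∀ f g : ℝ → ℝ → ℝ → ℝ, SmoothSpin M 0 (ofRealF f) → SmoothSpin M 0 (ofRealF g) →
      IsDHRPotentials M ψ f g →
      (∀ t r θ, Exterior M r θ →
        dhrScalar M ψ t r θ =
          -4 * r * deltaDelta (ofRealF f + Complex.I • ofRealF g) t r θ) ∧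
      ∀ q₁ q₂ : Field, SmoothSpin M 0 q₁ → SmoothSpin M 0 q₂ →
        IsMoncrief M (axial (hertzMetric M ψ)) q₁ q₂ →
        (∃ a b : ℝ → ℝ → ℂ, ∀ t r θ, Exterior M r θ →
          rwQ M q₁ q₂ t r θ =
            -Complex.I * pd 0 (ofRealF f + Complex.I • ofRealF g) t r θ
              + (a t r + b t r * Real.cos θ)) ∧
        (NoLowModes M q₁ → NoLowModes M q₂ →
          NoLowModes M (ofRealF f) → NoLowModes M (ofRealF g) →
          ∀ t r θ, Exterior M r θ →
            rwQ M q₁ q₂ t r θ =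
              -Complex.I * pd 0 (ofRealF f + Complex.I • ofRealF g) t r θ)) ∧
    -- the twist potential, for either orientation of the slices
    (∀ o : ℝ, o = 1 ∨ o = -1 → ∀ ω₀ : Field,
      ω₀ = (-(o : ℂ) * (Complex.I / 2)) • (rad ^ 2 * sinF ^ 2 * dhrScalar M ψ) →
      SmoothSpin M 0 ω₀ ∧
      IsTwistPotential M o (axial (admMomentum M (hertzMetric M ψ))) ω₀ ∧
      ∀ ω : Field, SmoothSpin M 0 ω →
        IsTwistPotential M o (axial (admMomentum M (hertzMetric M ψ))) ω →
        (∃ c : ℝ → ℂ, ∀ t r θ, Exterior M r θ → ω t r θ = ω₀ t r θ + c t) ∧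
        ((∀ t r, 2 * M < r → ω t r 0 = 0) →
          ∀ t r θ, Exterior M r θ → ω t r θ = ω₀ t r θ)) := by
  have : Fact (0 < M) := ⟨hM⟩
  obtain ⟨F, hF⟩ := hreg.exists_rep
  have h : Rep M 2 ψ (rE ^ 4 * F) := fun t r θ he => by
    rw [hψ, Pi.mul_apply, Pi.mul_apply, Pi.mul_apply, hF t r θ he, ev_mul,
      ev_pow _ _ _ _ _ he.1, ev_rE he.1]
    simp only [Pi.pow_apply, rad]
    ring
  refine ⟨exists_potentials h, ?_, ?_, ?_, ?_⟩
  · intro q₁ q₂ hq₁ hq₂ hm t r θ he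
    obtain ⟨A₁, h₁⟩ := hq₁.exists_rep
    obtain ⟨A₂, h₂⟩ := hq₂.exists_rep
    exact deltaDelta_rwQ_of_isMoncrief h hTeu h₁ h₂ hm he
  · intro p₁ p₂ hp₁ hp₂ hm t r θ he
    obtain ⟨B₁, h₁⟩ := hp₁.exists_rep
    obtain ⟨B₂, h₂⟩ := hp₂.exists_rep
    exact rwP_of_isMoncrief h h₁ h₂ hm he
  · intro f g hf hg hfg
    obtain ⟨F', hf⟩ := hf.exists_axisRep
    obtain ⟨G', hg⟩ := hg.exists_axisRep
    refine ⟨fun t r θ he => dhrScalar_eq_deltaDelta h hf.rep hg.rep hfg he,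
      fun q₁ q₂ hq₁ hq₂ hm => ?_⟩
    obtain ⟨A₁, h₁⟩ := hq₁.exists_axisRep
    obtain ⟨A₂, h₂⟩ := hq₂.exists_axisRep
    exact rwQ_eq_pd h hTeu hf hg hfg h₁ h₂ hm
  · rintro o ho ω₀ rfl
    have h₀ := h.axisRep_twist o
    refine ⟨h₀.smoothSpin, h.isTwistPotential_twist hTeu ho, fun ω hω ht => ?_⟩
    obtain ⟨A, hA⟩ := hω.exists_axisRep
    have key := h.twist_unique hTeu ho hA ht
    -- Any radius above 2M and any x in [-1, 1] serve as reference point for c(t).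
    refine ⟨⟨fun t => ev (A - twistE o (rE ^ 4 * F)) t (2 * M + 1) 0, fun t r θ he => ?_⟩,
      fun hax t r θ he => ?_⟩
    · beta_reduce
      rw [hA.rep t r θ he, h₀.rep t r θ he, ← key t r (2 * M + 1) (Real.cos θ) 0 he.1 (by linarith)
        (Set.Ioo_subset_Icc_self he.cos_mem) (by norm_num), ev_sub]
      ring
    -- The reference point x = 1 is the axis θ = 0, where both potentials vanish.
    · have k := key t r r (Real.cos θ) 1 he.1 he.1 (Set.Ioo_subset_Icc_self he.cos_mem)
        (by norm_num)
      have a1 := hA t r 0 he.1 le_rfl Real.pi_pos.le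
      have a2 := h₀ t r 0 he.1 le_rfl Real.pi_pos.le
      rw [hax t r he.1] at a1
      simp only [Pi.smul_apply, Pi.mul_apply, Pi.pow_apply, sinF, Real.sin_zero, smul_eq_mul,
        Complex.ofReal_zero, Real.cos_zero] at a1 a2
      rw [ev_sub, ev_sub, ← a1, ← a2] at k
      rw [hA.rep t r θ he, h₀.rep t r θ he]
      linear_combination k
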